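/- Let $\ell>0$, $\alpha,\beta,\gamma,\delta\in\mathbb{R}$, $s\ge 2$ and $\epsilon>0$. **Notation.** For $s,r\ge 0$ let $H^s_r(\mathbb{R})$ be the weighted Sobolev space of real functions with norm $\|u\|_{H^s_r(\mathbb{R})}=\|(1-\partial_x^2)^{s/2}[(1+x^2)^{r/2}u]\|_{L^2(\mathbb{R})}$. For $j\ge 0$ let $\phi_{2j}$ and $\phi_{2j+1}$ be the real and the imaginary part of $2\sqrt{\ell/\pi}\,(\ell+2ix)^j(\ell-2ix)^{-j-1}$ (the Malmquist–Takenaka–Christov functions, an orthonormal system in $L^2(\mathbb{R})$). For odd $n\in\mathbb{N}$ let $\mathbb{P}_n=\mathrm{span}\{\phi_0,\dots,\phi_n\}$, let $\mathcal{P}_n[u]=\sum_{k=0}^n\langle u,\phi_k\rangle_{L^2(\mathbb{R})}\phi_k$, let $\mathcal{I}_n[f]\in\mathbb{P}_n$ be the function that interpolates $f$ at the nodes $x_i=\frac{\ell}{2}\tan\frac{\pi(2i-n)}{2(n+1)}$, $0\le i\le n$, and let $\mathcal{J}_n=-\mathcal{P}_n\partial_x\mathcal{P}_n$. Let $\mathcal{H}$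 be the Hilbert transform (the Fourier multiplier $-i\,\mathrm{sgn}\,\xi$) and let $\mathcal{I}$ be the identity. For $v\in\mathbb{P}_n$ put $$\mathcal{G}_n(v)=\tfrac12\int_{\mathbb{R}}\Bigl(\alpha|v|^2-\beta v\mathcal{H}[\mathcal{J}_nv]+\gamma|\mathcal{J}_nv|^2+\tfrac{2\delta}{3}v\,\mathcal{I}_n[v^2]\Bigr)dx .$$ For a function $u=u(t)=u(t,\cdot)$, $t\in[0,T]$, put $u_0=u(0)$, $\tilde u=\mathcal{P}_n[u]$, $e_0=\mathcal{P}_n[u_0]-\mathcal{I}_n[u_0]$, $$\mathcal{E}_n(e,t)=2\delta\langle\tilde u(t),\mathcal{I}_n[e^2]\rangle_{L^2(\mathbb{R})},$$ $$\mathcal{D}_n(e,t)=\bigl\langle e,\ \alpha(\mathcal{I}-\mathcal{P}_n)[u](t)+\beta\mathcal{H}[(\partial_x+\mathcal{J}_n)u](t)-\gamma(\partial_x^2-\mathcal{J}_n^2)[u](t)+\delta\bigl(u^2(t)-\mathcal{I}_n[\tilde u^2](t)\bigr)\bigr\rangle_{L^2(\mathbb{R})},$$ and let $\nabla_e$ denote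 the $L^2(\mathbb{R})$-gradient in $e$; as $\mathcal{D}_n$ is linear in $e$, $\nabla_e\mathcal{D}_n(e,t)$ does not depend on $e$. **Claim.** There is a constant $c>0$, depending only on $\ell,\alpha,\beta,\gamma,\delta,s,\epsilon$, such that for all odd $n\in\mathbb{N}$, all $T>0$ and all $u$ with $u,u_t\in L^\infty([0,T],H^s_{2s}(\mathbb{R}))$ (where $u_t$ is the weak time derivative, and $u$ is taken to be its representative that is continuous in time): \begin{align*} &\|e_0\|_{L^2(\mathbb{R})}\le c\bigl(\tfrac{\ell n}{2}\bigr)^{\frac32+\epsilon-s}\|u_0\|_{H^s_{2s}(\mathbb{R})},\\ &|\mathcal{G}_n(-e_0)|^{\frac12}\le c\bigl(\tfrac{\ell n}{2}\bigr)^{\frac52+\epsilon-s}\bigl(\|u_0\|_{H^s_{2s}(\mathbb{R})}+\|u_0\|_{H^s_{2s}(\mathbb{R})}^{\frac53}\bigr),\\ &|\mathcal{E}_n(e_0,0)|^{\frac12}\le c\bigl(\tfrac{\ell n}{2}\bigr)^{\frac32+\epsilon-s}\|u_0\|_{H^s_{2s}(\mathbb{R})}^{\frac32},\\ &|\mathcal{D}_n(e_0,0)|^{\frac12}\le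 c\bigl(\tfrac{\ell n}{2}\bigr)^{\frac{7+2\epsilon}{4}-s}\bigl(\|u_0\|_{H^s_{2s}(\mathbb{R})}+\|u_0\|_{H^s_{2s}(\mathbb{R})}^{\frac32}\bigr),\\ &\|\nabla_e\mathcal{D}_n(e,t)\|_{L^2([0,T]\times\mathbb{R})}\le c\bigl(\tfrac{\ell n}{2}\bigr)^{2-s}\Bigl(\|u\|_{L^2([0,T],H^s_{2s}(\mathbb{R}))}+\|u\|^2_{L^4([0,T],H^s_{2s}(\mathbb{R}))}\Bigr), \end{align*} the weak time derivative $\partial_t\nabla_e\mathcal{D}_n(e,t)$ exists in $L^2([0,T]\times\mathbb{R})$, and $$\|\partial_t\nabla_e\mathcal{D}_n(e,t)\|_{L^2([0,T]\times\mathbb{R})}\le c\bigl(\tfrac{\ell n}{2}\bigr)^{2-s}\Bigl(\|u_t\|_{L^2([0,T],H^s_{2s}(\mathbb{R}))}+\|u\|_{L^4([0,T],H^s_{2s}(\mathbb{R}))}\|u_t\|_{L^4([0,T],H^s_{2s}(\mathbb{R}))}\Bigr).$$ -/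

import Mathlib

open MeasureTheory Filter Set
open scoped FourierTransform ENNReal Gradient ContDiff

noncomputable section

namespace MTC

/-! ### Square integrable functions and Fourier multipliers -/

/-- The real Hilbert space `L²(ℝ)` of real-valued functions. -/
abbrev L2 : Type := Lp ℝ 2 (volume : Measure ℝ)

/-- The space `L²(ℝ)` of complex-valued functions. -/
abbrev L2C : Type := Lp ℂ 2 (volume : Measure ℝ)

open Classical in
/-- The class in `L²(ℝ)` of a square integrable function (and `0` for any other function). -/
def toL2 {E : Type} [NormedAddCommGroup E] (f : ℝ → E) : Lp E 2 (volume : Measure ℝ) :=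
  if h : MemLp f 2 volume then h.toLp f else 0

/-- A real-valued square integrable function, regarded as a complex-valued one. -/
def complexify (f : L2) : L2C := Complex.ofRealCLM.compLp f

/-- The real part of a complex-valued square integrable function. -/
def realPart (f : L2C) : L2 := Complex.reCLM.compLp f

/-- The Hilbert transform: the Fourier multiplier with the symbol `-i sgn ξ`. -/
def hilbert (f : L2) : L2 :=
  realPart (𝓕⁻ (toL2 (fun ξ : ℝ => -Complex.I * (SignType.sign ξ : ℂ) * (𝓕 (complexify f) : L2C) ξ)))

/-- `g` is the weak derivative of `f`. -/
def IsWeakDeriv (f g : L2) : Prop :=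
  ∀ φ : ℝ → ℝ, ContDiff ℝ ∞ φ → HasCompactSupport φ →
    ∫ x, f x * deriv φ x = -∫ x, g x * φ x

open Classical in
/-- The operator `∂ₓ` on `L²(ℝ)` with its natural domain `H¹(ℝ)` (and the value `0` outside). -/
def dx (f : L2) : L2 := if h : ∃ g : L2, IsWeakDeriv f g then h.choose else 0

open Classical in
/-- Point values: the continuous representative of a class in `L²(ℝ)` that has one. -/
def contRep (f : L2) : ℝ → ℝ :=
  if h : ∃ g : ℝ → ℝ, Continuous g ∧ f =ᵐ[volume] g then h.choose else f

/-! ### The weighted Sobolev space `H^s_r(ℝ)`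

`u ∈ H^s_r(ℝ)` iff `(1 + x²)^(r/2) u ∈ H^s(ℝ)`, with the norm
`‖u‖ = ‖(1 - ∂ₓ²)^(s/2) [(1 + x²)^(r/2) u]‖` in `L²(ℝ)`. -/

/-- The function `(1 + x²)^(r/2) u(x)`. -/
def weighted (r : ℝ) (u : L2) (x : ℝ) : ℂ := (((1 + x ^ 2) ^ (r / 2) * u x : ℝ) : ℂ)

/-- The Fourier transform of `(1 - ∂ₓ²)^(s/2) [(1 + x²)^(r/2) u]`. -/
def besselSymbol (s r : ℝ) (u : L2) (ξ : ℝ) : ℂ :=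
  (((1 + (2 * Real.pi * ξ) ^ 2) ^ (s / 2) : ℝ) : ℂ) * (𝓕 (toL2 (weighted r u)) : L2C) ξ

theorem toL2_eq {E : Type} [NormedAddCommGroup E] {f : ℝ → E} (h : MemLp f 2 volume) :
    toL2 f = h.toLp f := dif_pos h

theorem toL2_add {E : Type} [NormedAddCommGroup E] {f g h : ℝ → E} (hf : MemLp f 2 volume)
    (hg : MemLp g 2 volume) (hh : h =ᵐ[volume] f + g) : toL2 h = toL2 f + toL2 g := by
  have h1 : MemLp h 2 volume := (memLp_congr_ae hh).2 (hf.add hg)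
  rw [toL2_eq h1, toL2_eq hf, toL2_eq hg, ← MemLp.toLp_add, MemLp.toLp_eq_toLp_iff]
  exact hh

theorem toL2_smul {f h : ℝ → ℂ} (c : ℝ) (hf : MemLp f 2 volume)
    (hh : h =ᵐ[volume] (c : ℂ) • f) : toL2 h = (c : ℂ) • toL2 f := by
  have h1 : MemLp h 2 volume := (memLp_congr_ae hh).2 (hf.const_smul _)
  rw [toL2_eq h1, toL2_eq hf, ← MemLp.toLp_const_smul, MemLp.toLp_eq_toLp_iff]
  exact hh

theorem weighted_add (r : ℝ) (u v : L2) :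
    weighted r (u + v) =ᵐ[volume] weighted r u + weighted r v := by
  filter_upwards [Lp.coeFn_add u v] with x hx
  simp only [weighted, hx, Pi.add_apply]
  push_cast
  ring

theorem weighted_smul (r : ℝ) (c : ℝ) (u : L2) :
    weighted r (c • u) =ᵐ[volume] (c : ℂ) • weighted r u := by
  filter_upwards [Lp.coeFn_smul c u] with x hx
  simp only [weighted, hx, Pi.smul_apply, smul_eq_mul]
  push_cast
  ring

theorem besselSymbol_add (s r : ℝ) {u v : L2} (hu : MemLp (weighted r u) 2 volume)
    (hv : MemLp (weighted r v) 2 volume) :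
    besselSymbol s r (u + v) =ᵐ[volume] besselSymbol s r u + besselSymbol s r v := by
  have h : (𝓕 (toL2 (weighted r (u + v))) : L2C)
      = 𝓕 (toL2 (weighted r u)) + 𝓕 (toL2 (weighted r v)) := by
    rw [toL2_add hu hv (weighted_add r u v)]
    exact FourierTransform.fourier_add _ _
  filter_upwards [Lp.coeFn_add (𝓕 (toL2 (weighted r u)) : L2C) (𝓕 (toL2 (weighted r v)))] with x hx
  simp only [besselSymbol, h, hx, Pi.add_apply, mul_add]

theorem besselSymbol_smul (s r c : ℝ) {u : L2} (hu : MemLp (weighted r u) 2 volume) :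
    besselSymbol s r (c • u) =ᵐ[volume] (c : ℂ) • besselSymbol s r u := by
  have h : (𝓕 (toL2 (weighted r (c • u))) : L2C) = (c : ℂ) • 𝓕 (toL2 (weighted r u)) := by
    rw [toL2_smul c hu (weighted_smul r c u)]
    exact FourierTransform.fourier_smul _ _
  filter_upwards [Lp.coeFn_smul (c : ℂ) (𝓕 (toL2 (weighted r u)) : L2C)] with x hx
  simp only [besselSymbol, h, hx, Pi.smul_apply, smul_eq_mul]
  ring

/-- The weighted Sobolev space as a subspace of `L²(ℝ)`. -/
def wsobSubmodule (s r : ℝ) : Submodule ℝ L2 where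
  carrier := {u | MemLp (weighted r u) 2 volume ∧ MemLp (besselSymbol s r u) 2 volume}
  add_mem' := fun hu hv =>
    ⟨(memLp_congr_ae (weighted_add r _ _)).2 (hu.1.add hv.1),
      (memLp_congr_ae (besselSymbol_add s r hu.1 hv.1)).2 (hu.2.add hv.2)⟩
  smul_mem' := fun c _ hu =>
    ⟨(memLp_congr_ae (weighted_smul r c _)).2 (hu.1.const_smul _),
      (memLp_congr_ae (besselSymbol_smul s r c hu.1)).2 (hu.2.const_smul _)⟩
  zero_mem' := by
    have h : weighted r (0 : L2) =ᵐ[volume] (0 : ℝ → ℂ) := by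
      filter_upwards [Lp.coeFn_zero ℝ 2 (volume : Measure ℝ)] with x hx
      simp only [weighted, hx, Pi.zero_apply, mul_zero, Complex.ofReal_zero]
    have h0 : MemLp (weighted r (0 : L2)) 2 volume := (memLp_congr_ae h).2 MemLp.zero
    refine ⟨h0, ?_⟩
    have h1 : besselSymbol s r (0 : L2) =ᵐ[volume] (0 : ℝ → ℂ) := by
      have := besselSymbol_smul s r 0 h0
      simpa using this
    exact (memLp_congr_ae h1).2 MemLp.zero

/-- The weighted Sobolev space `H^s_r(ℝ)`. -/
def WSob (s r : ℝ) : Type := wsobSubmodule s r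

instance (s r : ℝ) : AddCommGroup (WSob s r) := inferInstanceAs (AddCommGroup (wsobSubmodule s r))

instance (s r : ℝ) : Module ℝ (WSob s r) := inferInstanceAs (Module ℝ (wsobSubmodule s r))

/-- The inclusion `H^s_r(ℝ) → L²(ℝ)`. -/
def WSob.incl {s r : ℝ} (u : WSob s r) : L2 := Subtype.val u

/-- The isometry `u ↦ 𝓕 (1 - ∂ₓ²)^(s/2) [(1 + x²)^(r/2) u]` that defines the norm. -/
def WSob.bessel (s r : ℝ) : WSob s r →ₗ[ℝ] L2C where
  toFun u := toL2 (besselSymbol s r u.incl)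
  map_add' u v := toL2_add u.2.2 v.2.2 (besselSymbol_add s r u.2.1 v.2.1)
  map_smul' c u := toL2_smul c u.2.2 (besselSymbol_smul s r c u.2.1)

theorem WSob.bessel_injective (s r : ℝ) : Function.Injective (WSob.bessel s r) := by
  rw [← LinearMap.ker_eq_bot, LinearMap.ker_eq_bot']
  intro u hu
  have h1 : toL2 (besselSymbol s r u.incl) = 0 := hu
  have m1 : MemLp (weighted r u.incl) 2 volume := u.2.1
  have m2 : MemLp (besselSymbol s r u.incl) 2 volume := u.2.2
  have hpos : ∀ x a : ℝ, 0 < (1 + x ^ 2) ^ a := fun x a => Real.rpow_pos_of_pos (by positivity) a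
  rw [toL2_eq m2, Lp.eq_zero_iff_ae_eq_zero] at h1
  have h2 : (𝓕 (toL2 (weighted r u.incl)) : L2C) = 0 := by
    rw [Lp.eq_zero_iff_ae_eq_zero]
    filter_upwards [h1, m2.coeFn_toLp] with x hx hx'
    have h3 : besselSymbol s r u.incl x = 0 := hx'.symm.trans hx
    rcases mul_eq_zero.1 h3 with h | h
    · exact absurd (Complex.ofReal_eq_zero.1 h) (hpos _ _).ne'
    · exact h
  have h3 : toL2 (weighted r u.incl) = 0 := by
    have := Lp.norm_fourier_eq (toL2 (weighted r u.incl))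
    rw [h2, norm_zero] at this
    exact norm_eq_zero.1 this.symm
  rw [toL2_eq m1, Lp.eq_zero_iff_ae_eq_zero] at h3
  apply Subtype.ext
  change u.incl = 0
  rw [Lp.eq_zero_iff_ae_eq_zero]
  filter_upwards [h3, m1.coeFn_toLp] with x hx hx'
  have h4 : weighted r u.incl x = 0 := hx'.symm.trans hx
  rcases mul_eq_zero.1 (Complex.ofReal_eq_zero.1 h4) with h | h
  · exact absurd h (hpos _ _).ne'
  · exact h

instance (s r : ℝ) : NormedAddCommGroup (WSob s r) :=
  NormedAddCommGroup.induced (WSob s r) L2C (WSob.bessel s r) (WSob.bessel_injective s r)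

instance (s r : ℝ) : NormedSpace ℝ (WSob s r) :=
  NormedSpace.induced ℝ (WSob s r) L2C (WSob.bessel s r)

/-! ### The Malmquist-Takenaka-Christov system -/

/-- The Christov functions: `√2` times the real (`k = 2j`) and imaginary (`k = 2j + 1`) parts of the
Malmquist-Takenaka functions `√(2ℓ/π) (ℓ + 2ix)^j / (ℓ - 2ix)^(j+1)`. -/
def christov (ℓ : ℝ) (k : ℕ) (x : ℝ) : ℝ :=
  let z : ℂ := (ℓ + 2 * Complex.I * x) ^ (k / 2) / (ℓ - 2 * Complex.I * x) ^ (k / 2 + 1)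
  2 * √(ℓ / Real.pi) * (if Even k then z.re else z.im)

/-- The space `ℙₙ = span {φ₀, …, φₙ}`. -/
def mtcSpace (ℓ : ℝ) (n : ℕ) : Submodule ℝ (ℝ → ℝ) :=
  Submodule.span ℝ (christov ℓ '' {k | k ≤ n})

/-- The projector `𝒫ₙ[u] = ∑_{k ≤ n} ⟨u, φₖ⟩ φₖ`. -/
def proj (ℓ : ℝ) (n : ℕ) (u : L2) : L2 :=
  ∑ k ∈ Finset.range (n + 1), inner ℝ u (toL2 (christov ℓ k)) • toL2 (christov ℓ k)

/-- The collocation nodes `x₀, …, xₙ`. -/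
def node (ℓ : ℝ) (n i : ℕ) : ℝ := ℓ / 2 * Real.tan (Real.pi * (2 * i - n) / (2 * (n + 1)))

open Classical in
/-- The interpolant `ℐₙ[f]`: the element of `ℙₙ` that agrees with `f` at the nodes. -/
def interp (ℓ : ℝ) (n : ℕ) (f : ℝ → ℝ) : L2 :=
  if h : ∃ g ∈ mtcSpace ℓ n, ∀ i ≤ n, g (node ℓ n i) = f (node ℓ n i) then toL2 h.choose else 0

/-- The interpolant `ℐₙ[v²]`. -/
def interpSq (ℓ : ℝ) (n : ℕ) (v : L2) : L2 := interp ℓ n (fun x => contRep v x ^ 2)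

/-- The discrete automorphism `𝒥ₙ = -𝒫ₙ ∂ₓ 𝒫ₙ`. -/
def autJ (ℓ : ℝ) (n : ℕ) (u : L2) : L2 := -proj ℓ n (dx (proj ℓ n u))

/-! ### The functionals -/

/-- The discrete Hamiltonian `𝒢ₙ(v)`. -/
def hamG (ℓ : ℝ) (n : ℕ) (α β γ δ : ℝ) (v : L2) : ℝ :=
  1 / 2 * ∫ x, (α * v x ^ 2 - β * (v x * hilbert (autJ ℓ n v) x) + γ * autJ ℓ n v x ^ 2
    + 2 * δ / 3 * (v x * interpSq ℓ n v x))

/-- The functional `ℰₙ(e, t) = 2δ ⟨𝒫ₙ[u(t)], ℐₙ[e²]⟩`, in terms of `w = u(t)`. -/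
def funE (ℓ : ℝ) (n : ℕ) (δ : ℝ) (w e : L2) : ℝ :=
  2 * δ * inner ℝ (proj ℓ n w) (interpSq ℓ n e)

/-- The functional `𝒟ₙ(e, t)`, in terms of `w = u(t)`. -/
def funD (ℓ : ℝ) (n : ℕ) (α β γ δ : ℝ) (w e : L2) : ℝ :=
  inner ℝ e (α • (w - proj ℓ n w) + β • hilbert (dx w + autJ ℓ n w)
    - γ • (dx (dx w) - autJ ℓ n (autJ ℓ n w))
    + δ • (toL2 (fun x => w x ^ 2) - interpSq ℓ n (proj ℓ n w)))

/-- The initial error `e₀ = 𝒫ₙ[u₀] - ℐₙ[u₀]`. -/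
def initError (ℓ : ℝ) (n : ℕ) (u₀ : L2) : L2 := proj ℓ n u₀ - interp ℓ n (contRep u₀)

/-- `g'` is the (weak) time derivative of the absolutely continuous curve `g` on `[0, T]`. -/
def IsTimeDeriv (T : ℝ) (g g' : ℝ → L2) : Prop :=
  IntegrableOn g' (Icc 0 T) volume ∧ ∀ t ∈ Icc 0 T, g t = g 0 + ∫ τ in (0 : ℝ)..t, g' τ

end MTC

end

/-! Everything is read off from expansion coefficients. The complex functions `mt ℓ j`, `j ∈ ℤ`,
become `e^(ijθ)` times the fixed factor `mt ℓ 0` under `x = (ℓ/2) tan (θ/2)`, and `|mt ℓ 0|² dx`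
becomes `dθ/(2π)`. They therefore form a Hilbert basis whose coefficients are Fourier coefficients.
The real functions `φ_(2i), φ_(2i+1)` span the plane of `mt ℓ i` and its conjugate `mt ℓ (-1-i)`, so
for odd `n` the projector truncates to `|2j+1| ≤ n`.

The analytic core is the decay estimate `exists_bound_coef`: with `lam j = |2j+1|`, the sequence
`lam^s · coef` of `u ∈ H^s_(2s)` is square summable, with norm at most a constant times that of `u`.
For an integer order `M` this holds because `mt ℓ j` is an eigenfunction of the rotation generator
`∂_θ`, in the variable `x` the operator `(ℓ/4 + x²/ℓ) ∂ₓ + x/ℓ`, with eigenvalue `i(j + 1/2)`, and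
because the `M`-th power of the generator involves `∂ₓ^l`, `l ≤ M`, with coefficients that the
weight `(1+x²)^M` dominates. Real orders `s ≥ 2` follow by Stein interpolation: the three lines
theorem is applied to the analytic family `analyticT`, with the factor `exp (z²)` to absorb
polynomial growth in `z`.

The rest is arithmetic of sequences. Truncation at `n` gains negative powers of `n`, and `∂ₓ` is
tridiagonal and costs one power of `lam` (`sn_dseq_le`). Hence the linear consistency error is
`O(n^(2-s))` (`enorm_linErr_le`). By Cauchy-Schwarz the coefficients lie in a weighted `ℓ¹` space of
order `s - 1`. There, interpolation is stable because all `mt ℓ j` have the same modulus and the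
nodes are equidistant in `θ`; and the space behaves like an algebra because `mt ℓ i · mt ℓ j` is a
multiple of `mt ℓ (i+j) + mt ℓ (i+j+1)`. This gives `‖e₀‖ = O(n^(1-s))` and the quadratic error
`enorm_quadErr_le`.

The gradient of `𝒟ₙ` is the consistency error itself, a small linear operator plus a small symmetric
bilinear one evaluated at `(u, u)`. Its time derivative is given by the product rule in integrated
form (`quad_integral`), and Hölder's inequality with exponents `4, 4, 2` gives the bounds in time.
The bounds at time zero combine `‖e₀‖` with inverse inequalities on `ℙₙ`. They come out with better
exponents than those asserted, except that `2 - s` is used as it stands. -/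

noncomputable section

namespace MTC

/-! ### The complex Malmquist-Takenaka basis -/

/-- The Malmquist-Takenaka functions `√(2ℓ/π) (ℓ + 2ix)^j / (ℓ - 2ix)^(j+1)`, `j ∈ ℤ`. -/
def mt (ℓ : ℝ) (j : ℤ) (x : ℝ) : ℂ :=
  (√(2 * ℓ / Real.pi) : ℝ) * (ℓ + 2 * Complex.I * x) ^ j / (ℓ - 2 * Complex.I * x) ^ (j + 1)

theorem add_ne_zero_of_pos {ℓ : ℝ} (hℓ : 0 < ℓ) (x : ℝ) : (ℓ + 2 * Complex.I * x : ℂ) ≠ 0 := by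
  intro h
  have := congrArg Complex.re h
  simp at this
  exact hℓ.ne' this

theorem sub_ne_zero_of_pos {ℓ : ℝ} (hℓ : 0 < ℓ) (x : ℝ) : (ℓ - 2 * Complex.I * x : ℂ) ≠ 0 := by
  intro h
  have := congrArg Complex.re h
  simp at this
  exact hℓ.ne' this

theorem conj_add_eq (ℓ x : ℝ) :
    (starRingEnd ℂ) (ℓ + 2 * Complex.I * x) = ℓ - 2 * Complex.I * x := by
  apply Complex.ext <;> simp

theorem conj_sub_eq (ℓ x : ℝ) :
    (starRingEnd ℂ) (ℓ - 2 * Complex.I * x) = ℓ + 2 * Complex.I * x := by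
  apply Complex.ext <;> simp

theorem norm_add_eq (ℓ x : ℝ) : ‖(ℓ + 2 * Complex.I * x : ℂ)‖ = √(ℓ ^ 2 + 4 * x ^ 2) := by
  rw [Complex.norm_def, Complex.normSq_apply]
  congr 1
  simp
  ring

theorem norm_sub_eq (ℓ x : ℝ) : ‖(ℓ - 2 * Complex.I * x : ℂ)‖ = √(ℓ ^ 2 + 4 * x ^ 2) := by
  rw [← conj_add_eq, Complex.norm_conj, norm_add_eq]

theorem norm_mt {ℓ : ℝ} (hℓ : 0 < ℓ) (j : ℤ) (x : ℝ) :
    ‖mt ℓ j x‖ = √(2 * ℓ / Real.pi) / √(ℓ ^ 2 + 4 * x ^ 2) := by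
  have h : √(ℓ ^ 2 + 4 * x ^ 2) ≠ 0 := by positivity
  rw [mt, norm_div, norm_mul, norm_zpow, norm_zpow, norm_add_eq, norm_sub_eq,
    zpow_add_one₀ h, Complex.norm_real, Real.norm_of_nonneg (by positivity)]
  field_simp

theorem norm_mt_sq {ℓ : ℝ} (hℓ : 0 < ℓ) (j : ℤ) (x : ℝ) :
    ‖mt ℓ j x‖ ^ 2 = 2 * ℓ / Real.pi / (ℓ ^ 2 + 4 * x ^ 2) := by
  rw [norm_mt hℓ, div_pow, Real.sq_sqrt (by positivity), Real.sq_sqrt (by positivity)]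

theorem norm_mt_eq {ℓ : ℝ} (hℓ : 0 < ℓ) (j k : ℤ) (x : ℝ) : ‖mt ℓ j x‖ = ‖mt ℓ k x‖ := by
  rw [norm_mt hℓ, norm_mt hℓ]

theorem norm_mt_le {ℓ : ℝ} (hℓ : 0 < ℓ) (j : ℤ) (x : ℝ) :
    ‖mt ℓ j x‖ ≤ √(2 * ℓ / Real.pi) / ℓ := by
  rw [norm_mt hℓ]
  gcongr
  apply Real.le_sqrt_of_sq_le
  nlinarith [sq_nonneg x]

/-- Conjugation exchanges `ℓ + 2ix` and `ℓ - 2ix`; the extra power in the denominator makes the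
reflection of indices `j ↦ -1 - j` instead of `j ↦ -j`. Hence real functions pair `j` with `-1 - j`,
and `|2j + 1|` is the weight invariant under this symmetry. -/
theorem conj_mt (ℓ : ℝ) (j : ℤ) (x : ℝ) :
    (starRingEnd ℂ) (mt ℓ j x) = mt ℓ (-1 - j) x := by
  rw [mt, mt, map_div₀, map_mul, map_zpow₀, map_zpow₀, conj_add_eq, conj_sub_eq,
    Complex.conj_ofReal, mul_div_assoc, mul_div_assoc, show -1 - j + 1 = -j by ring,
    show -1 - j = -(j + 1) by ring, zpow_neg, zpow_neg]
  rw [div_inv_eq_mul, div_eq_mul_inv]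
  ring

theorem continuous_mt {ℓ : ℝ} (hℓ : 0 < ℓ) (j : ℤ) : Continuous (mt ℓ j) := by
  unfold mt
  refine Continuous.div (continuous_const.mul (Continuous.zpow₀ (by fun_prop) _ fun x => ?_))
    (Continuous.zpow₀ (by fun_prop) _ fun x => ?_) fun x => ?_
  · exact Or.inl (add_ne_zero_of_pos hℓ x)
  · exact Or.inl (sub_ne_zero_of_pos hℓ x)
  · exact zpow_ne_zero _ (sub_ne_zero_of_pos hℓ x)

theorem mt_ne_zero {ℓ : ℝ} (hℓ : 0 < ℓ) (j : ℤ) (x : ℝ) : mt ℓ j x ≠ 0 := by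
  rw [← norm_pos_iff, norm_mt hℓ]
  have := Real.pi_pos
  positivity

theorem memLp_mt {ℓ : ℝ} (hℓ : 0 < ℓ) (j : ℤ) : MemLp (mt ℓ j) 2 volume := by
  rw [memLp_two_iff_integrable_sq_norm (continuous_mt hℓ j).aestronglyMeasurable]
  simp_rw [norm_mt_sq hℓ]
  have h := (integrable_inv_one_add_sq.comp_mul_left' (R := 2 / ℓ) (by positivity)).const_mul
    (2 * ℓ / Real.pi / ℓ ^ 2)
  refine h.congr (Eventually.of_forall fun x => ?_)
  have h1 : 0 < 1 + (2 / ℓ * x) ^ 2 := by positivity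
  have h2 : 0 < ℓ ^ 2 + 4 * x ^ 2 := by positivity
  have := Real.pi_pos
  simp only
  field_simp
  ring

/-- The phase `(ℓ + 2ix) / (ℓ - 2ix)`. -/
def phase (ℓ : ℝ) (x : ℝ) : ℂ := (ℓ + 2 * Complex.I * x) / (ℓ - 2 * Complex.I * x)

theorem phase_ne_zero {ℓ : ℝ} (hℓ : 0 < ℓ) (x : ℝ) : phase ℓ x ≠ 0 :=
  div_ne_zero (add_ne_zero_of_pos hℓ x) (sub_ne_zero_of_pos hℓ x)

theorem mt_add {ℓ : ℝ} (hℓ : 0 < ℓ) (j k : ℤ) (x : ℝ) :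
    mt ℓ (j + k) x = phase ℓ x ^ j * mt ℓ k x := by
  have h1 := add_ne_zero_of_pos hℓ x
  have h2 := sub_ne_zero_of_pos hℓ x
  rw [mt, mt, phase, add_assoc, zpow_add₀ h1, zpow_add₀ h2, div_zpow]
  field_simp

theorem mt_eq_phase_zpow {ℓ : ℝ} (hℓ : 0 < ℓ) (j : ℤ) (x : ℝ) :
    mt ℓ j x = phase ℓ x ^ j * mt ℓ 0 x := by
  simpa using mt_add hℓ j 0 x

/-! ### The change of variables `x = (ℓ/2) tan (θ/2)` -/

/-- The map `θ ↦ (ℓ/2) tan (θ/2)`. -/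
def tanMap (ℓ θ : ℝ) : ℝ := ℓ / 2 * Real.tan (θ / 2)

theorem cos_half_pos {θ : ℝ} (h : θ ∈ Ioo (-Real.pi) Real.pi) : 0 < Real.cos (θ / 2) :=
  Real.cos_pos_of_mem_Ioo ⟨by linarith [h.1], by linarith [h.2]⟩

theorem hasDerivAt_tanMap (ℓ : ℝ) {θ : ℝ} (h : θ ∈ Ioo (-Real.pi) Real.pi) :
    HasDerivAt (tanMap ℓ) (ℓ / 4 / Real.cos (θ / 2) ^ 2) θ := by
  have h1 := (Real.hasDerivAt_tan (cos_half_pos h).ne').comp θ ((hasDerivAt_id θ).div_const 2)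
  have h2 := h1.const_mul (ℓ / 2)
  convert! h2 using 1
  ring

theorem injOn_tanMap {ℓ : ℝ} (hℓ : 0 < ℓ) : InjOn (tanMap ℓ) (Ioo (-Real.pi) Real.pi) := by
  intro a ha b hb h
  have h1 : Real.tan (a / 2) = Real.tan (b / 2) := mul_left_cancel₀ (by positivity) h
  have := Real.injOn_tan (x₁ := a / 2) (x₂ := b / 2) ⟨by linarith [ha.1], by linarith [ha.2]⟩
    ⟨by linarith [hb.1], by linarith [hb.2]⟩ h1
  linarith

theorem image_tanMap {ℓ : ℝ} (hℓ : 0 < ℓ) : tanMap ℓ '' Ioo (-Real.pi) Real.pi = univ := by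
  refine eq_univ_of_forall fun y => ⟨2 * Real.arctan (2 * y / ℓ), ?_, ?_⟩
  · constructor <;> linarith [Real.neg_pi_div_two_lt_arctan (2 * y / ℓ),
      Real.arctan_lt_pi_div_two (2 * y / ℓ)]
  · rw [tanMap, mul_div_cancel_left₀ _ two_ne_zero, Real.tan_arctan]
    field_simp

theorem one_add_tan_mul_I {a : ℝ} (h : Real.cos a ≠ 0) :
    (1 + Complex.I * Real.tan a : ℂ) = Complex.exp (Complex.I * a) / Real.cos a := by
  have h' : Complex.cos a ≠ 0 := by exact_mod_cast h
  rw [mul_comm Complex.I (a : ℂ), Complex.exp_mul_I, Real.tan_eq_sin_div_cos]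
  push_cast
  field_simp

/-- The numerator and the denominator are `ℓ (1 ± i tan (θ/2)) = ℓ e^(±iθ/2) / cos (θ/2)`. -/
theorem phase_tanMap {ℓ : ℝ} (hℓ : 0 < ℓ) {θ : ℝ} (h : Real.cos (θ / 2) ≠ 0) :
    phase ℓ (tanMap ℓ θ) = Complex.exp (Complex.I * θ) := by
  have h1 := one_add_tan_mul_I h
  have h2 := one_add_tan_mul_I (a := -(θ / 2)) (by rwa [Real.cos_neg])
  rw [Real.tan_neg, Real.cos_neg] at h2
  have hl : (ℓ : ℂ) ≠ 0 := by exact_mod_cast hℓ.ne'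
  have hc : ((Real.cos (θ / 2) : ℝ) : ℂ) ≠ 0 := by exact_mod_cast h
  have e1 : (ℓ + 2 * Complex.I * (tanMap ℓ θ) : ℂ) = ℓ * (1 + Complex.I * Real.tan (θ / 2)) := by
    rw [tanMap]; push_cast; ring
  have e2 : (ℓ - 2 * Complex.I * (tanMap ℓ θ) : ℂ)
      = ℓ * (1 + Complex.I * ((-Real.tan (θ / 2) : ℝ) : ℂ)) := by
    rw [tanMap]; push_cast; ring
  rw [phase, e1, e2, h1, h2, mul_div_mul_left _ _ hl, div_div_div_cancel_right₀ hc,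
    ← Complex.exp_sub]
  congr 1
  push_cast
  ring

/-- The measure `|mt ℓ j|² dx` is the normalised arc length on the circle; this is what makes the
system orthonormal. -/
theorem jacobian_mul_norm_sq {ℓ : ℝ} (hℓ : 0 < ℓ) {θ : ℝ} (h : Real.cos (θ / 2) ≠ 0) (j : ℤ) :
    ℓ / 4 / Real.cos (θ / 2) ^ 2 * ‖mt ℓ j (tanMap ℓ θ)‖ ^ 2 = (2 * Real.pi)⁻¹ := by
  rw [norm_mt_sq hℓ, tanMap, Real.tan_eq_sin_div_cos]
  have := Real.pi_pos
  have h3 : ℓ ^ 2 + 4 * (ℓ / 2 * (Real.sin (θ / 2) / Real.cos (θ / 2))) ^ 2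
      = ℓ ^ 2 / Real.cos (θ / 2) ^ 2 := by
    field_simp
    linear_combination 4 * Real.cos_sq_add_sin_sq (θ / 2)
  rw [h3]
  field_simp
  norm_num

theorem integral_comp_tanMap {E : Type*} [NormedAddCommGroup E] [NormedSpace ℝ E] {ℓ : ℝ}
    (hℓ : 0 < ℓ) (g : ℝ → E) :
    ∫ x, g x = ∫ θ in Ioo (-Real.pi) Real.pi,
      (ℓ / 4 / Real.cos (θ / 2) ^ 2) • g (tanMap ℓ θ) := by
  have h := integral_image_eq_integral_abs_deriv_smul measurableSet_Ioo
    (fun θ hθ => (hasDerivAt_tanMap ℓ hθ).hasDerivWithinAt) (injOn_tanMap hℓ) g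
  rw [image_tanMap hℓ, setIntegral_univ] at h
  rw [h]
  refine setIntegral_congr_fun measurableSet_Ioo fun θ hθ => ?_
  have := cos_half_pos hθ
  rw [abs_of_pos (by positivity)]

theorem integrableOn_comp_tanMap {E : Type*} [NormedAddCommGroup E] [NormedSpace ℝ E] {ℓ : ℝ}
    (hℓ : 0 < ℓ) {g : ℝ → E} (hg : Integrable g) :
    IntegrableOn (fun θ => (ℓ / 4 / Real.cos (θ / 2) ^ 2) • g (tanMap ℓ θ))
      (Ioo (-Real.pi) Real.pi) := by
  have h := integrableOn_image_iff_integrableOn_abs_deriv_smul measurableSet_Ioo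
    (fun θ hθ => (hasDerivAt_tanMap ℓ hθ).hasDerivWithinAt) (injOn_tanMap hℓ) g
  rw [image_tanMap hℓ, integrableOn_univ] at h
  refine (h.1 hg).congr_fun (fun θ hθ => ?_) measurableSet_Ioo
  have := cos_half_pos hθ
  beta_reduce
  rw [abs_of_pos (by positivity)]

/-- The class of `mt ℓ j` in `L²`. -/
def mtL2 (ℓ : ℝ) (j : ℤ) : L2C := toL2 (mt ℓ j)

theorem coeFn_mtL2 {ℓ : ℝ} (hℓ : 0 < ℓ) (j : ℤ) : mtL2 ℓ j =ᵐ[volume] mt ℓ j := by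
  rw [mtL2, toL2_eq (memLp_mt hℓ j)]
  exact (memLp_mt hℓ j).coeFn_toLp

theorem inner_mtL2_eq_integral {ℓ : ℝ} (hℓ : 0 < ℓ) (j : ℤ) {f : L2C} {g : ℝ → ℂ}
    (hg : f =ᵐ[volume] g) :
    inner ℂ (mtL2 ℓ j) f = ∫ x, (starRingEnd ℂ) (mt ℓ j x) * g x := by
  rw [L2.inner_def]
  refine integral_congr_ae ?_
  filter_upwards [coeFn_mtL2 hℓ j, hg] with x h1 h2
  rw [h1, h2, RCLike.inner_apply, mul_comm]

/-- In the variable `θ` the conjugate of `mt ℓ j` is `e^(-ijθ)` times that of `mt ℓ 0`, and the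
Jacobian turns the latter into division by `mt ℓ 0`. -/
theorem inner_mtL2_eq_fourierCoeffOn {ℓ : ℝ} (hℓ : 0 < ℓ) (j : ℤ) {f : L2C} {g : ℝ → ℂ}
    (hg : f =ᵐ[volume] g) (h : -Real.pi < Real.pi) :
    inner ℂ (mtL2 ℓ j) f
      = fourierCoeffOn h (fun θ => g (tanMap ℓ θ) / mt ℓ 0 (tanMap ℓ θ)) j := by
  rw [inner_mtL2_eq_integral hℓ j hg, integral_comp_tanMap hℓ, fourierCoeffOn_eq_integral,
    intervalIntegral.integral_of_le h.le, ← setIntegral_congr_set Ioo_ae_eq_Ioc, ← integral_smul]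
  refine setIntegral_congr_fun measurableSet_Ioo fun θ hθ => ?_
  have hc := (cos_half_pos hθ).ne'
  have hp := phase_tanMap hℓ hc
  have hJ := jacobian_mul_norm_sq hℓ hc 0
  have h0 := mt_ne_zero hℓ 0 (tanMap ℓ θ)
  have e1 : (fourier (-j) (θ : AddCircle (Real.pi - -Real.pi)) : ℂ)
      = (starRingEnd ℂ) (phase ℓ (tanMap ℓ θ) ^ j) := by
    rw [hp, fourier_coe_apply, map_zpow₀, ← Complex.exp_conj, ← Complex.exp_int_mul]
    congr 1
    simp
    have : (Real.pi : ℂ) ≠ 0 := by exact_mod_cast Real.pi_ne_zero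
    field_simp
    ring
  rw [e1, mt_eq_phase_zpow hℓ j, map_mul, smul_eq_mul, Complex.real_smul, Complex.real_smul]
  -- The Jacobian times `|mt ℓ 0|²` is `1/(2π)`, written here as `1/(π - (-π))`, the normalisation
  -- of `fourierCoeffOn`.
  have e2 : ((ℓ / 4 / Real.cos (θ / 2) ^ 2 : ℝ) : ℂ) * ((starRingEnd ℂ) (mt ℓ 0 (tanMap ℓ θ)))
      = ((1 / (Real.pi - -Real.pi) : ℝ) : ℂ) / mt ℓ 0 (tanMap ℓ θ) := by
    rw [eq_div_iff h0, mul_assoc, ← Complex.normSq_eq_conj_mul_self, Complex.normSq_eq_norm_sq,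
      ← Complex.ofReal_mul, hJ]
    congr 1
    field_simp
    ring
  linear_combination ((starRingEnd ℂ) (phase ℓ (tanMap ℓ θ) ^ j) * g (tanMap ℓ θ)) * e2

theorem inner_mtL2_mtL2 {ℓ : ℝ} (hℓ : 0 < ℓ) (j k : ℤ) :
    inner ℂ (mtL2 ℓ j) (mtL2 ℓ k) = if j = k then 1 else 0 := by
  have h : -Real.pi < Real.pi := by linarith [Real.pi_pos]
  have : Fact (0 < Real.pi - -Real.pi) := ⟨by linarith⟩
  rw [inner_mtL2_eq_fourierCoeffOn hℓ j (coeFn_mtL2 hℓ k) h]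
  have e : fourierCoeffOn h (fun θ => mt ℓ k (tanMap ℓ θ) / mt ℓ 0 (tanMap ℓ θ)) j
      = fourierCoeff (fourier (T := Real.pi - -Real.pi) k) j := by
    rw [fourierCoeffOn_eq_integral, fourierCoeff_eq_intervalIntegral _ _ (-Real.pi),
      add_sub_cancel, intervalIntegral.integral_of_le h.le, intervalIntegral.integral_of_le h.le,
      ← setIntegral_congr_set Ioo_ae_eq_Ioc, ← setIntegral_congr_set Ioo_ae_eq_Ioc]
    congr 1
    refine setIntegral_congr_fun measurableSet_Ioo fun θ hθ => ?_
    congr 1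
    rw [mt_eq_phase_zpow hℓ k, mul_div_cancel_right₀ _ (mt_ne_zero hℓ 0 _),
      phase_tanMap hℓ (cos_half_pos hθ).ne', fourier_coe_apply, ← Complex.exp_int_mul]
    congr 1
    have : (Real.pi : ℂ) ≠ 0 := by exact_mod_cast Real.pi_ne_zero
    push_cast
    field_simp
    ring
  rw [e, fourierCoeff_fourier]
  simp [Pi.single_apply]

theorem orthonormal_mtL2 {ℓ : ℝ} (hℓ : 0 < ℓ) : Orthonormal ℂ (mtL2 ℓ) := by
  rw [orthonormal_iff_ite]
  exact inner_mtL2_mtL2 hℓ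

/-- Parseval's identity on the circle for `f / mt ℓ 0`, transported back to the line. Completeness
of the system is a consequence. -/
theorem hasSum_norm_inner_mtL2 {ℓ : ℝ} (hℓ : 0 < ℓ) (f : L2C) :
    HasSum (fun j => ‖inner ℂ (mtL2 ℓ j) f‖ ^ 2) (‖f‖ ^ 2) := by
  have h : -Real.pi < Real.pi := by linarith [Real.pi_pos]
  simp_rw [fun j => inner_mtL2_eq_fourierCoeffOn hℓ j (Filter.EventuallyEq.refl _ f) h]
  have hsq : ∀ θ ∈ Ioo (-Real.pi) Real.pi, ‖f (tanMap ℓ θ) / mt ℓ 0 (tanMap ℓ θ)‖ ^ 2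
      = (2 * Real.pi) * ((ℓ / 4 / Real.cos (θ / 2) ^ 2) • ‖f (tanMap ℓ θ)‖ ^ 2) := by
    intro θ hθ
    have hJ := jacobian_mul_norm_sq hℓ (cos_half_pos hθ).ne' 0
    have h0 : ‖mt ℓ 0 (tanMap ℓ θ)‖ ≠ 0 := norm_ne_zero_iff.2 (mt_ne_zero hℓ 0 _)
    have := Real.pi_pos
    rw [norm_div, div_pow, div_eq_iff (by positivity), smul_eq_mul]
    have : 2 * Real.pi * (2 * Real.pi)⁻¹ = 1 := by field_simp
    linear_combination (-2 * Real.pi * ‖f (tanMap ℓ θ)‖ ^ 2) * hJ - ‖f (tanMap ℓ θ)‖ ^ 2 * this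
  have hInt : Integrable (fun x => ‖f x‖ ^ 2) := (Lp.memLp f).integrable_norm_pow two_ne_zero
  have hmeas : AEStronglyMeasurable (fun θ => f (tanMap ℓ θ) / mt ℓ 0 (tanMap ℓ θ))
      (volume.restrict (Ioc (-Real.pi) Real.pi)) := by
    rw [← restrict_Ioo_eq_restrict_Ioc]
    have hm : Measurable (tanMap ℓ) := by
      unfold tanMap
      simp only [Real.tan_eq_sin_div_cos]
      fun_prop
    have h1 : Measurable (fun θ => f (tanMap ℓ θ)) :=
      (Lp.stronglyMeasurable f).measurable.comp hm
    have h2 : Measurable (fun θ => mt ℓ 0 (tanMap ℓ θ)) := (continuous_mt hℓ 0).measurable.comp hm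
    exact (h1.div h2).aestronglyMeasurable
  have hL2 : MemLp (fun θ => f (tanMap ℓ θ) / mt ℓ 0 (tanMap ℓ θ)) 2
      (volume.restrict (Ioc (-Real.pi) Real.pi)) := by
    rw [memLp_two_iff_integrable_sq_norm hmeas, ← restrict_Ioo_eq_restrict_Ioc]
    have h1 : IntegrableOn (fun θ => (2 * Real.pi) *
        ((ℓ / 4 / Real.cos (θ / 2) ^ 2) • ‖f (tanMap ℓ θ)‖ ^ 2)) (Ioo (-Real.pi) Real.pi) :=
      (integrableOn_comp_tanMap hℓ hInt).const_mul (2 * Real.pi)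
    exact h1.congr_fun (fun θ hθ => (hsq θ hθ).symm) measurableSet_Ioo
  convert hasSum_sq_fourierCoeffOn h hL2 using 1
  rw [intervalIntegral.integral_of_le h.le, ← setIntegral_congr_set Ioo_ae_eq_Ioc,
    setIntegral_congr_fun measurableSet_Ioo hsq, integral_const_mul,
    ← integral_comp_tanMap hℓ (fun x => ‖f x‖ ^ 2), ← Real.rpow_natCast, Lp.norm_def]
  have h2 := (Lp.memLp f).eLpNorm_eq_integral_rpow_norm two_ne_zero ENNReal.ofNat_ne_top
  rw [h2, ENNReal.toReal_ofReal (by positivity), ← Real.rpow_mul (by positivity)]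
  have := Real.pi_pos
  simp
  field_simp
  norm_num

/-- The Malmquist-Takenaka functions as a Hilbert basis of `L²(ℝ; ℂ)`. -/
def mtBasis {ℓ : ℝ} (hℓ : 0 < ℓ) : HilbertBasis ℤ ℂ L2C :=
  HilbertBasis.mkOfOrthogonalEqBot (orthonormal_mtL2 hℓ) (by
    rw [Submodule.eq_bot_iff]
    intro f hf
    have h : ∀ j, inner ℂ (mtL2 ℓ j) f = 0 := fun j =>
      Submodule.inner_right_of_mem_orthogonal (Submodule.subset_span (mem_range_self j)) hf
    have h1 := hasSum_norm_inner_mtL2 hℓ f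
    simp only [h, norm_zero, ne_eq, OfNat.ofNat_ne_zero, not_false_eq_true, zero_pow] at h1
    have h2 := h1.unique hasSum_zero
    exact norm_eq_zero.1 (pow_eq_zero_iff two_ne_zero |>.1 h2))

@[simp] theorem mtBasis_apply {ℓ : ℝ} (hℓ : 0 < ℓ) (j : ℤ) : mtBasis hℓ j = mtL2 ℓ j := by
  simp [mtBasis]

/-- The coefficient of `f` with respect to `mtL2 ℓ j`. -/
def coef (ℓ : ℝ) (f : L2C) (j : ℤ) : ℂ := inner ℂ (mtL2 ℓ j) f

end MTC

end

/-! ### The rotation generator and its action on weighted functions -/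

noncomputable section

namespace MTC

open SchwartzMap

/-! ### Complex powers of `1 + x²` -/

/-- The function `(1 + x²)^(-z)`. -/
def pw (z : ℂ) (x : ℝ) : ℂ := Complex.exp (-z * Real.log (1 + x ^ 2))

theorem norm_pw (z : ℂ) (x : ℝ) : ‖pw z x‖ = (1 + x ^ 2) ^ (-z.re) := by
  rw [pw, Complex.norm_exp, Real.rpow_def_of_pos (by positivity)]
  congr 1
  simp
  ring

theorem pw_add (z w : ℂ) (x : ℝ) : pw (z + w) x = pw z x * pw w x := by
  rw [pw, pw, pw, ← Complex.exp_add]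
  congr 1
  ring

theorem pw_ofReal (s x : ℝ) : pw s x = (((1 + x ^ 2) ^ (-s) : ℝ) : ℂ) := by
  rw [pw, Real.rpow_def_of_pos (by positivity)]
  push_cast
  congr 1
  ring

theorem pw_one (x : ℝ) : pw 1 x = (1 + (x : ℂ) ^ 2)⁻¹ := by
  have := pw_ofReal 1 x
  rw [Complex.ofReal_one] at this
  rw [this, Real.rpow_neg_one]
  push_cast
  rfl

theorem hasDerivAt_log_one_add_sq (x : ℝ) :
    HasDerivAt (fun x : ℝ => Real.log (1 + x ^ 2)) (2 * x * (1 + x ^ 2)⁻¹) x := by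
  have h := (((hasDerivAt_id x).pow 2).const_add 1).log (by simp; positivity)
  simp only [id, Nat.cast_ofNat, Nat.add_one_sub_one, pow_one, mul_one] at h
  convert! h using 1

theorem hasDerivAt_pw (z : ℂ) (x : ℝ) :
    HasDerivAt (pw z) (-2 * z * x * pw (z + 1) x) x := by
  have h1 := (hasDerivAt_log_one_add_sq x).ofReal_comp
  have h2 := (h1.const_mul (-z)).cexp
  refine h2.congr_deriv ?_
  rw [pw_add, pw_one, pw]
  push_cast
  ring

theorem hasTemperateGrowth_cexp_mul_I (y : ℝ) :
    (fun t : ℝ => Complex.exp (y * Complex.I * t)).HasTemperateGrowth := by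
  have h0 : ContDiff ℝ ∞ (fun t : ℝ => (t : ℂ)) := Complex.ofRealCLM.contDiff
  refine ⟨by fun_prop, fun n => ⟨0, |y| ^ n, fun t => ?_⟩⟩
  have h : ∀ n : ℕ, iteratedDeriv n (fun t : ℝ => Complex.exp (y * Complex.I * t))
      = fun t : ℝ => (y * Complex.I) ^ n * Complex.exp (y * Complex.I * t) := by
    intro n
    induction n with
    | zero => simp
    | succ n ih =>
      rw [iteratedDeriv_succ, ih]
      ext t
      have h1 : HasDerivAt (fun t : ℝ => Complex.exp (y * Complex.I * t))
          (Complex.exp (y * Complex.I * t) * (y * Complex.I)) t := by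
        simpa using ((Complex.ofRealCLM.hasDerivAt (x := t)).const_mul (y * Complex.I)).cexp
      rw [(h1.const_mul ((y * Complex.I) ^ n)).deriv]
      ring
  rw [norm_iteratedFDeriv_eq_norm_iteratedDeriv, h, norm_mul, norm_pow, Complex.norm_exp]
  simp

theorem hasTemperateGrowth_one_add_sq_rpow (r : ℝ) :
    (fun x : ℝ => (1 + x ^ 2) ^ r).HasTemperateGrowth := by
  have := Function.hasTemperateGrowth_one_add_norm_sq_rpow ℝ r
  simpa using this

theorem hasTemperateGrowth_log_one_add_sq :
    (fun x : ℝ => Real.log (1 + x ^ 2)).HasTemperateGrowth := by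
  refine Function.HasTemperateGrowth.of_fderiv (k := 2) (C := 1) ?_
    (fun x => (hasDerivAt_log_one_add_sq x).differentiableAt) fun x => ?_
  · have e : fderiv ℝ (fun x : ℝ => Real.log (1 + x ^ 2))
        = fun x => (2 * x * (1 + x ^ 2) ^ (-1 : ℝ)) • (1 : ℝ →L[ℝ] ℝ) := by
      ext x
      rw [(hasDerivAt_log_one_add_sq x).hasFDerivAt.fderiv]
      simp [Real.rpow_neg_one]
    rw [e]
    have := hasTemperateGrowth_one_add_sq_rpow (-1)
    fun_prop
  · have h1 : 0 ≤ Real.log (1 + x ^ 2) := Real.log_nonneg (by nlinarith [sq_nonneg x])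
    have h2 := Real.log_le_sub_one_of_pos (x := 1 + x ^ 2) (by positivity)
    rw [Real.norm_of_nonneg h1, Real.norm_eq_abs, one_mul]
    nlinarith [abs_nonneg x, sq_abs x]

/-- The modulus `(1 + x²)^(-Re z)` and the phase are treated separately; the phase is `t ↦ e^(iyt)`,
`y = -Im z`, evaluated at `t = log (1 + x²)`. -/
theorem hasTemperateGrowth_pw (z : ℂ) : (pw z).HasTemperateGrowth := by
  have h1 := (hasTemperateGrowth_cexp_mul_I (-z.im)).comp hasTemperateGrowth_log_one_add_sq
  have h2 : (fun x : ℝ => (((1 + x ^ 2) ^ (-z.re) : ℝ) : ℂ)).HasTemperateGrowth :=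
    Complex.ofRealCLM.hasTemperateGrowth.comp (hasTemperateGrowth_one_add_sq_rpow (-z.re))
  convert! h2.mul h1 using 1
  ext x
  simp only [Pi.mul_apply, Function.comp_apply]
  rw [← pw_ofReal, pw, pw, ← Complex.exp_add]
  congr 1
  conv_lhs => rw [← Complex.re_add_im z]
  push_cast
  ring

/-- The symbol `(1 + (2πξ)²)^(-z/2)` of the Bessel potential of order `z`. -/
def besselPw (z : ℂ) (ξ : ℝ) : ℂ := pw (z / 2) (2 * Real.pi * ξ)

theorem hasTemperateGrowth_besselPw (z : ℂ) : (besselPw z).HasTemperateGrowth :=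
  (hasTemperateGrowth_pw (z / 2)).comp
    (g := pw (z / 2)) (f := fun ξ : ℝ => 2 * Real.pi * ξ) (by fun_prop)

theorem norm_besselPw (z : ℂ) (ξ : ℝ) :
    ‖besselPw z ξ‖ = (1 + (2 * Real.pi * ξ) ^ 2) ^ (-(z.re / 2)) := by
  rw [besselPw, norm_pw]
  simp

/-! ### The generator of rotations -/

theorem hasDerivAt_mt {ℓ : ℝ} (hℓ : 0 < ℓ) (j : ℤ) (x : ℝ) :
    HasDerivAt (mt ℓ j)
      (2 * Complex.I * (j / (ℓ + 2 * Complex.I * x) + (j + 1) / (ℓ - 2 * Complex.I * x))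
        * mt ℓ j x) x := by
  have ha := add_ne_zero_of_pos hℓ x
  have hb := sub_ne_zero_of_pos hℓ x
  have h0 : HasDerivAt (fun x : ℂ => 2 * Complex.I * x) (2 * Complex.I) x := by
    simpa using (hasDerivAt_id (x : ℂ)).const_mul (2 * Complex.I)
  have h1 : HasDerivAt (fun x : ℝ => (ℓ + 2 * Complex.I * x : ℂ) ^ j)
      (j * (ℓ + 2 * Complex.I * x : ℂ) ^ (j - 1) * (2 * Complex.I)) x := by
    have := (hasDerivAt_zpow j _ (Or.inl ha)).comp (x : ℂ) (h0.const_add (ℓ : ℂ))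
    exact this.comp_ofReal
  have h2 : HasDerivAt (fun x : ℝ => (ℓ - 2 * Complex.I * x : ℂ) ^ (j + 1))
      (((j + 1 : ℤ) : ℂ) * (ℓ - 2 * Complex.I * x : ℂ) ^ (j + 1 - 1) * (-(2 * Complex.I))) x := by
    have := (hasDerivAt_zpow (j + 1) _ (Or.inl hb)).comp (x : ℂ) (h0.const_sub (ℓ : ℂ))
    exact this.comp_ofReal
  have h3 := (h1.const_mul ((√(2 * ℓ / Real.pi) : ℝ) : ℂ)).div h2 (zpow_ne_zero _ hb)
  refine h3.congr_deriv ?_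
  rw [mt, add_sub_cancel_right, zpow_sub_one₀ ha, zpow_add_one₀ hb]
  push_cast
  field_simp
  ring

/-- The coefficient `(ℓ² + 4x²) / (4ℓ)`. -/
def rotWeight (ℓ x : ℝ) : ℂ := ℓ / 4 + x ^ 2 / ℓ

/-- The weight factors as `(ℓ + 2ix)(ℓ - 2ix)/(4ℓ)` and so removes both poles of the logarithmic
derivative. It equals `dx/dθ`. Once the term `x/ℓ` is added, `mt ℓ j` is an eigenfunction with
eigenvalue `i(j + 1/2)`. -/
theorem rotWeight_mul_deriv {ℓ : ℝ} (hℓ : 0 < ℓ) (j : ℤ) (x : ℝ) :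
    rotWeight ℓ x * (2 * Complex.I * (j / (ℓ + 2 * Complex.I * x)
        + (j + 1) / (ℓ - 2 * Complex.I * x)) * mt ℓ j x)
      = (Complex.I * (j + 1 / 2) - x / ℓ) * mt ℓ j x := by
  have ha := add_ne_zero_of_pos hℓ x
  have hb := sub_ne_zero_of_pos hℓ x
  have hl : (ℓ : ℂ) ≠ 0 := by exact_mod_cast hℓ.ne'
  have e : rotWeight ℓ x = (ℓ + 2 * Complex.I * x) * (ℓ - 2 * Complex.I * x) / (4 * ℓ) := by
    rw [rotWeight]
    field_simp
    ring_nf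
    simp
  have e2 : rotWeight ℓ x * (2 * Complex.I * (j / (ℓ + 2 * Complex.I * x)
        + (j + 1) / (ℓ - 2 * Complex.I * x))) = Complex.I * (j + 1 / 2) - x / ℓ := by
    rw [e]
    field_simp
    ring_nf
    simp
    ring
  rw [← mul_assoc, e2]

theorem hasTemperateGrowth_rotWeight (ℓ : ℝ) : (rotWeight ℓ).HasTemperateGrowth := by
  have h : (fun x : ℝ => (x : ℂ)).HasTemperateGrowth := Complex.ofRealCLM.hasTemperateGrowth
  have e : rotWeight ℓ = fun x : ℝ => (ℓ / 4 : ℂ) + (x : ℂ) ^ 2 * (1 / ℓ : ℂ) := by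
    ext x
    rw [rotWeight]
    ring
  rw [e]
  exact (Function.HasTemperateGrowth.const _).add ((h.pow 2).mul (.const _))

theorem hasTemperateGrowth_ofReal_div (ℓ : ℝ) :
    (fun x : ℝ => (x / ℓ : ℂ)).HasTemperateGrowth := by
  have h : (fun x : ℝ => (x : ℂ)).HasTemperateGrowth := Complex.ofRealCLM.hasTemperateGrowth
  simp_rw [div_eq_mul_inv]
  exact h.mul (.const _)

/-- The generator of rotations `((ℓ² + 4x²) / (4ℓ)) ∂ₓ + x / ℓ` on Schwartz functions. -/
def rotGen (ℓ : ℝ) (f : 𝓢(ℝ, ℂ)) : 𝓢(ℝ, ℂ) :=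
  smulLeftCLM ℂ (rotWeight ℓ) (derivCLM ℂ ℂ f) + smulLeftCLM ℂ (fun x : ℝ => (x / ℓ : ℂ)) f

theorem rotGen_apply (ℓ : ℝ) (f : 𝓢(ℝ, ℂ)) (x : ℝ) :
    rotGen ℓ f x = rotWeight ℓ x * deriv f x + x / ℓ * f x := by
  simp [rotGen, hasTemperateGrowth_rotWeight, hasTemperateGrowth_ofReal_div]

theorem integrable_mt_mul {ℓ : ℝ} (hℓ : 0 < ℓ) (j : ℤ) (f : 𝓢(ℝ, ℂ)) :
    Integrable (fun x => mt ℓ j x * f x) :=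
  f.integrable.bdd_mul (continuous_mt hℓ j).aestronglyMeasurable
    (Eventually.of_forall (norm_mt_le hℓ j))

theorem coef_toLp {ℓ : ℝ} (hℓ : 0 < ℓ) (f : 𝓢(ℝ, ℂ)) (j : ℤ) :
    coef ℓ (f.toLp 2) j = ∫ x, mt ℓ (-1 - j) x * f x := by
  rw [coef, inner_mtL2_eq_integral hℓ j (f.coeFn_toLp 2)]
  simp_rw [conj_mt]

/-- The generator is skew-symmetric, since the derivative `2x/ℓ` of its leading coefficient is twice
its zeroth order coefficient. Integration by parts moves it to the eigenfunction `mt ℓ (-1 - j)`. -/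
theorem coef_rotGen {ℓ : ℝ} (hℓ : 0 < ℓ) (f : 𝓢(ℝ, ℂ)) (j : ℤ) :
    coef ℓ ((rotGen ℓ f).toLp 2) j = Complex.I * (j + 1 / 2) * coef ℓ (f.toLp 2) j := by
  rw [coef_toLp hℓ, coef_toLp hℓ]
  have hl : (ℓ : ℂ) ≠ 0 := by exact_mod_cast hℓ.ne'
  set k := -1 - j with hk
  have hq : ∀ x : ℝ, HasDerivAt (rotWeight ℓ) (2 * (x / ℓ)) x := by
    intro x
    have h0 : HasDerivAt (fun x : ℝ => (x : ℂ)) 1 x := 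
      (hasDerivAt_id x).ofReal_comp
    have := ((h0.pow 2).div_const (ℓ : ℂ)).const_add (ℓ / 4 : ℂ)
    refine this.congr_deriv ?_
    simp
    ring
  have hu : ∀ x : ℝ, HasDerivAt (fun x => mt ℓ k x * rotWeight ℓ x)
      ((Complex.I * (k + 1 / 2) + x / ℓ) * mt ℓ k x) x := by
    intro x
    refine ((hasDerivAt_mt hℓ k x).mul (hq x)).congr_deriv ?_
    have := rotWeight_mul_deriv hℓ k x
    linear_combination this
  have hv : ∀ x : ℝ, HasDerivAt f (deriv f x) x := fun x => f.differentiable.differentiableAt.hasDerivAt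
  have tg := hasTemperateGrowth_rotWeight ℓ
  have tx := hasTemperateGrowth_ofReal_div ℓ
  -- All integrands are the bounded function `mt ℓ k` times a Schwartz function, since
  -- multiplication by the polynomial coefficients preserves the Schwartz class.
  have i1 : Integrable (fun x => mt ℓ k x * rotWeight ℓ x * deriv f x) := by
    have := integrable_mt_mul hℓ k (smulLeftCLM ℂ (rotWeight ℓ) (derivCLM ℂ ℂ f))
    refine this.congr (Eventually.of_forall fun x => ?_)
    simp [tg, mul_assoc]
  have i2 : Integrable (fun x => mt ℓ k x * (x / ℓ * f x)) := by
    have := integrable_mt_mul hℓ k (smulLeftCLM ℂ (fun x : ℝ => (x / ℓ : ℂ)) f)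
    refine this.congr (Eventually.of_forall fun x => ?_)
    simp [tx]
  have i3 := integrable_mt_mul hℓ k f
  have i4 : Integrable (fun x => (Complex.I * (k + 1 / 2) + x / ℓ) * mt ℓ k x * f x) := by
    refine ((i3.const_mul (Complex.I * (k + 1 / 2))).add i2).congr (Eventually.of_forall fun x => ?_)
    simp
    ring
  have i5 : Integrable (fun x => mt ℓ k x * rotWeight ℓ x * f x) := by
    have := integrable_mt_mul hℓ k (smulLeftCLM ℂ (rotWeight ℓ) f)
    refine this.congr (Eventually.of_forall fun x => ?_)
    simp [tg, mul_assoc]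
  have key := integral_mul_deriv_eq_deriv_mul_of_integrable (fun x _ => hu x)
    (fun x _ => hv x) i1 i4 i5
  have e1 : ∀ x : ℝ, mt ℓ k x * rotGen ℓ f x
      = mt ℓ k x * rotWeight ℓ x * deriv f x + mt ℓ k x * (x / ℓ * f x) := by
    intro x
    rw [rotGen_apply]
    ring
  have e2 : ∀ x : ℝ, (Complex.I * (k + 1 / 2) + x / ℓ) * mt ℓ k x * f x
      = Complex.I * (k + 1 / 2) * (mt ℓ k x * f x) + mt ℓ k x * (x / ℓ * f x) := by
    intro x
    ring
  simp_rw [e1]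
  rw [integral_add i1 i2, key]
  simp_rw [e2]
  rw [integral_add (i3.const_mul _) i2, integral_const_mul, hk]
  push_cast
  ring

/-! ### Iterates of the generator on `(1 + x²)^(-z) w` -/

/-- At most polynomial growth of a function on `ℂ`. -/
def PolyBdd (q : ℂ → ℂ) : Prop := ∃ C : ℝ, ∃ N : ℕ, 0 ≤ C ∧ ∀ z, ‖q z‖ ≤ C * (1 + ‖z‖) ^ N

theorem PolyBdd.const (c : ℂ) : PolyBdd fun _ => c := ⟨‖c‖, 0, norm_nonneg _, fun z => by simp⟩

theorem PolyBdd.mul {p q : ℂ → ℂ} (hp : PolyBdd p) (hq : PolyBdd q) :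
    PolyBdd fun z => p z * q z := by
  obtain ⟨C, N, hC, h⟩ := hp
  obtain ⟨C', N', hC', h'⟩ := hq
  refine ⟨C * C', N + N', by positivity, fun z => ?_⟩
  rw [norm_mul, pow_add]
  calc _ ≤ (C * (1 + ‖z‖) ^ N) * (C' * (1 + ‖z‖) ^ N') :=
        mul_le_mul (h z) (h' z) (norm_nonneg _) (by positivity)
    _ = _ := by ring

theorem PolyBdd.add_const (c : ℂ) : PolyBdd fun z => z + c := by
  refine ⟨1 + ‖c‖, 1, by positivity, fun z => ?_⟩
  have := norm_add_le z c
  nlinarith [norm_nonneg z, norm_nonneg c, mul_nonneg (norm_nonneg z) (norm_nonneg c)]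

/-- The differential operators `w ↦ ∑ q(z) x^a (1 + x²)^(-z-r) w^(l)` of order at most `k` whose
coefficients are bounded on the line `Re z = k`. -/
inductive Adm : ℕ → (ℂ → 𝓢(ℝ, ℂ) → ℝ → ℂ) → Prop
  -- On `Re z = k` the factor `pw (z + r)` has modulus `(1 + x²)^(-(k + r))`, and the degree
  -- condition together with `l ≤ k` gives `a ≤ 2(k + r)`. The numbers `a`, `r`, `l` do not depend
  -- on `z`, so one expression serves the whole family.
  | term (k a r l : ℕ) (q : ℂ → ℂ) (hl : l ≤ k) (ha : a ≤ k + l + 2 * r) (hq : PolyBdd q) :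
      Adm k fun z w x => q z * x ^ a * pw (z + r) x * ((derivCLM ℂ ℂ)^[l] w) x
  | add (k : ℕ) (Ψ Φ : ℂ → 𝓢(ℝ, ℂ) → ℝ → ℂ) (h : Adm k Ψ) (h' : Adm k Φ) :
      Adm k fun z w x => Ψ z w x + Φ z w x

/-- The derivative of a term has three pieces, and each meets the two summands of the weight. Of
these six products, `x²/ℓ` times the derivative of `x^a` absorbs the term `x/ℓ` and gets the
coefficient `(a + 1)/ℓ`. In each product the degree condition survives the passage from `k` to `k +
1`. -/
theorem Adm.rotGen {k : ℕ} {Ψ : ℂ → 𝓢(ℝ, ℂ) → ℝ → ℂ} (h : Adm k Ψ) (ℓ : ℝ) :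
    ∃ Ψ' : ℂ → 𝓢(ℝ, ℂ) → ℝ → ℂ, (∀ z w x, HasDerivAt (Ψ z w) (Ψ' z w x) x) ∧
      Adm (k + 1) fun z w x => rotWeight ℓ x * Ψ' z w x + x / ℓ * Ψ z w x := by
  induction h with
  | term a r l q hl ha hq =>
    refine ⟨fun z w x => q z * (a * x ^ (a - 1)) * pw (z + r) x * ((derivCLM ℂ ℂ)^[l] w) x
      + q z * x ^ a * (-2 * (z + r) * x * pw (z + r + 1) x) * ((derivCLM ℂ ℂ)^[l] w) x
      + q z * x ^ a * pw (z + r) x * ((derivCLM ℂ ℂ)^[l + 1] w) x, fun z w x => ?_, ?_⟩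
    · have h0 : HasDerivAt (fun x : ℝ => (x : ℂ)) 1 x := 
        (hasDerivAt_id x).ofReal_comp
      have h1 := ((h0.pow a).const_mul (q z)).mul (hasDerivAt_pw (z + r) x)
      have h2 : HasDerivAt ((derivCLM ℂ ℂ)^[l] w) (((derivCLM ℂ ℂ)^[l + 1] w) x) x := by
        rw [Function.iterate_succ_apply', derivCLM_apply]
        exact (SchwartzMap.differentiable _).differentiableAt.hasDerivAt
      refine (h1.mul h2).congr_deriv ?_
      simp
      ring
    · have t1 := Adm.term (k + 1) (a - 1) r l (fun z => ℓ / 4 * a * q z) (by omega) (by omega)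
        ((PolyBdd.const _).mul hq)
      have t2 := Adm.term (k + 1) (a + 1) r l (fun z => (a + 1) / ℓ * q z) (by omega) (by omega)
        ((PolyBdd.const _).mul hq)
      have t3 := Adm.term (k + 1) (a + 1) (r + 1) l (fun z => -ℓ / 2 * ((z + r) * q z)) (by omega)
        (by omega) ((PolyBdd.const _).mul ((PolyBdd.add_const _).mul hq))
      have t4 := Adm.term (k + 1) (a + 3) (r + 1) l (fun z => -2 / ℓ * ((z + r) * q z)) (by omega)
        (by omega) ((PolyBdd.const _).mul ((PolyBdd.add_const _).mul hq))
      have t5 := Adm.term (k + 1) a r (l + 1) (fun z => ℓ / 4 * q z) (by omega) (by omega)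
        ((PolyBdd.const _).mul hq)
      have t6 := Adm.term (k + 1) (a + 2) r (l + 1) (fun z => 1 / ℓ * q z) (by omega) (by omega)
        ((PolyBdd.const _).mul hq)
      convert! ((((t1.add _ _ _ t2).add _ _ _ t3).add _ _ _ t4).add _ _ _ t5).add _ _ _ t6 using 4
        with z w x
      rw [rotWeight]
      push_cast
      rw [← add_assoc z]
      rcases a with _ | a
      · simp
        ring
      · simp
        ring
  | add Ψ Φ h h' ih ih' =>
    obtain ⟨Ψ', d1, a1⟩ := ih
    obtain ⟨Φ', d2, a2⟩ := ih'
    refine ⟨fun z w x => Ψ' z w x + Φ' z w x, fun z w x => (d1 z w x).add (d2 z w x), ?_⟩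
    convert! a1.add _ _ _ a2 using 4
    ring

theorem abs_pow_mul_rpow_le {a : ℕ} {t : ℝ} (h : a ≤ 2 * t) (x : ℝ) :
    |x| ^ a * (1 + x ^ 2) ^ (-t) ≤ 1 := by
  have h1 : |x| ^ a ≤ (1 + x ^ 2) ^ ((a : ℝ) / 2) := by
    rw [← Real.sqrt_sq_eq_abs, Real.sqrt_eq_rpow, ← Real.rpow_natCast, ← Real.rpow_mul (by positivity),
      one_div_mul_eq_div]
    exact Real.rpow_le_rpow (by positivity) (by linarith) (by positivity)
  have h2 : (1 : ℝ) ≤ 1 + x ^ 2 := by linarith [sq_nonneg x]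
  calc _ ≤ (1 + x ^ 2) ^ ((a : ℝ) / 2) * (1 + x ^ 2) ^ (-t) := by gcongr
    _ = (1 + x ^ 2) ^ ((a : ℝ) / 2 + -t) := (Real.rpow_add (by positivity) _ _).symm
    _ ≤ _ := Real.rpow_le_one_of_one_le_of_nonpos h2 (by linarith)

theorem Adm.bound {k : ℕ} {Ψ : ℂ → 𝓢(ℝ, ℂ) → ℝ → ℂ} (h : Adm k Ψ) :
    ∃ C : ℝ, ∃ N : ℕ, 0 ≤ C ∧ ∀ z : ℂ, z.re = k → ∀ w x, ‖Ψ z w x‖ ≤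
      C * (1 + ‖z‖) ^ N * ∑ l ∈ Finset.range (k + 1), ‖((derivCLM ℂ ℂ)^[l] w) x‖ := by
  induction h with
  | term a r l q hl ha hq =>
    obtain ⟨C, N, hC, hb⟩ := hq
    refine ⟨C, N, hC, fun z hz w x => ?_⟩
    have h1 : ‖(x : ℂ) ^ a‖ * ‖pw (z + r) x‖ ≤ 1 := by
      rw [norm_pow, Complex.norm_real, Real.norm_eq_abs, norm_pw]
      apply abs_pow_mul_rpow_le
      simp only [Complex.add_re, hz, Complex.natCast_re]
      norm_cast
      omega
    have h2 : ‖((derivCLM ℂ ℂ)^[l] w) x‖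
        ≤ ∑ l ∈ Finset.range (k + 1), ‖((derivCLM ℂ ℂ)^[l] w) x‖ :=
      Finset.single_le_sum (f := fun l => ‖((derivCLM ℂ ℂ)^[l] w) x‖)
        (fun _ _ => norm_nonneg _) (Finset.mem_range.2 (by omega))
    rw [norm_mul, norm_mul, norm_mul, mul_assoc ‖q z‖]
    calc _ ≤ (C * (1 + ‖z‖) ^ N) * 1 * _ := by
          gcongr
          · exact hb z
      _ ≤ _ := by
          rw [mul_one]
          gcongr
  | add Ψ Φ h h' ih ih' =>
    obtain ⟨C, N, hC, hb⟩ := ih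
    obtain ⟨C', N', hC', hb'⟩ := ih'
    refine ⟨C + C', N + N', by positivity, fun z hz w x => ?_⟩
    have h1 : (1 : ℝ) ≤ 1 + ‖z‖ := by linarith [norm_nonneg z]
    have hS : 0 ≤ ∑ l ∈ Finset.range (k + 1), ‖((derivCLM ℂ ℂ)^[l] w) x‖ :=
      Finset.sum_nonneg fun _ _ => norm_nonneg _
    calc _ ≤ _ := norm_add_le _ _
      _ ≤ _ := add_le_add (hb z hz w x) (hb' z hz w x)
      _ ≤ C * (1 + ‖z‖) ^ (N + N') * ∑ l ∈ Finset.range (k + 1), ‖((derivCLM ℂ ℂ)^[l] w) x‖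
        + C' * (1 + ‖z‖) ^ (N + N') * ∑ l ∈ Finset.range (k + 1), ‖((derivCLM ℂ ℂ)^[l] w) x‖ := by
          gcongr <;> first | exact h1 | omega
      _ = _ := by ring

theorem exists_adm_iterate_rotGen (ℓ : ℝ) (k : ℕ) :
    ∃ Ψ, Adm k Ψ ∧ ∀ z w x, ((rotGen ℓ)^[k] (smulLeftCLM ℂ (pw z) w)) x = Ψ z w x := by
  induction k with
  | zero =>
    refine ⟨_, Adm.term 0 0 0 0 (fun _ => 1) le_rfl le_rfl (PolyBdd.const 1), fun z w x => ?_⟩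
    simp [hasTemperateGrowth_pw]
  | succ k ih =>
    obtain ⟨Ψ, hΨ, h⟩ := ih
    obtain ⟨Ψ', hd, ha⟩ := hΨ.rotGen ℓ
    refine ⟨_, ha, fun z w x => ?_⟩
    have e : ⇑((MTC.rotGen ℓ)^[k] (smulLeftCLM ℂ (pw z) w)) = Ψ z w := funext (h z w)
    rw [Function.iterate_succ_apply', rotGen_apply, e, (hd z w x).deriv]

end MTC

end

/-! ### Decay of coefficients by complex interpolation -/

noncomputable section

namespace MTC

open SchwartzMap

/-! ### The weighted Bessel potentials on Schwartz functions -/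

/-- The analytic family `b ↦ (1 + x²)^(-z) 𝓕⁻[(1 + (2πξ)²)^(-z/2) b]`. -/
def analyticT (z : ℂ) (b : 𝓢(ℝ, ℂ)) : 𝓢(ℝ, ℂ) :=
  smulLeftCLM ℂ (pw z) (𝓕⁻ (smulLeftCLM ℂ (besselPw z) b))

/-- Multiplication of a Schwartz function by `2πiξ`. -/
def mulFreq (g : 𝓢(ℝ, ℂ)) : 𝓢(ℝ, ℂ) :=
  (2 * Real.pi * Complex.I : ℂ) • smulLeftCLM ℂ (inner ℝ · (1 : ℝ)) g

theorem mulFreq_apply (g : 𝓢(ℝ, ℂ)) (ξ : ℝ) :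
    mulFreq g ξ = 2 * Real.pi * Complex.I * ξ * g ξ := by
  have : (inner ℝ · (1 : ℝ)).HasTemperateGrowth := ((innerSL ℝ).flip (1 : ℝ)).hasTemperateGrowth
  rw [mulFreq, smul_apply, smulLeftCLM_apply_apply this]
  simp
  ring

theorem iterate_mulFreq_apply (l : ℕ) (g : 𝓢(ℝ, ℂ)) (ξ : ℝ) :
    (mulFreq^[l] g) ξ = (2 * Real.pi * Complex.I * ξ) ^ l * g ξ := by
  induction l with
  | zero => simp
  | succ l ih =>
    rw [Function.iterate_succ_apply', mulFreq_apply, ih]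
    ring

theorem derivCLM_fourierInv (g : 𝓢(ℝ, ℂ)) : derivCLM ℂ ℂ (𝓕⁻ g) = 𝓕⁻ (mulFreq g) := by
  rw [mulFreq, ← lineDerivOp_fourierInv_eq]
  ext x
  rw [derivCLM_apply, lineDerivOp_apply_eq_fderiv, fderiv_apply_one_eq_deriv]

theorem iterate_derivCLM_fourierInv (l : ℕ) (g : 𝓢(ℝ, ℂ)) :
    (derivCLM ℂ ℂ)^[l] (𝓕⁻ g) = 𝓕⁻ (mulFreq^[l] g) := by
  induction l with
  | zero => rfl
  | succ l ih => rw [Function.iterate_succ_apply', ih, derivCLM_fourierInv,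
      Function.iterate_succ_apply']

theorem norm_fourierInv_toLp (g : 𝓢(ℝ, ℂ)) : ‖(𝓕⁻ g).toLp 2‖ = ‖g.toLp 2‖ := by
  rw [← SchwartzMap.toLp_fourierInv_eq]
  exact (Lp.fourierTransformₗᵢ ℝ ℂ).symm.norm_map _

theorem norm_toLp_le_of_pointwise (f g : 𝓢(ℝ, ℂ)) (h : ∀ x, ‖f x‖ ≤ ‖g x‖) :
    ‖f.toLp 2‖ ≤ ‖g.toLp 2‖ := by
  apply Lp.norm_le_norm_of_ae_le
  filter_upwards [f.coeFn_toLp 2, g.coeFn_toLp 2] with x h1 h2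
  rw [h1, h2]
  exact h x

/-- On the Fourier side `l` derivatives multiply by `(2πiξ)^l`, which the symbol of order `Re z ≥ l`
dominates. The bound does not depend on `Im z`. -/
theorem norm_iterate_deriv_bessel_le {z : ℂ} {l : ℕ} (h : l ≤ z.re) (b : 𝓢(ℝ, ℂ)) :
    ‖((derivCLM ℂ ℂ)^[l] (𝓕⁻ (smulLeftCLM ℂ (besselPw z) b))).toLp 2‖ ≤ ‖b.toLp 2‖ := by
  rw [iterate_derivCLM_fourierInv, norm_fourierInv_toLp]
  refine norm_toLp_le_of_pointwise _ _ fun ξ => ?_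
  rw [iterate_mulFreq_apply, smulLeftCLM_apply_apply (hasTemperateGrowth_besselPw z), smul_eq_mul,
    norm_mul, norm_mul, ← mul_assoc, norm_pow, norm_besselPw]
  have h1 : ‖(2 * Real.pi * Complex.I * ξ : ℂ)‖ = |2 * Real.pi * ξ| := by
    rw [show (2 * Real.pi * Complex.I * ξ : ℂ) = ((2 * Real.pi * ξ : ℝ) : ℂ) * Complex.I by
      push_cast; ring]
    rw [norm_mul, Complex.norm_I, mul_one, Complex.norm_real, Real.norm_eq_abs]
  rw [h1]
  have := abs_pow_mul_rpow_le (a := l) (t := z.re / 2) (by linarith) (2 * Real.pi * ξ)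
  calc _ ≤ 1 * ‖b ξ‖ := by gcongr
    _ = _ := one_mul _

/-- The weight `|2j + 1|`. -/
def lam (j : ℤ) : ℝ := |2 * (j : ℝ) + 1|

theorem one_le_lam (j : ℤ) : 1 ≤ lam j := by
  have : (1 : ℤ) ≤ |2 * j + 1| := by
    rcases abs_cases (2 * j + 1) with h | h <;> omega
  rw [lam]
  exact_mod_cast this

theorem lam_pos (j : ℤ) : 0 < lam j := one_pos.trans_le (one_le_lam j)

/-- Each application multiplies the coefficient by `i(j + 1/2)`, of modulus `lam j / 2`; hence the
powers of `2`. -/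
theorem norm_coef_iterate_rotGen {ℓ : ℝ} (hℓ : 0 < ℓ) (M : ℕ) (f : 𝓢(ℝ, ℂ)) (j : ℤ) :
    2 ^ M * ‖coef ℓ (((rotGen ℓ)^[M] f).toLp 2) j‖ = lam j ^ M * ‖coef ℓ (f.toLp 2) j‖ := by
  have h : ‖Complex.I * ((j : ℂ) + 1 / 2)‖ = lam j / 2 := by
    rw [norm_mul, Complex.norm_I, one_mul, lam,
      show ((j : ℂ) + 1 / 2) = (((2 * (j : ℝ) + 1) / 2 : ℝ) : ℂ) by push_cast; ring,
      Complex.norm_real, Real.norm_eq_abs, abs_div, abs_two]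
  induction M with
  | zero => simp
  | succ M ih =>
    rw [Function.iterate_succ_apply', coef_rotGen hℓ, norm_mul, h, pow_succ, pow_succ]
    linear_combination lam j * ih

/-- The iterate is a sum of derivatives of order at most `M` of the Bessel potential of `b`, with
coefficients bounded in `x` on the line `Re z = M` and polynomial in `z`. -/
theorem exists_bound_iterate_rotGen (ℓ : ℝ) (M : ℕ) :
    ∃ C : ℝ, ∃ N : ℕ, 0 ≤ C ∧ ∀ z : ℂ, z.re = M → ∀ b : 𝓢(ℝ, ℂ),
      ‖((rotGen ℓ)^[M] (analyticT z b)).toLp 2‖ ≤ C * (1 + ‖z‖) ^ N * ‖b.toLp 2‖ := by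
  obtain ⟨Ψ, hΨ, hA⟩ := exists_adm_iterate_rotGen ℓ M
  obtain ⟨C, N, hC, hb⟩ := hΨ.bound
  refine ⟨C * (M + 1), N, by positivity, fun z hz b => ?_⟩
  set w : 𝓢(ℝ, ℂ) := 𝓕⁻ (smulLeftCLM ℂ (besselPw z) b) with hw
  have h1 : ∀ x, ‖((rotGen ℓ)^[M] (analyticT z b)) x‖ ≤
      C * (1 + ‖z‖) ^ N * ∑ l ∈ Finset.range (M + 1), ‖((derivCLM ℂ ℂ)^[l] w) x‖ := by
    intro x
    rw [analyticT, hA]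
    exact hb z hz w x
  set W : ℕ → 𝓢(ℝ, ℂ) := fun l => (derivCLM ℂ ℂ)^[l] w with hW
  have h2 : eLpNorm ((rotGen ℓ)^[M] (analyticT z b)) 2 volume ≤
      ENNReal.ofReal (C * (1 + ‖z‖) ^ N) * ∑ l ∈ Finset.range (M + 1), eLpNorm (W l) 2 volume := by
    have e1 := eLpNorm_le_mul_eLpNorm_of_ae_le_mul (μ := volume)
      (f := (rotGen ℓ)^[M] (analyticT z b))
      (g := fun x => ∑ l ∈ Finset.range (M + 1), ‖W l x‖) (c := C * (1 + ‖z‖) ^ N)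
      (Eventually.of_forall fun x => by
        rw [Real.norm_of_nonneg (Finset.sum_nonneg fun _ _ => norm_nonneg _)]
        exact h1 x) 2
    refine e1.trans (mul_le_mul_right ?_ _)
    have e2 := eLpNorm_sum_le (μ := volume) (p := 2) (s := Finset.range (M + 1))
      (f := fun l x => ‖W l x‖) (fun l _ => (W l).continuous.norm.aestronglyMeasurable) (by norm_num)
    simp only [eLpNorm_norm] at e2
    have e3 : (fun x => ∑ l ∈ Finset.range (M + 1), ‖W l x‖)
        = ∑ l ∈ Finset.range (M + 1), fun x => ‖W l x‖ := by
      ext x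
      rw [Finset.sum_apply]
    rw [e3]
    exact e2
  have h3 : ∀ l ∈ Finset.range (M + 1), eLpNorm (W l) 2 volume ≤ ENNReal.ofReal ‖b.toLp 2‖ := by
    intro l hl
    have hl' : (l : ℝ) ≤ z.re := by
      rw [hz]
      exact_mod_cast Nat.lt_succ_iff.1 (Finset.mem_range.1 hl)
    have := norm_iterate_deriv_bessel_le hl' b
    rw [SchwartzMap.norm_toLp] at this
    exact (ENNReal.le_ofReal_iff_toReal_le ((W l).memLp 2 volume).eLpNorm_ne_top
      (norm_nonneg _)).2 this
  rw [SchwartzMap.norm_toLp]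
  refine ENNReal.toReal_le_of_le_ofReal (by positivity) (h2.trans ?_)
  calc _ ≤ ENNReal.ofReal (C * (1 + ‖z‖) ^ N)
        * ∑ l ∈ Finset.range (M + 1), ENNReal.ofReal ‖b.toLp 2‖ := by
        gcongr with l hl
        exact h3 l hl
    _ = _ := by
        rw [Finset.sum_const, Finset.card_range, nsmul_eq_mul, ← ENNReal.ofReal_natCast,
          ← ENNReal.ofReal_mul (by positivity), ← ENNReal.ofReal_mul (by positivity)]
        congr 1
        push_cast
        ring

/-- Bessel's inequality for the `M`-th iterate of the generator on `analyticT z b`, whose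
coefficients carry the weight `lam^M`. -/
theorem exists_bound_on_line {ℓ : ℝ} (hℓ : 0 < ℓ) (M : ℕ) :
    ∃ C : ℝ, ∃ N : ℕ, 0 ≤ C ∧ ∀ z : ℂ, z.re = M → ∀ (b : 𝓢(ℝ, ℂ)) (J : Finset ℤ),
      ∑ j ∈ J, (lam j ^ M * ‖coef ℓ ((analyticT z b).toLp 2) j‖) ^ 2
        ≤ (C * (1 + ‖z‖) ^ N * ‖b.toLp 2‖) ^ 2 := by
  obtain ⟨C, N, hC, h⟩ := exists_bound_iterate_rotGen ℓ M
  refine ⟨2 ^ M * C, N, by positivity, fun z hz b J => ?_⟩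
  have h0 := h z hz b
  generalize hg : ((rotGen ℓ)^[M] (analyticT z b)).toLp 2 = g at h0
  have h1 : ∑ j ∈ J, ‖coef ℓ g j‖ ^ 2 ≤ ‖g‖ ^ 2 :=
    (orthonormal_mtL2 hℓ).sum_inner_products_le g
  have h2 : ∀ j, (lam j ^ M * ‖coef ℓ ((analyticT z b).toLp 2) j‖) ^ 2
      = (2 ^ M) ^ 2 * ‖coef ℓ g j‖ ^ 2 := by
    intro j
    rw [← norm_coef_iterate_rotGen hℓ, hg, mul_pow]
  rw [Finset.sum_congr rfl fun j _ => h2 j, ← Finset.mul_sum]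
  generalize ‖b.toLp 2‖ = B at h0 ⊢
  have h3 : ‖g‖ ^ 2 ≤ (C * (1 + ‖z‖) ^ N * B) ^ 2 := pow_le_pow_left₀ (norm_nonneg _) h0 2
  calc _ ≤ ((2 : ℝ) ^ M) ^ 2 * (C * (1 + ‖z‖) ^ N * B) ^ 2 :=
        mul_le_mul_of_nonneg_left (h1.trans h3) (by positivity)
    _ = _ := by ring

/-! ### Holomorphy of the coefficients -/

/-- The exponent `log (1 + x²) + ½ log (1 + (2πξ)²)`. -/
def logWeight (p : ℝ × ℝ) : ℝ :=
  Real.log (1 + p.1 ^ 2) + 1 / 2 * Real.log (1 + (2 * Real.pi * p.2) ^ 2)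

theorem log_one_add_sq_nonneg (x : ℝ) : 0 ≤ Real.log (1 + x ^ 2) :=
  Real.log_nonneg (by linarith [sq_nonneg x])

theorem logWeight_nonneg (p : ℝ × ℝ) : 0 ≤ logWeight p :=
  add_nonneg (log_one_add_sq_nonneg _) (mul_nonneg (by norm_num) (log_one_add_sq_nonneg _))

theorem continuous_logWeight : Continuous logWeight := by
  have h : ∀ x : ℝ, 1 + x ^ 2 ≠ 0 := fun x => by positivity
  unfold logWeight
  refine Continuous.add (Continuous.log (by fun_prop) fun p => h _)
    (continuous_const.mul (Continuous.log (by fun_prop) fun p => h _))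

theorem exp_neg_logWeight_le (p : ℝ × ℝ) : Real.exp (-logWeight p) ≤ (1 + p.1 ^ 2)⁻¹ := by
  have h : (1 + p.1 ^ 2)⁻¹ = Real.exp (-Real.log (1 + p.1 ^ 2)) := by
    rw [Real.exp_neg, Real.exp_log (by positivity)]
  rw [h, Real.exp_le_exp, logWeight]
  linarith [log_one_add_sq_nonneg (2 * Real.pi * p.2)]

/-- The kernel of the coefficient functional, without the weights. -/
def coefKernel (ℓ : ℝ) (j : ℤ) (b : 𝓢(ℝ, ℂ)) (p : ℝ × ℝ) : ℂ :=
  mt ℓ (-1 - j) p.1 * Complex.exp ((2 * Real.pi * (p.2 * p.1) : ℝ) * Complex.I) * b p.2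

theorem continuous_coefKernel {ℓ : ℝ} (hℓ : 0 < ℓ) (j : ℤ) (b : 𝓢(ℝ, ℂ)) :
    Continuous (coefKernel ℓ j b) := by
  have h1 := continuous_mt hℓ (-1 - j)
  have h2 := b.continuous
  unfold coefKernel
  fun_prop

theorem norm_coefKernel_mul_exp_le {ℓ : ℝ} (hℓ : 0 < ℓ) (j : ℤ) (b : 𝓢(ℝ, ℂ)) (p : ℝ × ℝ) :
    ‖coefKernel ℓ j b p‖ * Real.exp (-logWeight p)
      ≤ √(2 * ℓ / Real.pi) / ℓ * ((1 + p.1 ^ 2)⁻¹ * ‖b p.2‖) := by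
  have h1 := norm_mt_le hℓ (-1 - j) p.1
  have h2 := exp_neg_logWeight_le p
  rw [coefKernel, norm_mul, norm_mul, Complex.norm_exp_ofReal_mul_I, mul_one]
  calc _ = ‖mt ℓ (-1 - j) p.1‖ * (Real.exp (-logWeight p) * ‖b p.2‖) := by ring
    _ ≤ _ := by gcongr

theorem integrable_coefKernel_bound {ℓ : ℝ} (b : 𝓢(ℝ, ℂ)) :
    Integrable (fun p : ℝ × ℝ => √(2 * ℓ / Real.pi) / ℓ * ((1 + p.1 ^ 2)⁻¹ * ‖b p.2‖))
      (volume.prod volume) :=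
  ((integrable_inv_one_add_sq.mul_prod b.integrable.norm).const_mul _)

theorem norm_exp_neg_mul_logWeight {z : ℂ} (hz : 1 ≤ z.re) (p : ℝ × ℝ) :
    ‖Complex.exp (-z * logWeight p)‖ ≤ Real.exp (-logWeight p) := by
  rw [Complex.norm_exp, Real.exp_le_exp]
  simp
  nlinarith [logWeight_nonneg p]

theorem norm_coefKernel_mul_le {ℓ : ℝ} (hℓ : 0 < ℓ) (j : ℤ) (b : 𝓢(ℝ, ℂ)) {z : ℂ}
    (hz : 1 ≤ z.re) (p : ℝ × ℝ) : ‖coefKernel ℓ j b p * Complex.exp (-z * logWeight p)‖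
      ≤ √(2 * ℓ / Real.pi) / ℓ * ((1 + p.1 ^ 2)⁻¹ * ‖b p.2‖) := by
  rw [norm_mul]
  refine le_trans ?_ (norm_coefKernel_mul_exp_le hℓ j b p)
  gcongr
  exact norm_exp_neg_mul_logWeight hz p

theorem continuous_coefKernel_mul {ℓ : ℝ} (hℓ : 0 < ℓ) (j : ℤ) (b : 𝓢(ℝ, ℂ)) (z : ℂ) :
    Continuous fun p => coefKernel ℓ j b p * Complex.exp (-z * logWeight p) := by
  have h1 := continuous_coefKernel hℓ j b
  have h2 := continuous_logWeight
  fun_prop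

theorem integrable_coefKernel_mul {ℓ : ℝ} (hℓ : 0 < ℓ) (j : ℤ) (b : 𝓢(ℝ, ℂ)) {z : ℂ}
    (hz : 1 ≤ z.re) : Integrable (fun p => coefKernel ℓ j b p * Complex.exp (-z * logWeight p))
      (volume.prod volume) :=
  (integrable_coefKernel_bound (ℓ := ℓ) b).mono'
    (continuous_coefKernel_mul hℓ j b z).aestronglyMeasurable
    (Eventually.of_forall (norm_coefKernel_mul_le hℓ j b hz))

/-- Fubini, with absolute convergence because `Re z ≥ 1`. In the double integral `z` enters only
through one exponential, which gives holomorphy and a bound uniform in `z`. -/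
theorem coef_analyticT {ℓ : ℝ} (hℓ : 0 < ℓ) (j : ℤ) (b : 𝓢(ℝ, ℂ)) {z : ℂ} (hz : 1 ≤ z.re) :
    coef ℓ ((analyticT z b).toLp 2) j
      = ∫ p, coefKernel ℓ j b p * Complex.exp (-z * logWeight p) ∂(volume.prod volume) := by
  rw [coef_toLp hℓ, integral_prod _ (integrable_coefKernel_mul hℓ j b hz)]
  refine integral_congr_ae (Eventually.of_forall fun x => ?_)
  beta_reduce
  rw [analyticT, smulLeftCLM_apply_apply (hasTemperateGrowth_pw z), SchwartzMap.fourierInv_coe,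
    Real.fourierInv_eq', smul_eq_mul, ← integral_const_mul, ← integral_const_mul]
  refine integral_congr_ae (Eventually.of_forall fun ξ => ?_)
  beta_reduce
  rw [smulLeftCLM_apply_apply (hasTemperateGrowth_besselPw z), coefKernel, logWeight, besselPw,
    pw, pw, smul_eq_mul, smul_eq_mul]
  have e : Complex.exp (-z * ((Real.log (1 + x ^ 2)
      + 1 / 2 * Real.log (1 + (2 * Real.pi * ξ) ^ 2) : ℝ) : ℂ))
      = Complex.exp (-z * Real.log (1 + x ^ 2))
        * Complex.exp (-(z / 2) * Real.log (1 + (2 * Real.pi * ξ) ^ 2)) := by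
    rw [← Complex.exp_add]
    congr 1
    push_cast
    ring
  have e2 : inner ℝ ξ x = ξ * x := by simp [mul_comm]
  rw [e, e2]
  ring

theorem norm_coef_analyticT_le {ℓ : ℝ} (hℓ : 0 < ℓ) (j : ℤ) (b : 𝓢(ℝ, ℂ)) {z : ℂ}
    (hz : 1 ≤ z.re) : ‖coef ℓ ((analyticT z b).toLp 2) j‖ ≤
      ∫ p : ℝ × ℝ, √(2 * ℓ / Real.pi) / ℓ * ((1 + p.1 ^ 2)⁻¹ * ‖b p.2‖) ∂(volume.prod volume) := by
  rw [coef_analyticT hℓ j b hz]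
  exact norm_integral_le_of_norm_le (integrable_coefKernel_bound b)
    (Eventually.of_forall (norm_coefKernel_mul_le hℓ j b hz))

theorem differentiableAt_coef_analyticT {ℓ : ℝ} (hℓ : 0 < ℓ) (j : ℤ) (b : 𝓢(ℝ, ℂ)) {z : ℂ}
    (hz : 2 ≤ z.re) : DifferentiableAt ℂ (fun z => coef ℓ ((analyticT z b).toLp 2) j) z := by
  -- On `Re z > 3/2` half a power of the weight is to spare after integrability; it absorbs the
  -- factor `logWeight` of the derivative, as `t ≤ 2 e^(t/2)`.
  have hs : {z : ℂ | 3 / 2 < z.re} ∈ nhds z :=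
    (isOpen_lt continuous_const Complex.continuous_re).mem_nhds (by simp; linarith)
  have hkey := hasDerivAt_integral_of_dominated_loc_of_deriv_le (μ := volume.prod volume)
    (F := fun z p => coefKernel ℓ j b p * Complex.exp (-z * logWeight p))
    (F' := fun z p => coefKernel ℓ j b p * (Complex.exp (-z * logWeight p) * (-logWeight p)))
    (bound := fun p => 2 * (√(2 * ℓ / Real.pi) / ℓ * ((1 + p.1 ^ 2)⁻¹ * ‖b p.2‖)))
    hs (Eventually.of_forall fun z => (continuous_coefKernel_mul hℓ j b z).aestronglyMeasurable)
    (integrable_coefKernel_mul hℓ j b (by linarith)) ?_ ?_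
    ((integrable_coefKernel_bound b).const_mul 2) ?_
  · refine hkey.2.differentiableAt.congr_of_eventuallyEq ?_
    filter_upwards [hs] with w hw
    exact coef_analyticT hℓ j b (by have : 3 / 2 < w.re := hw; linarith)
  · have h1 := continuous_coefKernel hℓ j b
    have h2 := continuous_logWeight
    exact Continuous.aestronglyMeasurable (by fun_prop)
  · refine Eventually.of_forall fun p w hw => ?_
    have h0 := logWeight_nonneg p
    have h1 : ‖Complex.exp (-w * logWeight p) * (-logWeight p)‖ ≤ 2 * Real.exp (-logWeight p) := by
      rw [norm_mul, norm_neg, Complex.norm_real, Real.norm_of_nonneg h0, Complex.norm_exp]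
      have e1 : (-w * (logWeight p : ℂ)).re ≤ -logWeight p - logWeight p / 2 := by
        have hw' : 3 / 2 < w.re := hw
        simp only [neg_mul, Complex.neg_re, Complex.mul_re, Complex.ofReal_re, Complex.ofReal_im,
          mul_zero, sub_zero]
        nlinarith
      have e2 : logWeight p / 2 ≤ Real.exp (logWeight p / 2) := by
        linarith [Real.add_one_le_exp (logWeight p / 2)]
      calc _ ≤ Real.exp (-logWeight p - logWeight p / 2) * (2 * Real.exp (logWeight p / 2)) := by
            gcongr
            linarith
        _ = 2 * (Real.exp (-logWeight p - logWeight p / 2) * Real.exp (logWeight p / 2)) := by ring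
        _ = _ := by
          rw [← Real.exp_add]
          ring_nf
    rw [norm_mul]
    calc _ ≤ ‖coefKernel ℓ j b p‖ * (2 * Real.exp (-logWeight p)) := by gcongr
      _ = 2 * (‖coefKernel ℓ j b p‖ * Real.exp (-logWeight p)) := by ring
      _ ≤ _ := mul_le_mul_of_nonneg_left (norm_coefKernel_mul_exp_le hℓ j b p) two_pos.le
  · refine Eventually.of_forall fun p w _ => ?_
    have := (((hasDerivAt_id w).neg.mul_const (logWeight p : ℂ)).cexp).const_mul
      (coefKernel ℓ j b p)
    refine this.congr_deriv ?_
    simp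

/-! ### Interpolation between integer orders -/

/-- On a vertical line `Re (z²) = 2M² - |z|²`, a Gaussian that beats any power of `1 + |z|`. -/
theorem norm_exp_sq_mul_le {M : ℝ} (N : ℕ) {z : ℂ} (hz : z.re = M) :
    ‖Complex.exp (z ^ 2)‖ * (1 + ‖z‖) ^ N ≤ Real.exp (2 * M ^ 2) * (N.factorial * Real.exp 2) := by
  have h1 : (z ^ 2).re = 2 * M ^ 2 - ‖z‖ ^ 2 := by
    rw [← Complex.normSq_eq_norm_sq, Complex.normSq_apply, ← hz, pow_two, Complex.mul_re]
    ring
  have h2 : (1 + ‖z‖) ^ N ≤ N.factorial * Real.exp (1 + ‖z‖) := by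
    have := Real.pow_div_factorial_le_exp (1 + ‖z‖) (by positivity) N
    rwa [div_le_iff₀' (by positivity)] at this
  rw [Complex.norm_exp, h1]
  calc _ ≤ Real.exp (2 * M ^ 2 - ‖z‖ ^ 2) * (N.factorial * Real.exp (1 + ‖z‖)) := by gcongr
    _ = Real.exp (2 * M ^ 2) * (N.factorial * Real.exp (1 + ‖z‖ - ‖z‖ ^ 2)) := by
        rw [sub_eq_add_neg, Real.exp_add, sub_eq_add_neg, Real.exp_add (1 + ‖z‖)]
        ring
    _ ≤ _ := by
        gcongr
        nlinarith [sq_nonneg (‖z‖ - 1)]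

/-- The function to which the three lines theorem is applied. -/
def stripFun (ℓ : ℝ) (b : 𝓢(ℝ, ℂ)) (J : Finset ℤ) (z : ℂ) : EuclideanSpace ℂ J :=
  WithLp.toLp 2 fun j : J =>
    Complex.exp (z ^ 2) * ((lam j : ℂ) ^ z * coef ℓ ((analyticT z b).toLp 2) j)

theorem norm_stripFun_sq (ℓ : ℝ) (b : 𝓢(ℝ, ℂ)) (J : Finset ℤ) (z : ℂ) :
    ‖stripFun ℓ b J z‖ ^ 2 = ‖Complex.exp (z ^ 2)‖ ^ 2
      * ∑ j ∈ J, (lam j ^ z.re * ‖coef ℓ ((analyticT z b).toLp 2) j‖) ^ 2 := by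
  rw [EuclideanSpace.norm_sq_eq, Finset.mul_sum, ← Finset.sum_coe_sort J]
  refine Finset.sum_congr rfl fun j _ => ?_
  simp only [stripFun, norm_mul]
  rw [Complex.norm_cpow_eq_rpow_re_of_pos (lam_pos j)]
  ring

theorem differentiableAt_stripFun {ℓ : ℝ} (hℓ : 0 < ℓ) (b : 𝓢(ℝ, ℂ)) (J : Finset ℤ) {z : ℂ}
    (hz : 2 ≤ z.re) : DifferentiableAt ℂ (stripFun ℓ b J) z := by
  rw [differentiableAt_euclidean]
  intro j
  have h1 := differentiableAt_coef_analyticT hℓ j b hz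
  have h2 : DifferentiableAt ℂ (fun z : ℂ => (lam j : ℂ) ^ z) z :=
    differentiableAt_id.const_cpow (Or.inl (by exact_mod_cast (lam_pos j).ne'))
  have h3 : DifferentiableAt ℂ (fun z : ℂ => Complex.exp (z ^ 2)) z := by fun_prop
  exact h3.mul (h2.mul h1)

/-- The a priori boundedness that the three lines theorem requires; this bound may depend on `b` and
`J`, as it does not enter the conclusion. -/
theorem bddAbove_stripFun {ℓ : ℝ} (hℓ : 0 < ℓ) (b : 𝓢(ℝ, ℂ)) (J : Finset ℤ) {M : ℝ} :
    BddAbove ((norm ∘ stripFun ℓ b J) '' Complex.HadamardThreeLines.verticalClosedStrip 2 M) := by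
  set I := ∫ p : ℝ × ℝ, √(2 * ℓ / Real.pi) / ℓ * ((1 + p.1 ^ 2)⁻¹ * ‖b p.2‖)
    ∂(volume.prod volume)
  refine ⟨√((Real.exp (M ^ 2)) ^ 2 * ∑ j ∈ J, (lam j ^ M * I) ^ 2), ?_⟩
  rintro _ ⟨z, hz, rfl⟩
  simp only [Function.comp_apply]
  apply Real.le_sqrt_of_sq_le
  rw [norm_stripFun_sq]
  have hz1 : 2 ≤ z.re := hz.1
  have hz2 : z.re ≤ M := hz.2
  have h1 : ‖Complex.exp (z ^ 2)‖ ≤ Real.exp (M ^ 2) := by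
    rw [Complex.norm_exp, Real.exp_le_exp, pow_two, Complex.mul_re]
    nlinarith [mul_self_nonneg z.im]
  have h2 : ∀ j ∈ J, (lam j ^ z.re * ‖coef ℓ ((analyticT z b).toLp 2) j‖) ^ 2
      ≤ (lam j ^ M * I) ^ 2 := by
    intro j _
    have e1 := norm_coef_analyticT_le hℓ j b (z := z) (by linarith)
    have e2 := Real.rpow_le_rpow_of_exponent_le (one_le_lam j) hz2
    have e3 := Real.rpow_nonneg (lam_pos j).le
    exact pow_le_pow_left₀ (mul_nonneg (e3 _) (norm_nonneg _))
      (mul_le_mul e2 e1 (norm_nonneg _) (e3 _)) 2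
  exact mul_le_mul (pow_le_pow_left₀ (norm_nonneg _) h1 2) (Finset.sum_le_sum h2)
    (Finset.sum_nonneg fun _ _ => sq_nonneg _) (sq_nonneg _)

theorem exists_bound_stripFun {ℓ : ℝ} (hℓ : 0 < ℓ) (M : ℕ) :
    ∃ C : ℝ, 0 ≤ C ∧ ∀ z : ℂ, z.re = M → ∀ (b : 𝓢(ℝ, ℂ)) (J : Finset ℤ),
      ‖stripFun ℓ b J z‖ ≤ C * ‖b.toLp 2‖ := by
  obtain ⟨C, N, hC, h⟩ := exists_bound_on_line hℓ M
  refine ⟨C * (Real.exp (2 * (M : ℝ) ^ 2) * (N.factorial * Real.exp 2)), by positivity,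
    fun z hz b J => ?_⟩
  have h0 := h z hz b J
  have h1 := norm_stripFun_sq ℓ b J z
  simp_rw [hz, Real.rpow_natCast] at h1
  have h2 := norm_exp_sq_mul_le N hz
  generalize hB : ‖b.toLp 2‖ = B at h0 ⊢
  have hB0 : 0 ≤ B := hB ▸ norm_nonneg _
  have h3 : ‖stripFun ℓ b J z‖ ^ 2
      ≤ (‖Complex.exp (z ^ 2)‖ * (C * (1 + ‖z‖) ^ N * B)) ^ 2 := by
    rw [h1, mul_pow]
    exact mul_le_mul_of_nonneg_left h0 (sq_nonneg _)
  refine (abs_le_of_sq_le_sq' h3 (by positivity)).2.trans ?_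
  calc _ = C * (‖Complex.exp (z ^ 2)‖ * (1 + ‖z‖) ^ N) * B := by ring
    _ ≤ _ := mul_le_mul_of_nonneg_right (mul_le_mul_of_nonneg_left h2 hC) hB0

/-- Stein interpolation between the lines `Re z = 2` and `Re z = M`. The values lie in the
finite-dimensional space `ℂ^J`, so holomorphy is checked coordinatewise, while the bounds on the two
lines do not depend on `J`. -/
theorem exists_bound_schwartz {ℓ : ℝ} (hℓ : 0 < ℓ) {s : ℝ} (hs : 2 ≤ s) :
    ∃ C : ℝ, 0 ≤ C ∧ ∀ (b : 𝓢(ℝ, ℂ)) (J : Finset ℤ),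
      ∑ j ∈ J, (lam j ^ s * ‖coef ℓ ((analyticT s b).toLp 2) j‖) ^ 2 ≤ (C * ‖b.toLp 2‖) ^ 2 := by
  obtain ⟨M, hM⟩ := exists_nat_gt s
  obtain ⟨C₁, hC₁, h₁⟩ := exists_bound_stripFun hℓ 2
  obtain ⟨C₂, hC₂, h₂⟩ := exists_bound_stripFun hℓ M
  refine ⟨C₁ + C₂, by positivity, fun b J => ?_⟩
  have h₁' := fun z hz => h₁ z hz b J
  have h₂' := fun z hz => h₂ z hz b J
  have hn := norm_stripFun_sq ℓ b J s
  generalize hB : ‖b.toLp 2‖ = B at h₁' h₂' ⊢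
  have hB0 : 0 ≤ B := hB ▸ norm_nonneg _
  have hK0 : 0 ≤ (C₁ + C₂) * B := by positivity
  have h2M : (2 : ℝ) < M := by linarith
  have hcl : closure (Complex.HadamardThreeLines.verticalStrip 2 M)
      ⊆ Complex.HadamardThreeLines.verticalClosedStrip 2 M :=
    closure_minimal (preimage_mono Ioo_subset_Icc_self)
      (isClosed_Icc.preimage Complex.continuous_re)
  have hd : DiffContOnCl ℂ (stripFun ℓ b J) (Complex.HadamardThreeLines.verticalStrip 2 M) :=
    DifferentiableOn.diffContOnCl fun z hz =>
      (differentiableAt_stripFun hℓ b J (hcl hz).1).differentiableWithinAt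
  have ha : ∀ z ∈ Complex.re ⁻¹' {(2 : ℝ)}, ‖stripFun ℓ b J z‖ ≤ (C₁ + C₂) * B := by
    intro z hz
    refine (h₁' z (by simpa using hz)).trans ?_
    nlinarith [mul_nonneg hC₂ hB0]
  have hb : ∀ z ∈ Complex.re ⁻¹' {(M : ℝ)}, ‖stripFun ℓ b J z‖ ≤ (C₁ + C₂) * B := by
    intro z hz
    refine (h₂' z (by simpa using hz)).trans ?_
    nlinarith [mul_nonneg hC₁ hB0]
  have key := Complex.HadamardThreeLines.norm_le_interp_of_mem_verticalClosedStrip' h2M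
    (z := (s : ℂ)) (f := stripFun ℓ b J) ⟨by simpa using hs, by simpa using hM.le⟩ hd
    (bddAbove_stripFun hℓ b J) ha hb
  have hθ : 0 ≤ (s - 2) / (M - 2) := div_nonneg (by linarith) (by linarith)
  have hθ' : (s - 2) / (M - 2) ≤ 1 := (div_le_one (by linarith)).2 (by linarith)
  rw [Complex.ofReal_re, ← Real.rpow_add_of_nonneg hK0 (by linarith) hθ, sub_add_cancel,
    Real.rpow_one] at key
  rw [Complex.ofReal_re] at hn
  -- At the real point `s` the convergence factor has modulus at least `1` and can be dropped.
  have h1 : 1 ≤ ‖Complex.exp ((s : ℂ) ^ 2)‖ := by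
    rw [Complex.norm_exp, Real.one_le_exp_iff, ← Complex.ofReal_pow, Complex.ofReal_re]
    positivity
  refine le_trans ?_ (pow_le_pow_left₀ (norm_nonneg _) key 2)
  rw [hn]
  exact le_mul_of_one_le_left (Finset.sum_nonneg fun _ _ => sq_nonneg _) (one_le_pow₀ h1)

end MTC

end

/-! ### From Schwartz functions to `L²`, and the discrete operators on coefficients -/

noncomputable section

namespace MTC

open SchwartzMap

/-! ### Operators on `L²` -/

theorem coeFn_toL2 {E : Type} [NormedAddCommGroup E] {f : ℝ → E} (h : MemLp f 2 volume) :
    toL2 f =ᵐ[volume] f := by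
  rw [toL2_eq h]
  exact h.coeFn_toLp

theorem toL2_coeFn {E : Type} [NormedAddCommGroup E] (f : Lp E 2 (volume : Measure ℝ)) :
    toL2 f = f := by
  rw [toL2_eq (Lp.memLp f)]
  exact Lp.toLp_coeFn f _

theorem toL2_congr {E : Type} [NormedAddCommGroup E] {f g : ℝ → E} (h : f =ᵐ[volume] g) :
    toL2 f = toL2 g := by
  by_cases hf : MemLp f 2 volume
  · rw [toL2_eq hf, toL2_eq ((memLp_congr_ae h).1 hf)]
    exact (MemLp.toLp_eq_toLp_iff _ _).2 h
  · have hg : ¬ MemLp g 2 volume := fun hg => hf ((memLp_congr_ae h).2 hg)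
    rw [toL2, toL2, dif_neg hf, dif_neg hg]

theorem memLp_mul_of_bounded {g : ℝ → ℂ} (hg : Measurable g) (hb : ∀ x, ‖g x‖ ≤ 1) (f : L2C) :
    MemLp (fun x => g x * f x) 2 volume := by
  refine (Lp.memLp f).mono (hg.aestronglyMeasurable.mul (Lp.aestronglyMeasurable f))
    (Eventually.of_forall fun x => ?_)
  rw [norm_mul]
  exact mul_le_of_le_one_left (norm_nonneg _) (hb x)

/-- Multiplication by a measurable function that is bounded by `1`. -/
def mulL2 (g : ℝ → ℂ) (hg : Measurable g) (hb : ∀ x, ‖g x‖ ≤ 1) : L2C →L[ℂ] L2C :=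
  LinearMap.mkContinuous
    { toFun := fun f => toL2 fun x => g x * f x
      map_add' := fun f f' => toL2_add (memLp_mul_of_bounded hg hb f)
        (memLp_mul_of_bounded hg hb f') (by
          filter_upwards [Lp.coeFn_add f f'] with x hx
          rw [hx, Pi.add_apply, Pi.add_apply, mul_add])
      map_smul' := fun c f => by
        have h : (fun x => g x * (c • f : L2C) x) =ᵐ[volume] c • fun x => g x * f x := by
          filter_upwards [Lp.coeFn_smul c f] with x hx
          rw [hx, Pi.smul_apply, Pi.smul_apply, smul_eq_mul, smul_eq_mul]
          ring
        rw [toL2_congr h, toL2_eq ((memLp_mul_of_bounded hg hb f).const_smul c),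
          toL2_eq (memLp_mul_of_bounded hg hb f)]
        exact MemLp.toLp_const_smul c _ } 1 fun f => by
    rw [one_mul]
    refine Lp.norm_le_norm_of_ae_le ?_
    filter_upwards [coeFn_toL2 (memLp_mul_of_bounded hg hb f)] with x hx
    change ‖toL2 (fun x => g x * f x) x‖ ≤ _
    rw [hx, norm_mul]
    exact mul_le_of_le_one_left (norm_nonneg _) (hb x)

theorem coeFn_mulL2 (g : ℝ → ℂ) (hg : Measurable g) (hb : ∀ x, ‖g x‖ ≤ 1) (f : L2C) :
    mulL2 g hg hb f =ᵐ[volume] fun x => g x * f x :=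
  coeFn_toL2 (memLp_mul_of_bounded hg hb f)

theorem norm_mulL2_le (g : ℝ → ℂ) (hg : Measurable g) (hb : ∀ x, ‖g x‖ ≤ 1) (f : L2C) :
    ‖mulL2 g hg hb f‖ ≤ ‖f‖ := by
  refine Lp.norm_le_norm_of_ae_le ?_
  filter_upwards [coeFn_mulL2 g hg hb f] with x hx
  rw [hx, norm_mul]
  exact mul_le_of_le_one_left (norm_nonneg _) (hb x)

theorem coeFn_complexify (f : L2) : complexify f =ᵐ[volume] fun x => (f x : ℂ) :=
  ContinuousLinearMap.coeFn_compLp _ f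

theorem coeFn_realPart (f : L2C) : realPart f =ᵐ[volume] fun x => (f x).re :=
  ContinuousLinearMap.coeFn_compLp _ f

/-- The isometric embedding of real into complex `L²`. -/
def complexifyL : L2 →ₗᵢ[ℝ] L2C where
  toLinearMap := (Complex.ofRealCLM.compLpₗ 2 volume)
  norm_map' f := by
    have h : ‖complexify f‖ = ‖f‖ := by
      rw [Lp.norm_def, Lp.norm_def]
      congr 1
      refine eLpNorm_congr_norm_ae ?_
      filter_upwards [coeFn_complexify f] with x hx
      rw [hx, Complex.norm_real]
    exact h

theorem complexifyL_apply (f : L2) : complexifyL f = complexify f := rfl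

theorem norm_complexify (f : L2) : ‖complexify f‖ = ‖f‖ := complexifyL.norm_map f

theorem complexify_add (f g : L2) : complexify (f + g) = complexify f + complexify g :=
  complexifyL.map_add f g

theorem complexify_sub (f g : L2) : complexify (f - g) = complexify f - complexify g :=
  complexifyL.map_sub f g

theorem complexify_neg (f : L2) : complexify (-f) = -complexify f :=
  complexifyL.map_neg f

theorem complexify_smul (c : ℝ) (f : L2) : complexify (c • f) = (c : ℂ) • complexify f := by
  rw [← complexifyL_apply, map_smul, complexifyL_apply]
  rfl

theorem complexify_injective : Function.Injective complexify := complexifyL.injective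

/-- The real part as a continuous linear map. -/
def realPartL : L2C →L[ℝ] L2 := Complex.reCLM.compLpL 2 volume

theorem norm_realPart_le (f : L2C) : ‖realPart f‖ ≤ ‖f‖ := by
  refine Lp.norm_le_norm_of_ae_le ?_
  filter_upwards [coeFn_realPart f] with x hx
  rw [hx]
  exact Complex.abs_re_le_norm _

theorem measurable_hilbert_symbol :
    Measurable fun ξ : ℝ => -Complex.I * (SignType.sign ξ : ℂ) := by
  refine measurable_const.mul ?_
  have h : (fun ξ : ℝ => ((SignType.sign ξ : SignType) : ℂ))
      = fun ξ : ℝ => if 0 < ξ then (1 : ℂ) else if ξ < 0 then -1 else 0 := by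
    ext ξ
    rcases lt_trichotomy ξ 0 with h | h | h
    · simp [sign_neg h, h, h.not_gt]
    · simp [h]
    · simp [sign_pos h, h]
  rw [h]
  exact Measurable.ite measurableSet_Ioi measurable_const
    (Measurable.ite measurableSet_Iio measurable_const measurable_const)

theorem norm_hilbert_symbol_le (ξ : ℝ) : ‖-Complex.I * (SignType.sign ξ : ℂ)‖ ≤ 1 := by
  rcases lt_trichotomy ξ 0 with h | h | h
  · simp [sign_neg h]
  · simp [h]
  · simp [sign_pos h]

/-- The Hilbert transform as a continuous linear map. -/
def hilbertL : L2 →L[ℝ] L2 :=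
  realPartL ∘L
    (((Lp.fourierTransformₗᵢ ℝ ℂ).symm.toContinuousLinearEquiv.toContinuousLinearMap ∘L
      mulL2 _ measurable_hilbert_symbol norm_hilbert_symbol_le ∘L
      (Lp.fourierTransformₗᵢ ℝ ℂ).toContinuousLinearEquiv.toContinuousLinearMap).restrictScalars ℝ)
    ∘L complexifyL.toContinuousLinearMap

theorem norm_hilbert_le (f : L2) : ‖hilbert f‖ ≤ ‖f‖ := by
  refine (norm_realPart_le _).trans ?_
  have h1 := norm_mulL2_le _ measurable_hilbert_symbol norm_hilbert_symbol_le (𝓕 (complexify f))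
  rw [Lp.norm_fourier_eq, norm_complexify] at h1
  refine le_of_eq_of_le ?_ h1
  exact (Lp.fourierTransformₗᵢ ℝ ℂ).symm.norm_map _

/-! ### The weighted Bessel potential on `L²` -/

theorem measurable_pw (z : ℂ) : Measurable (pw z) :=
  (continuous_iff_continuousAt.2 fun x => (hasDerivAt_pw z x).continuousAt).measurable

theorem measurable_besselPw (z : ℂ) : Measurable (besselPw z) :=
  (measurable_pw _).comp (measurable_const.mul measurable_id)

theorem norm_pw_le {s : ℝ} (hs : 0 ≤ s) (x : ℝ) : ‖pw s x‖ ≤ 1 := by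
  rw [norm_pw, Complex.ofReal_re]
  exact Real.rpow_le_one_of_one_le_of_nonpos (by linarith [sq_nonneg x]) (by linarith)

theorem norm_besselPw_le {s : ℝ} (hs : 0 ≤ s) (ξ : ℝ) : ‖besselPw s ξ‖ ≤ 1 := by
  rw [norm_besselPw, Complex.ofReal_re]
  exact Real.rpow_le_one_of_one_le_of_nonpos (by linarith [sq_nonneg (2 * Real.pi * ξ)])
    (by linarith)

/-- The operator `b ↦ (1 + x²)^(-s) 𝓕⁻[(1 + (2πξ)²)^(-s/2) b]` on `L²`. -/
def besselT {s : ℝ} (hs : 0 ≤ s) : L2C →L[ℂ] L2C :=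
  mulL2 (pw s) (measurable_pw s) (norm_pw_le hs) ∘L
    (Lp.fourierTransformₗᵢ ℝ ℂ).symm.toContinuousLinearEquiv.toContinuousLinearMap ∘L
    mulL2 (besselPw s) (measurable_besselPw s) (norm_besselPw_le hs)

theorem besselT_apply {s : ℝ} (hs : 0 ≤ s) (b : L2C) :
    besselT hs b = mulL2 (pw s) (measurable_pw s) (norm_pw_le hs)
      (𝓕⁻ (mulL2 (besselPw s) (measurable_besselPw s) (norm_besselPw_le hs) b)) := rfl

theorem norm_besselT_le {s : ℝ} (hs : 0 ≤ s) (b : L2C) : ‖besselT hs b‖ ≤ ‖b‖ := by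
  rw [besselT_apply]
  refine (norm_mulL2_le _ _ _ _).trans (le_trans ?_ (norm_mulL2_le _ (measurable_besselPw s)
    (norm_besselPw_le hs) b))
  exact ((Lp.fourierTransformₗᵢ ℝ ℂ).symm.norm_map _).le

theorem mulL2_toLp (g : ℝ → ℂ) (hg : Measurable g) (hb : ∀ x, ‖g x‖ ≤ 1)
    (ht : g.HasTemperateGrowth) (f : 𝓢(ℝ, ℂ)) :
    mulL2 g hg hb (f.toLp 2) = (smulLeftCLM ℂ g f).toLp 2 := by
  apply Lp.ext
  filter_upwards [coeFn_mulL2 g hg hb (f.toLp 2), f.coeFn_toLp 2,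
    (smulLeftCLM ℂ g f).coeFn_toLp 2] with x h1 h2 h3
  rw [h1, h2, h3, smulLeftCLM_apply_apply ht, smul_eq_mul]

theorem besselT_toLp {s : ℝ} (hs : 0 ≤ s) (b : 𝓢(ℝ, ℂ)) :
    besselT hs (b.toLp 2) = (analyticT s b).toLp 2 := by
  rw [besselT_apply, mulL2_toLp _ _ _ (hasTemperateGrowth_besselPw s),
    SchwartzMap.toLp_fourierInv_eq, mulL2_toLp _ _ _ (hasTemperateGrowth_pw s), analyticT]

theorem continuous_coef (ℓ : ℝ) (j : ℤ) : Continuous fun f : L2C => coef ℓ f j :=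
  continuous_const.inner continuous_id

/-- For a finite set `J` both sides are continuous in `b ∈ L²`, so the estimate passes from the
dense Schwartz functions to all of `L²`. -/
theorem exists_bound_besselT {ℓ : ℝ} (hℓ : 0 < ℓ) {s : ℝ} (hs : 2 ≤ s) (hs0 : 0 ≤ s) :
    ∃ C : ℝ, 0 ≤ C ∧ ∀ (b : L2C) (J : Finset ℤ),
      ∑ j ∈ J, (lam j ^ s * ‖coef ℓ (besselT hs0 b) j‖) ^ 2 ≤ (C * ‖b‖) ^ 2 := by
  obtain ⟨C, hC, h⟩ := exists_bound_schwartz hℓ hs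
  refine ⟨C, hC, fun b J => ?_⟩
  have hd : DenseRange (toLpCLM ℂ (E := ℝ) ℂ 2 volume) :=
    SchwartzMap.denseRange_toLpCLM ENNReal.ofNat_ne_top
  refine hd.induction_on (p := fun b : L2C =>
    ∑ j ∈ J, (lam j ^ s * ‖coef ℓ (besselT hs0 b) j‖) ^ 2 ≤ (C * ‖b‖) ^ 2) b ?_ ?_
  · refine isClosed_le (continuous_finsetSum _ fun j _ => ?_) (by fun_prop)
    have := (continuous_coef ℓ j).comp (besselT hs0).continuous
    exact (continuous_const.mul this.norm).pow 2
  · intro f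
    rw [toLpCLM_apply, besselT_toLp]
    exact h f J

/-! ### The weighted Sobolev space in terms of the Bessel potential -/

theorem norm_wsob {s r : ℝ} (u : WSob s r) : ‖u‖ = ‖WSob.bessel s r u‖ := rfl

theorem coeFn_bessel {s r : ℝ} (u : WSob s r) :
    WSob.bessel s r u =ᵐ[volume] besselSymbol s r u.incl := coeFn_toL2 u.2.2

theorem besselPw_mul_rpow (s ξ : ℝ) :
    besselPw s ξ * (((1 + (2 * Real.pi * ξ) ^ 2) ^ (s / 2) : ℝ) : ℂ) = 1 := by
  rw [besselPw, show (s : ℂ) / 2 = ((s / 2 : ℝ) : ℂ) by push_cast; rfl, pw_ofReal,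
    ← Complex.ofReal_mul, ← Real.rpow_add (by positivity)]
  simp

theorem pw_mul_rpow (s x : ℝ) : pw s x * (((1 + x ^ 2) ^ (2 * s / 2) : ℝ) : ℂ) = 1 := by
  rw [pw_ofReal, ← Complex.ofReal_mul, ← Real.rpow_add (by positivity)]
  simp

/-- The operator `besselT` undoes the isometry that defines the norm, so bounds for `besselT` are
bounds on the weighted space. The next lemma is the converse: whatever `besselT` produces as a real
function lies in that space. -/
theorem complexify_incl {s : ℝ} (hs : 0 ≤ s) (u : WSob s (2 * s)) :
    complexify u.incl = besselT hs (WSob.bessel s (2 * s) u) := by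
  have h1 : mulL2 (besselPw s) (measurable_besselPw s) (norm_besselPw_le hs)
      (WSob.bessel s (2 * s) u) = 𝓕 (toL2 (weighted (2 * s) u.incl)) := by
    apply Lp.ext
    filter_upwards [coeFn_mulL2 _ (measurable_besselPw s) (norm_besselPw_le hs)
      (WSob.bessel s (2 * s) u), coeFn_bessel u] with ξ e1 e2
    rw [e1, e2, besselSymbol, ← mul_assoc, besselPw_mul_rpow, one_mul]
  rw [besselT_apply, h1, FourierTransform.fourierInv_fourier_eq]
  apply Lp.ext
  filter_upwards [coeFn_mulL2 _ (measurable_pw s) (norm_pw_le hs)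
    (toL2 (weighted (2 * s) u.incl)), coeFn_toL2 u.2.1, coeFn_complexify u.incl] with x e1 e2 e3
  rw [e1, e3]
  have e2' : toL2 (weighted (2 * s) u.incl) x = weighted (2 * s) u.incl x := e2
  rw [e2', weighted, Complex.ofReal_mul, ← mul_assoc, pw_mul_rpow, one_mul]

theorem exists_wsob_of_complexify_eq {s : ℝ} (hs : 0 ≤ s) {u : L2} {b : L2C}
    (h : complexify u = besselT hs b) :
    ∃ v : WSob s (2 * s), v.incl = u ∧ WSob.bessel s (2 * s) v = b := by
  set V : L2C := 𝓕⁻ (mulL2 (besselPw s) (measurable_besselPw s) (norm_besselPw_le hs) b) with hV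
  have h1 : weighted (2 * s) u =ᵐ[volume] V := by
    have h' := h
    rw [besselT_apply, ← hV] at h'
    filter_upwards [coeFn_mulL2 _ (measurable_pw s) (norm_pw_le hs) V,
      coeFn_complexify u] with x e1 e2
    rw [← h', e2] at e1
    rw [weighted, Complex.ofReal_mul, e1, ← mul_assoc, mul_comm _ (pw s x), pw_mul_rpow, one_mul]
  have h2 : toL2 (weighted (2 * s) u) = V := by rw [toL2_congr h1, toL2_coeFn]
  have h3 : besselSymbol s (2 * s) u =ᵐ[volume] b := by
    have e : 𝓕 (toL2 (weighted (2 * s) u))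
        = mulL2 (besselPw s) (measurable_besselPw s) (norm_besselPw_le hs) b := by
      rw [h2, hV, FourierTransform.fourier_fourierInv_eq]
    filter_upwards [coeFn_mulL2 _ (measurable_besselPw s) (norm_besselPw_le hs) b] with ξ e1
    rw [besselSymbol, e, e1, ← mul_assoc, mul_comm _ (besselPw s ξ), besselPw_mul_rpow, one_mul]
  refine ⟨⟨u, (memLp_congr_ae h1).2 (Lp.memLp V), (memLp_congr_ae h3).2 (Lp.memLp b)⟩, rfl, ?_⟩
  change toL2 (besselSymbol s (2 * s) u) = b
  rw [toL2_congr h3, toL2_coeFn]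

theorem norm_incl_le {s : ℝ} (hs : 0 ≤ s) (u : WSob s (2 * s)) : ‖u.incl‖ ≤ ‖u‖ := by
  rw [← norm_complexify, complexify_incl hs, norm_wsob]
  exact norm_besselT_le hs _

/-- The inclusion of the weighted Sobolev space as a continuous linear map. -/
def inclL {s : ℝ} (hs : 0 ≤ s) : WSob s (2 * s) →L[ℝ] L2 :=
  LinearMap.mkContinuous (wsobSubmodule s (2 * s)).subtype 1 fun u => by
    rw [one_mul]
    exact norm_incl_le hs u

theorem inclL_apply {s : ℝ} (hs : 0 ≤ s) (u : WSob s (2 * s)) : inclL hs u = u.incl := rfl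

theorem incl_injective {s r : ℝ} : Function.Injective (WSob.incl : WSob s r → L2) :=
  Subtype.val_injective

/-- Along a Cauchy sequence the inclusions and their Bessel images converge in `L²`, and the limits
stay related by `besselT`. Completeness is needed to integrate curves in this space. -/
theorem completeSpace_wsob {s : ℝ} (hs : 0 ≤ s) : CompleteSpace (WSob s (2 * s)) := by
  refine Metric.complete_of_cauchySeq_tendsto fun v hv => ?_
  have hb : CauchySeq fun n => WSob.bessel s (2 * s) (v n) := by
    rw [Metric.cauchySeq_iff'] at hv ⊢
    exact hv
  obtain ⟨b, hb⟩ := cauchySeq_tendsto_of_complete hb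
  have hu : CauchySeq fun n => inclL hs (v n) := hv.map (inclL hs).uniformContinuous
  obtain ⟨u, hu⟩ := cauchySeq_tendsto_of_complete hu
  have h : complexify u = besselT hs b := by
    have h1 := (complexifyL.continuous.tendsto u).comp hu
    have h2 := ((besselT hs).continuous.tendsto b).comp hb
    refine tendsto_nhds_unique h1 (h2.congr fun n => ?_)
    exact (complexify_incl hs (v n)).symm
  obtain ⟨w, -, hw⟩ := exists_wsob_of_complexify_eq hs h
  refine ⟨w, ?_⟩
  rw [← hw, tendsto_iff_norm_sub_tendsto_zero] at hb
  rw [tendsto_iff_norm_sub_tendsto_zero]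
  refine hb.congr fun n => ?_
  rw [← map_sub]
  rfl

theorem exists_bound_coef {ℓ : ℝ} (hℓ : 0 < ℓ) {s : ℝ} (hs : 2 ≤ s) :
    ∃ C : ℝ, 0 ≤ C ∧ ∀ (u : WSob s (2 * s)) (J : Finset ℤ),
      ∑ j ∈ J, (lam j ^ s * ‖coef ℓ (complexify u.incl) j‖) ^ 2 ≤ (C * ‖u‖) ^ 2 := by
  have hs0 : 0 ≤ s := by linarith
  obtain ⟨C, hC, h⟩ := exists_bound_besselT hℓ hs hs0
  refine ⟨C, hC, fun u J => ?_⟩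
  rw [complexify_incl hs0]
  exact h _ J

/-! ### Weighted norms of coefficient sequences -/

/-- The weighted `ℓ²` norm of a sequence. -/
def sn (σ : ℝ) (c : ℤ → ℂ) : ℝ≥0∞ :=
  eLpNorm (fun j : ℤ => lam j ^ σ * ‖c j‖) 2 Measure.count

theorem aesm_int {E : Type*} [TopologicalSpace E] (f : ℤ → E) :
    AEStronglyMeasurable f (Measure.count : Measure ℤ) :=
  (StronglyMeasurable.of_discrete).aestronglyMeasurable

theorem lam_rpow_nonneg (j : ℤ) (σ : ℝ) : 0 ≤ lam j ^ σ := Real.rpow_nonneg (lam_pos j).le σ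

theorem sn_le_mul {σ τ K : ℝ} {c d : ℤ → ℂ}
    (h : ∀ j, lam j ^ σ * ‖c j‖ ≤ K * (lam j ^ τ * ‖d j‖)) :
    sn σ c ≤ ENNReal.ofReal K * sn τ d := by
  refine eLpNorm_le_mul_eLpNorm_of_ae_le_mul (Eventually.of_forall fun j => ?_) 2
  rw [Real.norm_of_nonneg (mul_nonneg (lam_rpow_nonneg j σ) (norm_nonneg _)),
    Real.norm_of_nonneg (mul_nonneg (lam_rpow_nonneg j τ) (norm_nonneg _))]
  exact h j

theorem sn_mono {σ : ℝ} {c d : ℤ → ℂ} (h : ∀ j, ‖c j‖ ≤ ‖d j‖) : sn σ c ≤ sn σ d := by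
  have := sn_le_mul (σ := σ) (τ := σ) (K := 1) (c := c) (d := d) fun j => by
    rw [one_mul]
    exact mul_le_mul_of_nonneg_left (h j) (lam_rpow_nonneg j σ)
  simpa using this

theorem sn_mono_exponent {σ τ : ℝ} (hστ : σ ≤ τ) (c : ℤ → ℂ) : sn σ c ≤ sn τ c := by
  have := sn_le_mul (σ := σ) (τ := τ) (K := 1) (c := c) (d := c) fun j => by
    rw [one_mul]
    exact mul_le_mul_of_nonneg_right (Real.rpow_le_rpow_of_exponent_le (one_le_lam j) hστ)
      (norm_nonneg _)
  simpa using this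

theorem sn_add_le (σ : ℝ) (c d : ℤ → ℂ) : sn σ (c + d) ≤ sn σ c + sn σ d := by
  refine le_trans ?_ (eLpNorm_add_le (aesm_int _) (aesm_int _) (by norm_num))
  refine eLpNorm_mono fun j => ?_
  have h1 := mul_nonneg (lam_rpow_nonneg j σ) (norm_nonneg (c j))
  have h2 := mul_nonneg (lam_rpow_nonneg j σ) (norm_nonneg (d j))
  rw [Pi.add_apply, Real.norm_of_nonneg (mul_nonneg (lam_rpow_nonneg j σ) (norm_nonneg _)),
    Pi.add_apply, Real.norm_of_nonneg (add_nonneg h1 h2), ← mul_add]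
  exact mul_le_mul_of_nonneg_left (norm_add_le _ _) (lam_rpow_nonneg j σ)

theorem sn_le_of_sum_le {σ K : ℝ} (hK : 0 ≤ K) {c : ℤ → ℂ}
    (h : ∀ J : Finset ℤ, ∑ j ∈ J, (lam j ^ σ * ‖c j‖) ^ 2 ≤ K ^ 2) :
    sn σ c ≤ ENNReal.ofReal K := by
  rw [sn, eLpNorm_eq_lintegral_rpow_enorm_toReal two_ne_zero ENNReal.ofNat_ne_top, lintegral_count]
  have h1 : ∑' j, ‖lam j ^ σ * ‖c j‖‖ₑ ^ (2 : ℝ≥0∞).toReal ≤ ENNReal.ofReal K ^ (2 : ℝ) := by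
    rw [ENNReal.tsum_eq_iSup_sum]
    refine iSup_le fun J => ?_
    have e : ∀ j, ‖lam j ^ σ * ‖c j‖‖ₑ ^ (2 : ℝ≥0∞).toReal
        = ENNReal.ofReal ((lam j ^ σ * ‖c j‖) ^ 2) := by
      intro j
      have h0 := mul_nonneg (lam_rpow_nonneg j σ) (norm_nonneg (c j))
      rw [Real.enorm_eq_ofReal h0, ENNReal.ofReal_pow h0]
      simp
    rw [Finset.sum_congr rfl fun j _ => e j, ← ENNReal.ofReal_sum_of_nonneg fun _ _ => sq_nonneg _,
      ENNReal.ofReal_rpow_of_nonneg hK two_pos.le]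
    refine ENNReal.ofReal_le_ofReal ?_
    rw [show K ^ (2 : ℝ) = K ^ 2 by norm_cast]
    exact h J
  calc _ ≤ (ENNReal.ofReal K ^ (2 : ℝ)) ^ (1 / (2 : ℝ≥0∞).toReal) := by
        exact ENNReal.rpow_le_rpow h1 (by simp)
    _ = _ := by
        rw [← ENNReal.rpow_mul]
        simp

theorem summable_sq_of_sn {c : ℤ → ℂ} (h : sn 0 c < ⊤) : Summable fun j => ‖c j‖ ^ 2 := by
  have h1 := (eLpNorm_lt_top_iff_lintegral_rpow_enorm_lt_top two_ne_zero
    ENNReal.ofNat_ne_top).1 h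
  rw [lintegral_count] at h1
  have e : ∀ j, ‖lam j ^ (0 : ℝ) * ‖c j‖‖ₑ ^ (2 : ℝ≥0∞).toReal = ENNReal.ofReal (‖c j‖ ^ 2) := by
    intro j
    rw [Real.rpow_zero, one_mul, enorm_norm, ← ofReal_norm, ENNReal.ofReal_pow
      (norm_nonneg _)]
    simp
  simp_rw [e] at h1
  refine (ENNReal.summable_toReal h1.ne).congr fun j => ?_
  rw [ENNReal.toReal_ofReal (sq_nonneg _)]

/-- The sequence truncated to `|2j + 1| ≤ n`. -/
def trunc (n : ℕ) (c : ℤ → ℂ) (j : ℤ) : ℂ := if lam j ≤ n then c j else 0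

theorem norm_trunc_le (n : ℕ) (c : ℤ → ℂ) (j : ℤ) : ‖trunc n c j‖ ≤ ‖c j‖ := by
  rw [trunc]
  split_ifs <;> simp

theorem trunc_sub (n : ℕ) (c d : ℤ → ℂ) : trunc n (c - d) = trunc n c - trunc n d := by
  ext j
  simp only [trunc, Pi.sub_apply]
  split_ifs <;> simp

theorem sn_trunc_le (σ : ℝ) (n : ℕ) (c : ℤ → ℂ) : sn σ (trunc n c) ≤ sn σ c :=
  sn_mono (norm_trunc_le n c)

theorem lam_rpow_le {σ s : ℝ} (hσ : σ ≤ s) {n : ℕ} (hn : 1 ≤ n) {j : ℤ} (h : (n : ℝ) ≤ lam j) :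
    lam j ^ σ ≤ (n : ℝ) ^ (σ - s) * lam j ^ s := by
  have hn' : (0 : ℝ) < n := by exact_mod_cast hn
  have e : lam j ^ σ = lam j ^ (σ - s) * lam j ^ s := by
    rw [← Real.rpow_add (lam_pos j)]
    congr 1
    ring
  rw [e]
  exact mul_le_mul_of_nonneg_right (Real.rpow_le_rpow_of_nonpos hn' h (by linarith))
    (lam_rpow_nonneg j s)

/-- The tail lives where `lam j > n`; there `lam^σ = lam^(σ-s) lam^s` and the first factor is at
most `n^(σ-s)`. -/
theorem sn_sub_trunc_le {σ s : ℝ} (hσ : σ ≤ s) {n : ℕ} (hn : 1 ≤ n) (c : ℤ → ℂ) :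
    sn σ (c - trunc n c) ≤ ENNReal.ofReal ((n : ℝ) ^ (σ - s)) * sn s c := by
  refine sn_le_mul fun j => ?_
  rw [Pi.sub_apply, trunc]
  split_ifs with h
  · rw [sub_self, norm_zero, mul_zero]
    exact mul_nonneg (by positivity) (mul_nonneg (lam_rpow_nonneg j s) (norm_nonneg _))
  · rw [sub_zero, ← mul_assoc]
    exact mul_le_mul_of_nonneg_right (lam_rpow_le hσ hn (not_le.1 h).le) (norm_nonneg _)

/-- The action of `∂ₓ` on coefficient sequences. -/
def dseq (ℓ : ℝ) (c : ℤ → ℂ) (k : ℤ) : ℂ :=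
  Complex.I / ℓ * ((k + 1) * c (k + 1) + (2 * k + 1) * c k + k * c (k - 1))

theorem dseq_sub (ℓ : ℝ) (c d : ℤ → ℂ) : dseq ℓ (c - d) = dseq ℓ c - dseq ℓ d := by
  ext k
  simp only [dseq, Pi.sub_apply]
  ring

theorem lam_succ_le (k : ℤ) : lam k ≤ 3 * lam (k + 1) := by
  have h := one_le_lam (k + 1)
  rw [lam] at h ⊢
  rw [lam]
  have : (2 * (k : ℝ) + 1) = (2 * ((k + 1 : ℤ) : ℝ) + 1) + (-2) := by push_cast; ring
  rw [this]
  refine (abs_add_le _ _).trans ?_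
  norm_num
  norm_num at h
  linarith

theorem lam_pred_le (k : ℤ) : lam k ≤ 3 * lam (k - 1) := by
  have h := one_le_lam (k - 1)
  rw [lam] at h ⊢
  rw [lam]
  have : (2 * (k : ℝ) + 1) = (2 * ((k - 1 : ℤ) : ℝ) + 1) + 2 := by push_cast; ring
  rw [this]
  refine (abs_add_le _ _).trans ?_
  norm_num
  norm_num at h
  linarith

theorem abs_le_lam (k : ℤ) : |(k : ℝ)| ≤ lam k := by
  rw [lam]
  have : |k| ≤ |2 * k + 1| := by
    rcases abs_cases (2 * k + 1) with h | h <;> rcases abs_cases k with h' | h' <;> omega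
  exact_mod_cast this

theorem abs_le_lam_pred (k : ℤ) : |(k : ℝ)| ≤ lam (k - 1) := by
  rw [lam]
  have : |k| ≤ |2 * (k - 1) + 1| := by
    rcases abs_cases (2 * (k - 1) + 1) with h | h <;> rcases abs_cases k with h' | h' <;> omega
  exact_mod_cast this

theorem lam_rpow_mul_le {σ : ℝ} (hσ : 0 ≤ σ) {k j : ℤ} (h : lam k ≤ 3 * lam j) {a : ℝ}
    (ha : |a| ≤ lam j) (x : ℂ) :
    lam k ^ σ * ‖(a : ℂ) * x‖ ≤ 3 ^ σ * (lam j ^ (σ + 1) * ‖x‖) := by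
  have h1 : lam k ^ σ ≤ 3 ^ σ * lam j ^ σ := by
    rw [← Real.mul_rpow (by norm_num) (lam_pos j).le]
    exact Real.rpow_le_rpow (lam_pos k).le h hσ
  rw [norm_mul, Complex.norm_real, Real.norm_eq_abs, Real.rpow_add_one (lam_pos j).ne']
  calc _ ≤ (3 ^ σ * lam j ^ σ) * (lam j * ‖x‖) := by
        refine mul_le_mul h1 (mul_le_mul_of_nonneg_right ha (norm_nonneg _)) (by positivity) ?_
        exact mul_nonneg (by positivity) (lam_rpow_nonneg j σ)
    _ = _ := by ring

theorem eLpNorm_shift (g : ℤ → ℝ) (a : ℤ) :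
    eLpNorm (fun k => g (k + a)) 2 Measure.count = eLpNorm g 2 Measure.count :=
  eLpNorm_comp_measurePreserving (aesm_int g) (measurePreserving_add_right Measure.count a)

/-- Counting measure is invariant under the shift by `b`, and the weights at `k` and `k + b` are
comparable with the constant `3`. The multiplier `a` costs one power of `lam`. -/
theorem sn_shift_le {σ : ℝ} (hσ : 0 ≤ σ) (c : ℤ → ℂ) (a : ℤ → ℝ) (b : ℤ)
    (hb : ∀ k, lam k ≤ 3 * lam (k + b)) (ha : ∀ k, |a k| ≤ lam (k + b)) :
    sn σ (fun k => (a k : ℂ) * c (k + b)) ≤ ENNReal.ofReal (3 ^ σ) * sn (σ + 1) c := by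
  have h := eLpNorm_shift (fun j => lam j ^ (σ + 1) * ‖c j‖) b
  rw [sn, sn, ← h]
  refine eLpNorm_le_mul_eLpNorm_of_ae_le_mul (Eventually.of_forall fun k => ?_) 2
  rw [Real.norm_of_nonneg (mul_nonneg (lam_rpow_nonneg k σ) (norm_nonneg _)),
    Real.norm_of_nonneg (mul_nonneg (lam_rpow_nonneg _ _) (norm_nonneg _))]
  exact lam_rpow_mul_le hσ (hb k) (ha k) _

theorem sn_succ_le {σ : ℝ} (hσ : 0 ≤ σ) (c : ℤ → ℂ) :
    sn σ (fun k => ((k : ℂ) + 1) * c (k + 1)) ≤ ENNReal.ofReal (3 ^ σ) * sn (σ + 1) c := by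
  have := sn_shift_le hσ c (fun k => (k : ℝ) + 1) 1 lam_succ_le fun k => by
    have := abs_le_lam (k + 1)
    push_cast at this
    exact this
  push_cast at this
  exact this

theorem sn_diag_le {σ : ℝ} (hσ : 0 ≤ σ) (c : ℤ → ℂ) :
    sn σ (fun k => (2 * (k : ℂ) + 1) * c k) ≤ ENNReal.ofReal (3 ^ σ) * sn (σ + 1) c := by
  have := sn_shift_le hσ c (fun k => 2 * (k : ℝ) + 1) 0
    (fun k => by rw [add_zero]; linarith [lam_pos k]) fun k => by rw [add_zero, lam]
  push_cast at this
  simpa using this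

theorem sn_pred_le {σ : ℝ} (hσ : 0 ≤ σ) (c : ℤ → ℂ) :
    sn σ (fun k => (k : ℂ) * c (k - 1)) ≤ ENNReal.ofReal (3 ^ σ) * sn (σ + 1) c := by
  have := sn_shift_le hσ c (fun k => (k : ℝ)) (-1) lam_pred_le abs_le_lam_pred
  push_cast at this
  exact this

/-- Three diagonals, each costing one power of `lam` and the constant `3^σ`. -/
theorem sn_dseq_le {ℓ : ℝ} (hℓ : 0 < ℓ) {σ : ℝ} (hσ : 0 ≤ σ) (c : ℤ → ℂ) :
    sn σ (dseq ℓ c) ≤ ENNReal.ofReal (3 ^ (σ + 1) / ℓ) * sn (σ + 1) c := by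
  have h1 := sn_le_mul (σ := σ) (τ := σ) (K := 1 / ℓ) (c := dseq ℓ c)
    (d := ((fun k : ℤ => ((k : ℂ) + 1) * c (k + 1)) + fun k : ℤ => (2 * (k : ℂ) + 1) * c k)
      + fun k : ℤ => (k : ℂ) * c (k - 1)) fun j => by
    simp only [dseq, Pi.add_apply]
    rw [norm_mul, norm_div, Complex.norm_I, Complex.norm_real, Real.norm_of_nonneg hℓ.le]
    exact le_of_eq (by ring)
  refine h1.trans ?_
  have h2 := (sn_add_le σ ((fun k : ℤ => ((k : ℂ) + 1) * c (k + 1)) + fun k : ℤ => (2 * (k : ℂ) + 1) * c k)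
      fun k : ℤ => (k : ℂ) * c (k - 1)).trans (add_le_add ((sn_add_le σ _ _).trans
        (add_le_add (sn_succ_le hσ c) (sn_diag_le hσ c))) (sn_pred_le hσ c))
  calc _ ≤ ENNReal.ofReal (1 / ℓ) * _ := mul_le_mul_right h2 _
    _ = ENNReal.ofReal (1 / ℓ) * (3 * ENNReal.ofReal (3 ^ σ)) * sn (σ + 1) c := by ring
    _ = _ := by
        congr 1
        rw [show (3 : ℝ≥0∞) = ENNReal.ofReal 3 by simp, ← ENNReal.ofReal_mul (by norm_num),
          ← ENNReal.ofReal_mul (by positivity), Real.rpow_add_one (by norm_num)]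
        congr 1
        ring

theorem sn_neg (σ : ℝ) (c : ℤ → ℂ) : sn σ (-c) = sn σ c := by
  simp [sn]

/-- The truncation error of the first derivative. -/
theorem sn_dseq_sub_trunc_le {ℓ : ℝ} (hℓ : 0 < ℓ) {s : ℝ} (hs : 1 ≤ s) {n : ℕ} (hn : 1 ≤ n)
    (c : ℤ → ℂ) : sn 0 (dseq ℓ c - trunc n (dseq ℓ (trunc n c)))
      ≤ ENNReal.ofReal (2 * (3 ^ s / ℓ) * (n : ℝ) ^ (1 - s)) * sn s c := by
  -- The error is the derivative of the tail plus the tail of the derivative of the truncated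
  -- sequence.
  have e : dseq ℓ c - trunc n (dseq ℓ (trunc n c)) = dseq ℓ (c - trunc n c)
      + (dseq ℓ (trunc n c) - trunc n (dseq ℓ (trunc n c))) := by
    rw [dseq_sub]
    abel
  have hn0 : (0 : ℝ) ≤ (n : ℝ) ^ (1 - s) := by positivity
  have h3 : (3 : ℝ) ^ (0 + 1 : ℝ) ≤ 3 ^ s :=
    Real.rpow_le_rpow_of_exponent_le (by norm_num) (by linarith)
  have h1 : sn 0 (dseq ℓ (c - trunc n c))
      ≤ ENNReal.ofReal ((3 ^ s / ℓ) * (n : ℝ) ^ (1 - s)) * sn s c := by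
    refine (sn_dseq_le hℓ le_rfl _).trans ?_
    rw [ENNReal.ofReal_mul (by positivity), mul_assoc]
    refine mul_le_mul' (ENNReal.ofReal_le_ofReal (by gcongr)) ?_
    rw [zero_add]
    exact sn_sub_trunc_le hs hn c
  have h2 : sn 0 (dseq ℓ (trunc n c) - trunc n (dseq ℓ (trunc n c)))
      ≤ ENNReal.ofReal ((3 ^ s / ℓ) * (n : ℝ) ^ (1 - s)) * sn s c := by
    refine (sn_sub_trunc_le (s := s - 1) (by linarith) hn _).trans ?_
    have h4 := (sn_dseq_le hℓ (σ := s - 1) (by linarith) (trunc n c)).trans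
      (mul_le_mul_right (sn_trunc_le _ n c) _)
    rw [sub_add_cancel] at h4
    rw [mul_comm (3 ^ s / ℓ), ENNReal.ofReal_mul hn0, mul_assoc]
    rw [show (0 : ℝ) - (s - 1) = 1 - s by ring]
    exact mul_le_mul_right h4 _
  rw [e]
  refine (sn_add_le 0 _ _).trans ((add_le_add h1 h2).trans ?_)
  rw [← two_mul, ← mul_assoc, show (2 : ℝ≥0∞) = ENNReal.ofReal 2 by simp,
    ← ENNReal.ofReal_mul (by norm_num), mul_assoc 2]

/-- The truncation error of the second derivative. -/
theorem sn_dseq_dseq_sub_trunc_le {ℓ : ℝ} (hℓ : 0 < ℓ) {s : ℝ} (hs : 2 ≤ s) {n : ℕ} (hn : 1 ≤ n)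
    (c : ℤ → ℂ) :
    sn 0 (dseq ℓ (dseq ℓ c) - trunc n (dseq ℓ (trunc n (dseq ℓ (trunc n c)))))
      ≤ ENNReal.ofReal (3 * ((3 ^ s / ℓ) * (3 ^ s / ℓ)) * (n : ℝ) ^ (2 - s)) * sn s c := by
  set c' := trunc n c with hc'
  -- Three contributions: the second derivative of the tail, the tail of the second derivative of
  -- `c'`, and the effect of the intermediate truncation. Each is bounded by `n^(2-s)` times the
  -- norm of order `s`.
  have e : dseq ℓ (dseq ℓ c) - trunc n (dseq ℓ (trunc n (dseq ℓ c')))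
      = (dseq ℓ (dseq ℓ (c - c')) + (dseq ℓ (dseq ℓ c') - trunc n (dseq ℓ (dseq ℓ c'))))
        + trunc n (dseq ℓ (dseq ℓ c' - trunc n (dseq ℓ c'))) := by
    rw [dseq_sub, dseq_sub, dseq_sub, trunc_sub]
    abel
  have hn0 : (0 : ℝ) ≤ (n : ℝ) ^ (2 - s) := by positivity
  have hpow : ∀ a : ℝ, a ≤ s → ENNReal.ofReal ((3 : ℝ) ^ a / ℓ) ≤ ENNReal.ofReal (3 ^ s / ℓ) := by
    intro a ha
    refine ENNReal.ofReal_le_ofReal ?_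
    have := Real.rpow_le_rpow_of_exponent_le (x := 3) (by norm_num) ha
    gcongr
  have hR : ENNReal.ofReal ((3 ^ s / ℓ) * (3 ^ s / ℓ) * (n : ℝ) ^ (2 - s)) * sn s c
      = ENNReal.ofReal (3 ^ s / ℓ) * (ENNReal.ofReal (3 ^ s / ℓ) *
        (ENNReal.ofReal ((n : ℝ) ^ (2 - s)) * sn s c)) := by
    rw [ENNReal.ofReal_mul (by positivity), ENNReal.ofReal_mul (by positivity)]
    ring
  have d1 : ∀ d : ℤ → ℂ, sn 0 (dseq ℓ d) ≤ ENNReal.ofReal (3 ^ s / ℓ) * sn 1 d := by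
    intro d
    have := sn_dseq_le hℓ le_rfl d
    rw [zero_add] at this
    exact this.trans (mul_le_mul_left (hpow 1 (by linarith)) _)
  have d2 : ∀ d : ℤ → ℂ, sn 1 (dseq ℓ d) ≤ ENNReal.ofReal (3 ^ s / ℓ) * sn 2 d := by
    intro d
    have := sn_dseq_le hℓ zero_le_one d
    rw [one_add_one_eq_two] at this
    exact this.trans (mul_le_mul_left (hpow 2 hs) _)
  have d3 : ∀ d : ℤ → ℂ, sn (s - 1) (dseq ℓ d) ≤ ENNReal.ofReal (3 ^ s / ℓ) * sn s d := by
    intro d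
    have := sn_dseq_le hℓ (σ := s - 1) (by linarith) d
    rwa [sub_add_cancel] at this
  have d4 : ∀ d : ℤ → ℂ, sn (s - 2) (dseq ℓ d) ≤ ENNReal.ofReal (3 ^ s / ℓ) * sn (s - 1) d := by
    intro d
    have := sn_dseq_le hℓ (σ := s - 2) (by linarith) d
    rw [show s - 2 + 1 = s - 1 by ring] at this
    exact this.trans (mul_le_mul_left (hpow _ (by linarith)) _)
  have hc : sn s c' ≤ sn s c := sn_trunc_le s n c
  have h1 : sn 0 (dseq ℓ (dseq ℓ (c - c')))
      ≤ ENNReal.ofReal ((3 ^ s / ℓ) * (3 ^ s / ℓ) * (n : ℝ) ^ (2 - s)) * sn s c := by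
    rw [hR]
    refine (d1 _).trans (mul_le_mul_right ((d2 _).trans (mul_le_mul_right ?_ _)) _)
    exact sn_sub_trunc_le hs hn c
  have h2 : sn 0 (dseq ℓ (dseq ℓ c') - trunc n (dseq ℓ (dseq ℓ c')))
      ≤ ENNReal.ofReal ((3 ^ s / ℓ) * (3 ^ s / ℓ) * (n : ℝ) ^ (2 - s)) * sn s c := by
    refine (sn_sub_trunc_le (s := s - 2) (by linarith) hn _).trans ?_
    rw [show (0 : ℝ) - (s - 2) = 2 - s by ring, hR]
    calc _ ≤ ENNReal.ofReal ((n : ℝ) ^ (2 - s)) * (ENNReal.ofReal (3 ^ s / ℓ) *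
          (ENNReal.ofReal (3 ^ s / ℓ) * sn s c)) :=
          mul_le_mul_right ((d4 _).trans (mul_le_mul_right
            ((d3 _).trans (mul_le_mul_right hc _)) _)) _
      _ = _ := by ring
  have h3 : sn 0 (trunc n (dseq ℓ (dseq ℓ c' - trunc n (dseq ℓ c'))))
      ≤ ENNReal.ofReal ((3 ^ s / ℓ) * (3 ^ s / ℓ) * (n : ℝ) ^ (2 - s)) * sn s c := by
    refine (sn_trunc_le 0 n _).trans ((d1 _).trans ?_)
    rw [hR]
    refine mul_le_mul_right ((sn_sub_trunc_le (s := s - 1) (by linarith) hn _).trans ?_) _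
    rw [show (1 : ℝ) - (s - 1) = 2 - s by ring]
    calc _ ≤ ENNReal.ofReal ((n : ℝ) ^ (2 - s)) * (ENNReal.ofReal (3 ^ s / ℓ) * sn s c) :=
          mul_le_mul_right ((d3 _).trans (mul_le_mul_right hc _)) _
      _ = _ := by ring
  rw [e]
  refine (sn_add_le 0 _ _).trans ((add_le_add ((sn_add_le 0 _ _).trans (add_le_add h1 h2)) h3).trans
    (le_of_eq ?_))
  rw [mul_assoc (3 : ℝ), ENNReal.ofReal_mul (by norm_num : (0 : ℝ) ≤ 3)]
  simp only [ENNReal.ofReal_ofNat]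
  ring

/-! ### Functions and their coefficients -/

theorem coef_add (ℓ : ℝ) (f g : L2C) : coef ℓ (f + g) = coef ℓ f + coef ℓ g := by
  ext j
  exact inner_add_right _ _ _

theorem coef_sub (ℓ : ℝ) (f g : L2C) : coef ℓ (f - g) = coef ℓ f - coef ℓ g := by
  ext j
  exact inner_sub_right _ _ _

theorem coef_neg (ℓ : ℝ) (f : L2C) : coef ℓ (-f) = -coef ℓ f := by
  ext j
  exact inner_neg_right _ _

theorem coef_smul (ℓ : ℝ) (a : ℂ) (f : L2C) : coef ℓ (a • f) = a • coef ℓ f := by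
  ext j
  exact inner_smul_right _ _ _

theorem coef_mtL2 {ℓ : ℝ} (hℓ : 0 < ℓ) (k j : ℤ) :
    coef ℓ (mtL2 ℓ k) j = if j = k then 1 else 0 := inner_mtL2_mtL2 hℓ j k

theorem coef_injective {ℓ : ℝ} (hℓ : 0 < ℓ) {f g : L2C} (h : coef ℓ f = coef ℓ g) : f = g := by
  have h1 := hasSum_norm_inner_mtL2 hℓ (f - g)
  have h2 : ∀ j, inner ℂ (mtL2 ℓ j) (f - g) = 0 := fun j => by
    have := congrFun (coef_sub ℓ f g) j
    rw [h, sub_self] at this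
    exact this
  simp only [h2, norm_zero, ne_eq, OfNat.ofNat_ne_zero, not_false_eq_true, zero_pow] at h1
  exact sub_eq_zero.1 (norm_eq_zero.1 (pow_eq_zero_iff two_ne_zero |>.1 (h1.unique hasSum_zero)))

theorem hasSum_coef_smul {ℓ : ℝ} (hℓ : 0 < ℓ) (f : L2C) :
    HasSum (fun j => coef ℓ f j • mtL2 ℓ j) f := by
  have h := (mtBasis hℓ).hasSum_repr f
  simp only [HilbertBasis.repr_apply_apply, mtBasis_apply] at h
  exact h

theorem sn_coef_zero {ℓ : ℝ} (hℓ : 0 < ℓ) (f : L2C) : sn 0 (coef ℓ f) = ‖f‖ₑ := by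
  have h := hasSum_norm_inner_mtL2 hℓ f
  have h1 : ∑' j, ENNReal.ofReal (‖coef ℓ f j‖ ^ 2) = ENNReal.ofReal (‖f‖ ^ 2) := by
    rw [← h.tsum_eq, ENNReal.ofReal_tsum_of_nonneg (fun _ => sq_nonneg _) h.summable]
    rfl
  rw [sn, eLpNorm_eq_lintegral_rpow_enorm_toReal two_ne_zero ENNReal.ofNat_ne_top, lintegral_count]
  have e : ∀ j, ‖lam j ^ (0 : ℝ) * ‖coef ℓ f j‖‖ₑ ^ (2 : ℝ≥0∞).toReal
      = ENNReal.ofReal (‖coef ℓ f j‖ ^ 2) := by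
    intro j
    rw [Real.rpow_zero, one_mul, enorm_norm, ← ofReal_norm, ENNReal.ofReal_pow (norm_nonneg _)]
    simp
  simp_rw [e]
  rw [h1, ENNReal.ofReal_pow (norm_nonneg _), ← ENNReal.rpow_natCast, ← ENNReal.rpow_mul,
    ofReal_norm]
  simp

theorem enorm_complexify (f : L2) : ‖complexify f‖ₑ = ‖f‖ₑ := by
  rw [← ofReal_norm, norm_complexify, ofReal_norm]

/-- The Riesz-Fischer theorem for the basis `mtBasis`. -/
theorem exists_of_sn_lt_top {ℓ : ℝ} (hℓ : 0 < ℓ) {c : ℤ → ℂ} (h : sn 0 c < ⊤) :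
    ∃ f : L2C, coef ℓ f = c := by
  have hm : Memℓp c 2 := by
    rw [memℓp_gen_iff (by simp)]
    simpa using summable_sq_of_sn h
  refine ⟨(mtBasis hℓ).repr.symm ⟨c, hm⟩, ?_⟩
  ext j
  have := (mtBasis hℓ).repr_apply_apply ((mtBasis hℓ).repr.symm ⟨c, hm⟩) j
  rw [LinearIsometryEquiv.apply_symm_apply, mtBasis_apply] at this
  exact this.symm

theorem coef_complexify_neg {ℓ : ℝ} (hℓ : 0 < ℓ) (f : L2) (j : ℤ) :
    coef ℓ (complexify f) (-1 - j) = (starRingEnd ℂ) (coef ℓ (complexify f) j) := by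
  rw [coef, coef, inner_mtL2_eq_integral hℓ _ (coeFn_complexify f),
    inner_mtL2_eq_integral hℓ _ (coeFn_complexify f), ← integral_conj]
  congr 1
  ext x
  rw [map_mul, Complex.conj_conj, Complex.conj_ofReal, conj_mt]
  congr 2
  ring

theorem integrable_conj_mt_mul {ℓ : ℝ} (hℓ : 0 < ℓ) (j : ℤ) (f : L2C) :
    Integrable fun x => (starRingEnd ℂ) (mt ℓ j x) * f x := by
  have h := L2.integrable_inner (𝕜 := ℂ) (mtL2 ℓ j) f
  refine h.congr ?_
  filter_upwards [coeFn_mtL2 hℓ j] with x h1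
  rw [h1, RCLike.inner_apply, mul_comm]

theorem coef_complexify_realPart {ℓ : ℝ} (hℓ : 0 < ℓ) (f : L2C) (j : ℤ) :
    coef ℓ (complexify (realPart f)) j
      = 1 / 2 * (coef ℓ f j + (starRingEnd ℂ) (coef ℓ f (-1 - j))) := by
  have hg : complexify (realPart f) =ᵐ[volume]
      fun x => 1 / 2 * (f x + (starRingEnd ℂ) (f x)) := by
    filter_upwards [coeFn_complexify (realPart f), coeFn_realPart f] with x h1 h2
    rw [h1, h2, Complex.add_conj]
    push_cast
    ring
  rw [coef, coef, coef, inner_mtL2_eq_integral hℓ _ hg,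
    inner_mtL2_eq_integral hℓ j (Filter.EventuallyEq.refl _ f),
    inner_mtL2_eq_integral hℓ (-1 - j) (Filter.EventuallyEq.refl _ f), ← integral_conj,
    ← integral_add (integrable_conj_mt_mul hℓ j f), ← integral_const_mul]
  · congr 1
    ext x
    rw [map_mul, Complex.conj_conj, ← conj_mt]
    ring
  · have := integrable_conj_mt_mul hℓ (-1 - j) f
    exact (Complex.conjCLE.toContinuousLinearMap.integrable_comp this)

/-- The reflection symmetry of the coefficients characterises real functions. It returns objects
built in complex `L²` to the real space. -/
theorem complexify_realPart_of_symm {ℓ : ℝ} (hℓ : 0 < ℓ) {f : L2C}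
    (h : ∀ j, coef ℓ f (-1 - j) = (starRingEnd ℂ) (coef ℓ f j)) :
    complexify (realPart f) = f := by
  refine coef_injective hℓ ?_
  ext j
  rw [coef_complexify_realPart hℓ, h, Complex.conj_conj]
  ring

theorem inner_complexify (f g : L2) :
    inner ℂ (complexify f) (complexify g) = ((inner ℝ f g : ℝ) : ℂ) := by
  rw [L2.inner_def, L2.inner_def, ← integral_complex_ofReal]
  refine integral_congr_ae ?_
  filter_upwards [coeFn_complexify f, coeFn_complexify g] with x h1 h2
  rw [h1, h2]
  simp [mul_comm]

/-! ### Weak derivatives -/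

theorem mt_pred_add_mt {ℓ : ℝ} (hℓ : 0 < ℓ) (j : ℤ) (x : ℝ) :
    mt ℓ (j - 1) x + mt ℓ j x = 2 * ℓ / (ℓ + 2 * Complex.I * x) * mt ℓ j x := by
  have ha := add_ne_zero_of_pos hℓ x
  have hb := sub_ne_zero_of_pos hℓ x
  have h := mt_add hℓ 1 (j - 1) x
  rw [show 1 + (j - 1) = j by ring, zpow_one, phase] at h
  rw [h]
  field_simp
  ring

theorem mt_add_mt_succ {ℓ : ℝ} (hℓ : 0 < ℓ) (j : ℤ) (x : ℝ) :
    mt ℓ j x + mt ℓ (j + 1) x = 2 * ℓ / (ℓ - 2 * Complex.I * x) * mt ℓ j x := by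
  have hb := sub_ne_zero_of_pos hℓ x
  have h := mt_add hℓ 1 j x
  rw [add_comm 1 j, zpow_one, phase] at h
  rw [h]
  field_simp
  ring

/-- Since `1 + phase^(∓1) = 2ℓ/(ℓ ± 2ix)`, the products of `mt ℓ j` with `1/(ℓ ± 2ix)` are sums of
two neighbours over `2ℓ`. So the derivative stays in the span of three consecutive basis functions.
-/
theorem hasDerivAt_mt_eq {ℓ : ℝ} (hℓ : 0 < ℓ) (j : ℤ) (x : ℝ) :
    HasDerivAt (mt ℓ j) (Complex.I / ℓ * (j * mt ℓ (j - 1) x + (2 * j + 1) * mt ℓ j x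
      + (j + 1) * mt ℓ (j + 1) x)) x := by
  refine (hasDerivAt_mt hℓ j x).congr_deriv ?_
  have h1 := mt_pred_add_mt hℓ j x
  have h2 := mt_add_mt_succ hℓ j x
  have hl : (ℓ : ℂ) ≠ 0 := by exact_mod_cast hℓ.ne'
  have e1 : mt ℓ j x / (ℓ + 2 * Complex.I * x) = (mt ℓ (j - 1) x + mt ℓ j x) / (2 * ℓ) := by
    rw [h1]
    field_simp
  have e2 : mt ℓ j x / (ℓ - 2 * Complex.I * x) = (mt ℓ j x + mt ℓ (j + 1) x) / (2 * ℓ) := by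
    rw [h2]
    field_simp
  have e3 : 2 * Complex.I * (j / (ℓ + 2 * Complex.I * x) + (j + 1) / (ℓ - 2 * Complex.I * x))
      * mt ℓ j x = 2 * Complex.I * (j * (mt ℓ j x / (ℓ + 2 * Complex.I * x))
        + (j + 1) * (mt ℓ j x / (ℓ - 2 * Complex.I * x))) := by ring
  rw [e3, e1, e2]
  field_simp
  ring

/-- The class in `L²` of the derivative of `mt ℓ j`. -/
def mtDerivL2 (ℓ : ℝ) (j : ℤ) : L2C :=
  (Complex.I / ℓ) • ((j : ℂ) • mtL2 ℓ (j - 1) + (2 * j + 1 : ℂ) • mtL2 ℓ j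
    + (j + 1 : ℂ) • mtL2 ℓ (j + 1))

theorem coeFn_mtDerivL2 {ℓ : ℝ} (hℓ : 0 < ℓ) (j : ℤ) : mtDerivL2 ℓ j =ᵐ[volume]
    fun x => Complex.I / ℓ * (j * mt ℓ (j - 1) x + (2 * j + 1) * mt ℓ j x
      + (j + 1) * mt ℓ (j + 1) x) := by
  rw [mtDerivL2]
  filter_upwards [Lp.coeFn_smul (Complex.I / ℓ : ℂ) ((j : ℂ) • mtL2 ℓ (j - 1)
    + (2 * j + 1 : ℂ) • mtL2 ℓ j + (j + 1 : ℂ) • mtL2 ℓ (j + 1)),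
    Lp.coeFn_add ((j : ℂ) • mtL2 ℓ (j - 1) + (2 * j + 1 : ℂ) • mtL2 ℓ j)
      ((j + 1 : ℂ) • mtL2 ℓ (j + 1)),
    Lp.coeFn_add ((j : ℂ) • mtL2 ℓ (j - 1)) ((2 * j + 1 : ℂ) • mtL2 ℓ j),
    Lp.coeFn_smul (j : ℂ) (mtL2 ℓ (j - 1)), Lp.coeFn_smul (2 * j + 1 : ℂ) (mtL2 ℓ j),
    Lp.coeFn_smul (j + 1 : ℂ) (mtL2 ℓ (j + 1)), coeFn_mtL2 hℓ (j - 1), coeFn_mtL2 hℓ j,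
    coeFn_mtL2 hℓ (j + 1)] with x h1 h2 h3 h4 h5 h6 h7 h8 h9
  rw [h1, Pi.smul_apply, h2, Pi.add_apply, h3, Pi.add_apply, h4, h5, h6, Pi.smul_apply,
    Pi.smul_apply, Pi.smul_apply, h7, h8, h9]
  simp only [smul_eq_mul]

theorem memLp_test {φ : ℝ → ℝ} (h : Continuous φ) (hc : HasCompactSupport φ) :
    MemLp φ 2 volume := h.memLp_of_hasCompactSupport hc

theorem inner_complexify_toL2 {φ : ℝ → ℝ} (h : Continuous φ) (hc : HasCompactSupport φ)
    {f : L2C} {g : ℝ → ℂ} (hg : f =ᵐ[volume] g) :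
    inner ℂ (complexify (toL2 φ)) f = ∫ x, g x * φ x := by
  rw [L2.inner_def]
  refine integral_congr_ae ?_
  filter_upwards [coeFn_complexify (toL2 φ), coeFn_toL2 (memLp_test h hc), hg] with x h1 h2 h3
  rw [h1, h2, h3, RCLike.inner_apply, Complex.conj_ofReal]

theorem inner_deriv_test {ℓ : ℝ} (hℓ : 0 < ℓ) {φ : ℝ → ℝ} (h : ContDiff ℝ ∞ φ)
    (hc : HasCompactSupport φ) (j : ℤ) :
    inner ℂ (complexify (toL2 (deriv φ))) (mtL2 ℓ j)
      = -inner ℂ (complexify (toL2 φ)) (mtDerivL2 ℓ j) := by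
  have hd : Continuous (deriv φ) := h.continuous_deriv (by simp)
  rw [inner_complexify_toL2 hd hc.deriv (coeFn_mtL2 hℓ j),
    inner_complexify_toL2 h.continuous hc (coeFn_mtDerivL2 hℓ j)]
  have hcm := fun k => continuous_mt hℓ k
  have i1 : ∀ {ψ : ℝ → ℝ}, Continuous ψ → HasCompactSupport ψ → ∀ {g : ℝ → ℂ}, Continuous g →
      Integrable fun x => g x * (ψ x : ℂ) := by
    intro ψ h1 h2 g hg
    have : HasCompactSupport fun x => g x * (ψ x : ℂ) :=
      (h2.comp_left (g := fun t : ℝ => (t : ℂ)) (by simp)).mul_left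
    exact (hg.mul (Complex.continuous_ofReal.comp h1)).integrable_of_hasCompactSupport this
  have hcd : Continuous fun x : ℝ => Complex.I / ℓ * (j * mt ℓ (j - 1) x
      + (2 * j + 1) * mt ℓ j x + (j + 1) * mt ℓ (j + 1) x) := by
    have := hcm (j - 1)
    have := hcm j
    have := hcm (j + 1)
    fun_prop
  exact integral_mul_deriv_eq_deriv_mul_of_integrable (u := mt ℓ j) (v := fun x => (φ x : ℂ))
    (v' := fun x => ((deriv φ x : ℝ) : ℂ)) (fun x _ => hasDerivAt_mt_eq hℓ j x)
    (fun x _ => ((h.differentiable (by simp)).differentiableAt.hasDerivAt (x := x)).ofReal_comp)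
    (i1 hd hc.deriv (hcm j)) (i1 h.continuous hc hcd) (i1 h.continuous hc (hcm j))

/-- Each diagonal of `dseq` is square summable by itself, so the three series converge separately
and may be reindexed before they are added. -/
theorem exists_deriv_of_sn {ℓ : ℝ} (hℓ : 0 < ℓ) {f : L2C} (h : sn 1 (coef ℓ f) < ⊤) :
    ∃ G : L2C, coef ℓ G = dseq ℓ (coef ℓ f) ∧
      HasSum (fun j => coef ℓ f j • mtDerivL2 ℓ j) G := by
  set c := coef ℓ f
  have hfin : ENNReal.ofReal (3 ^ (0 : ℝ)) * sn (0 + 1) c < ⊤ := by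
    rw [zero_add]
    exact ENNReal.mul_lt_top ENNReal.ofReal_lt_top h
  obtain ⟨A, hA⟩ := exists_of_sn_lt_top hℓ ((sn_succ_le le_rfl c).trans_lt hfin)
  obtain ⟨B, hB⟩ := exists_of_sn_lt_top hℓ ((sn_diag_le le_rfl c).trans_lt hfin)
  obtain ⟨E, hE⟩ := exists_of_sn_lt_top hℓ ((sn_pred_le le_rfl c).trans_lt hfin)
  refine ⟨(Complex.I / ℓ : ℂ) • (A + B + E), ?_, ?_⟩
  · rw [coef_smul, coef_add, coef_add, hA, hB, hE]
    rfl
  · have sA := hasSum_coef_smul hℓ A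
    have sB := hasSum_coef_smul hℓ B
    have sE := hasSum_coef_smul hℓ E
    rw [hA] at sA
    rw [hB] at sB
    rw [hE] at sE
    -- The upper and the lower diagonal are shifted back, so that the term with index `j` contains
    -- only the coefficient `c j`.
    have sA' := (Equiv.hasSum_iff (Equiv.subRight (1 : ℤ))).2 sA
    have sE' := (Equiv.hasSum_iff (Equiv.addRight (1 : ℤ))).2 sE
    have := ((sA'.add sB).add sE').const_smul (Complex.I / ℓ : ℂ)
    refine this.congr_fun fun j => ?_
    simp only [Function.comp_apply, Equiv.subRight_apply, Equiv.coe_addRight, mtDerivL2]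
    rw [smul_comm (c j), sub_add_cancel, add_sub_cancel_right]
    congr 1
    rw [smul_add, smul_add, smul_smul, smul_smul, smul_smul]
    push_cast
    rw [sub_add_cancel, mul_comm (c j), mul_comm (c j), mul_comm (c j)]

/-- The expansions of `u` and of the candidate derivative are paired termwise with a test function,
where integration by parts is classical. The candidate is real because `dseq` respects the
reflection symmetry. -/
theorem exists_weakDeriv {ℓ : ℝ} (hℓ : 0 < ℓ) {u : L2} (h : sn 1 (coef ℓ (complexify u)) < ⊤) :
    ∃ g : L2, IsWeakDeriv u g ∧ coef ℓ (complexify g) = dseq ℓ (coef ℓ (complexify u)) := by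
  obtain ⟨G, hG, hS⟩ := exists_deriv_of_sn hℓ h
  have hsymm : ∀ j, coef ℓ G (-1 - j) = (starRingEnd ℂ) (coef ℓ G j) := by
    intro j
    have hc := coef_complexify_neg hℓ u
    rw [hG]
    simp only [dseq]
    have e1 : coef ℓ (complexify u) (-1 - j + 1)
        = (starRingEnd ℂ) (coef ℓ (complexify u) (j - 1)) := by
      rw [← hc]
      congr 1
      ring
    have e2 : coef ℓ (complexify u) (-1 - j - 1)
        = (starRingEnd ℂ) (coef ℓ (complexify u) (j + 1)) := by
      rw [← hc]
      congr 1
      ring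
    rw [e1, e2, hc]
    simp only [map_mul, map_div₀, map_add, Complex.conj_I, Complex.conj_ofReal, map_intCast,
      map_one, map_ofNat]
    push_cast
    ring
  have hre := complexify_realPart_of_symm hℓ hsymm
  refine ⟨realPart G, fun φ hφ hc => ?_, by rw [hre, hG]⟩
  have hd : Continuous (deriv φ) := hφ.continuous_deriv (by simp)
  have h1 := (hasSum_coef_smul hℓ (complexify u)).mapL
    (innerSL ℂ (complexify (toL2 (deriv φ))))
  have h2 := hS.mapL (innerSL ℂ (complexify (toL2 φ)))
  have h3 : inner ℂ (complexify (toL2 (deriv φ))) (complexify u)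
      = -inner ℂ (complexify (toL2 φ)) G := by
    refine h1.unique (h2.neg.congr_fun fun j => ?_)
    simp only [innerSL_apply_apply, inner_smul_right]
    rw [inner_deriv_test hℓ hφ hc]
    ring
  rw [← hre, inner_complexify_toL2 hd hc.deriv (coeFn_complexify u),
    inner_complexify_toL2 hφ.continuous hc (coeFn_complexify (realPart G))] at h3
  have h4 := congrArg Complex.re h3
  simp_rw [← Complex.ofReal_mul] at h4
  rw [integral_complex_ofReal, integral_complex_ofReal, Complex.neg_re, Complex.ofReal_re,
    Complex.ofReal_re] at h4
  exact h4

/-- The fundamental lemma of the calculus of variations. As `dx` takes a weak derivative by choice,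
uniqueness is what identifies its value. -/
theorem isWeakDeriv_unique {f g g' : L2} (h : IsWeakDeriv f g) (h' : IsWeakDeriv f g') :
    g = g' := by
  rw [← sub_eq_zero, Lp.eq_zero_iff_ae_eq_zero]
  refine ae_eq_zero_of_integral_contDiff_smul_eq_zero
    ((Lp.memLp (g - g')).locallyIntegrable (by norm_num)) fun φ hφ hc => ?_
  have h1 := (h φ hφ hc).symm.trans (h' φ hφ hc)
  have hi : ∀ w : L2, Integrable fun x => w x * φ x := fun w =>
    (Lp.memLp w).integrable_mul (memLp_test hφ.continuous hc)
  have h2 : ∫ x, φ x • (g - g' : L2) x = ∫ x, (g x * φ x - g' x * φ x) := by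
    refine integral_congr_ae ?_
    filter_upwards [Lp.coeFn_sub g g'] with x hx
    rw [hx, Pi.sub_apply, smul_eq_mul]
    ring
  rw [h2, integral_sub (hi g) (hi g')]
  linarith

theorem dx_eq {f g : L2} (h : IsWeakDeriv f g) : dx f = g := by
  have hex : ∃ g : L2, IsWeakDeriv f g := ⟨g, h⟩
  rw [dx, dif_pos hex]
  exact isWeakDeriv_unique hex.choose_spec h

theorem coef_dx {ℓ : ℝ} (hℓ : 0 < ℓ) {u : L2} (h : sn 1 (coef ℓ (complexify u)) < ⊤) :
    coef ℓ (complexify (dx u)) = dseq ℓ (coef ℓ (complexify u)) := by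
  obtain ⟨g, h1, h2⟩ := exists_weakDeriv hℓ h
  rw [dx_eq h1, h2]

/-! ### The projector -/

theorem christov_even (ℓ : ℝ) (i : ℕ) (x : ℝ) :
    christov ℓ (2 * i) x = √2 * (mt ℓ i x).re := by
  have h : √2 * √(2 * ℓ / Real.pi) = 2 * √(ℓ / Real.pi) := by
    rw [mul_div_assoc, Real.sqrt_mul (by norm_num), ← mul_assoc, Real.mul_self_sqrt (by norm_num)]
  rw [christov, mt, mul_div_assoc, Complex.re_ofReal_mul, ← mul_assoc, h]
  simp
  norm_cast
  exact Or.inl rfl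

theorem christov_odd (ℓ : ℝ) (i : ℕ) (x : ℝ) :
    christov ℓ (2 * i + 1) x = √2 * (mt ℓ i x).im := by
  have h : √2 * √(2 * ℓ / Real.pi) = 2 * √(ℓ / Real.pi) := by
    rw [mul_div_assoc, Real.sqrt_mul (by norm_num), ← mul_assoc, Real.mul_self_sqrt (by norm_num)]
  rw [christov, mt, mul_div_assoc, Complex.im_ofReal_mul, ← mul_assoc, h]
  have h2 : (2 * i + 1) / 2 = i := by omega
  simp [h2]
  norm_cast
  exact Or.inl rfl

theorem abs_christov_le {ℓ : ℝ} (hℓ : 0 < ℓ) (k : ℕ) (x : ℝ) :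
    |christov ℓ k x| ≤ √2 * ‖mt ℓ 0 x‖ := by
  obtain ⟨i, rfl | rfl⟩ := k.even_or_odd'
  · rw [christov_even ℓ, abs_mul, abs_of_nonneg (Real.sqrt_nonneg 2), norm_mt_eq hℓ 0 i]
    exact mul_le_mul_of_nonneg_left (Complex.abs_re_le_norm _) (Real.sqrt_nonneg 2)
  · rw [christov_odd ℓ, abs_mul, abs_of_nonneg (Real.sqrt_nonneg 2), norm_mt_eq hℓ 0 i]
    exact mul_le_mul_of_nonneg_left (Complex.abs_im_le_norm _) (Real.sqrt_nonneg 2)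

theorem continuous_christov {ℓ : ℝ} (hℓ : 0 < ℓ) (k : ℕ) : Continuous (christov ℓ k) := by
  obtain ⟨i, rfl | rfl⟩ := k.even_or_odd'
  · simp_rw [funext (christov_even ℓ i)]
    exact continuous_const.mul (Complex.continuous_re.comp (continuous_mt hℓ i))
  · simp_rw [funext (christov_odd ℓ i)]
    exact continuous_const.mul (Complex.continuous_im.comp (continuous_mt hℓ i))

theorem memLp_christov {ℓ : ℝ} (hℓ : 0 < ℓ) (k : ℕ) : MemLp (christov ℓ k) 2 volume := by
  refine (memLp_mt hℓ 0).of_le_mul (c := √2) (continuous_christov hℓ k).aestronglyMeasurable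
    (Eventually.of_forall fun x => ?_)
  exact abs_christov_le hℓ k x

theorem complexify_christov_even {ℓ : ℝ} (hℓ : 0 < ℓ) (i : ℕ) :
    complexify (toL2 (christov ℓ (2 * i))) = (1 / √2 : ℂ) • (mtL2 ℓ i + mtL2 ℓ (-1 - i)) := by
  apply Lp.ext
  filter_upwards [coeFn_complexify (toL2 (christov ℓ (2 * i))),
    coeFn_toL2 (memLp_christov hℓ (2 * i)), Lp.coeFn_smul (1 / √2 : ℂ)
      (mtL2 ℓ i + mtL2 ℓ (-1 - i)), Lp.coeFn_add (mtL2 ℓ i) (mtL2 ℓ (-1 - i)), coeFn_mtL2 hℓ i,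
    coeFn_mtL2 hℓ (-1 - i)] with x h1 h2 h3 h4 h5 h6
  rw [h1, h2, h3, Pi.smul_apply, h4, Pi.add_apply, h5, h6, ← conj_mt, Complex.add_conj,
    christov_even ℓ, smul_eq_mul]
  have h : (√2 : ℂ) * √2 = 2 := by
    rw [← Complex.ofReal_mul, Real.mul_self_sqrt (by norm_num)]
    norm_num
  have h0 : (√2 : ℂ) ≠ 0 := by
    exact_mod_cast (Real.sqrt_pos.2 two_pos).ne'
  push_cast
  field_simp
  rw [pow_two, h]
  ring

theorem complexify_christov_odd {ℓ : ℝ} (hℓ : 0 < ℓ) (i : ℕ) :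
    complexify (toL2 (christov ℓ (2 * i + 1)))
      = (-Complex.I / √2 : ℂ) • (mtL2 ℓ i - mtL2 ℓ (-1 - i)) := by
  apply Lp.ext
  filter_upwards [coeFn_complexify (toL2 (christov ℓ (2 * i + 1))),
    coeFn_toL2 (memLp_christov hℓ (2 * i + 1)), Lp.coeFn_smul (-Complex.I / √2 : ℂ)
      (mtL2 ℓ i - mtL2 ℓ (-1 - i)), Lp.coeFn_sub (mtL2 ℓ i) (mtL2 ℓ (-1 - i)), coeFn_mtL2 hℓ i,
    coeFn_mtL2 hℓ (-1 - i)] with x h1 h2 h3 h4 h5 h6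
  rw [h1, h2, h3, Pi.smul_apply, h4, Pi.sub_apply, h5, h6, ← conj_mt, Complex.sub_conj,
    christov_odd ℓ, smul_eq_mul]
  have h : (√2 : ℂ) * √2 = 2 := by
    rw [← Complex.ofReal_mul, Real.mul_self_sqrt (by norm_num)]
    norm_num
  have h0 : (√2 : ℂ) ≠ 0 := by
    exact_mod_cast (Real.sqrt_pos.2 two_pos).ne'
  push_cast
  field_simp
  rw [pow_two, h, Complex.I_sq]
  ring

/-- The pair `φ_(2i), φ_(2i+1)` arises from `mt ℓ i, mt ℓ (-1 - i)` by a unitary change of basis, so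
both give the same projection. -/
theorem complexify_pair {ℓ : ℝ} (hℓ : 0 < ℓ) (u : L2) (i : ℕ) :
    complexify (inner ℝ u (toL2 (christov ℓ (2 * i))) • toL2 (christov ℓ (2 * i))
        + inner ℝ u (toL2 (christov ℓ (2 * i + 1))) • toL2 (christov ℓ (2 * i + 1)))
      = coef ℓ (complexify u) i • mtL2 ℓ i
        + coef ℓ (complexify u) (-1 - i) • mtL2 ℓ (-1 - i) := by
  have h : (√2 : ℂ) * √2 = 2 := by
    rw [← Complex.ofReal_mul, Real.mul_self_sqrt (by norm_num)]
    norm_num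
  have h0 : (√2 : ℂ) ≠ 0 := by
    exact_mod_cast (Real.sqrt_pos.2 two_pos).ne'
  rw [complexify_add, complexify_smul, complexify_smul, real_inner_comm, real_inner_comm _ u,
    ← inner_complexify, ← inner_complexify, complexify_christov_even hℓ,
    complexify_christov_odd hℓ, inner_smul_left, inner_smul_left, inner_add_left, inner_sub_left]
  change ((starRingEnd ℂ) (1 / √2 : ℂ) * (coef ℓ (complexify u) i
    + coef ℓ (complexify u) (-1 - i))) • _ + ((starRingEnd ℂ) (-Complex.I / √2 : ℂ) *
      (coef ℓ (complexify u) i - coef ℓ (complexify u) (-1 - i))) • _ = _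
  generalize coef ℓ (complexify u) i = a
  generalize coef ℓ (complexify u) (-1 - i) = b
  have e1 : (starRingEnd ℂ) (1 / √2 : ℂ) * (1 / √2) = 1 / 2 := by
    simp only [map_div₀, map_one, Complex.conj_ofReal]
    field_simp
    rw [pow_two, h]
  have e2 : (starRingEnd ℂ) (-Complex.I / √2 : ℂ) * (-Complex.I / √2) = 1 / 2 := by
    simp only [map_div₀, map_neg, Complex.conj_I, Complex.conj_ofReal]
    field_simp
    linear_combination (-2) * Complex.I_sq - h
  rw [smul_smul, smul_smul, mul_right_comm, e1, mul_right_comm, e2]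
  module

theorem sum_range_two_mul_succ {M : Type*} [AddCommMonoid M] (f : ℕ → M) (m : ℕ) :
    ∑ k ∈ Finset.range (2 * (m + 1)), f k
      = ∑ k ∈ Finset.range (2 * m), f k + (f (2 * m) + f (2 * m + 1)) := by
  rw [show 2 * (m + 1) = 2 * m + 1 + 1 by ring, Finset.sum_range_succ, Finset.sum_range_succ,
    add_assoc]

theorem lam_le_iff (j : ℤ) (n : ℕ) : lam j ≤ n ↔ |2 * j + 1| ≤ (n : ℤ) := by
  rw [lam]
  exact_mod_cast Iff.rfl

theorem coef_complexify_sum {ℓ : ℝ} (hℓ : 0 < ℓ) (u : L2) (m : ℕ) (j : ℤ) :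
    coef ℓ (complexify (∑ k ∈ Finset.range (2 * m),
      inner ℝ u (toL2 (christov ℓ k)) • toL2 (christov ℓ k))) j
      = if |2 * j + 1| < 2 * (m : ℤ) then coef ℓ (complexify u) j else 0 := by
  induction m with
  | zero =>
    rw [if_neg (by simp)]
    simp only [mul_zero, Finset.range_zero, Finset.sum_empty]
    rw [← complexifyL_apply, map_zero]
    exact inner_zero_right _
  | succ m ih =>
    rw [sum_range_two_mul_succ, complexify_add, complexify_pair hℓ, coef_add, coef_add, coef_smul,
      coef_smul]
    simp only [Pi.add_apply, Pi.smul_apply, smul_eq_mul]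
    rw [ih, coef_mtL2 hℓ, coef_mtL2 hℓ]
    by_cases h1 : |2 * j + 1| < 2 * (m : ℤ)
    · have h2 : j ≠ m := by rintro rfl; rw [abs_lt] at h1; omega
      have h3 : j ≠ -1 - m := by rintro rfl; rw [abs_lt] at h1; omega
      rw [if_pos h1, if_neg h2, if_neg h3, if_pos (by push_cast; omega)]
      ring
    · by_cases h2 : j = m
      · subst h2
        rw [if_neg h1, if_pos rfl, if_neg (by omega), if_pos (by rw [abs_lt]; push_cast; omega)]
        ring
      · by_cases h3 : j = -1 - m
        · subst h3
          rw [if_neg h1, if_neg h2, if_pos rfl, if_pos (by rw [abs_lt]; push_cast; omega)]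
          ring
        · rw [if_neg h1, if_neg h2, if_neg h3, if_neg]
          · ring
          · push_cast
            rw [abs_lt] at h1 ⊢
            omega

/-- For `n = 2m + 1` the functions `φ₀, …, φₙ` form the complete pairs `i ≤ m`, that is, the indices
`-1 - m ≤ j ≤ m`. An even `n` would cut a pair in half. -/
theorem coef_proj {ℓ : ℝ} (hℓ : 0 < ℓ) {n : ℕ} (hn : Odd n) (u : L2) :
    coef ℓ (complexify (proj ℓ n u)) = trunc n (coef ℓ (complexify u)) := by
  obtain ⟨m, rfl⟩ := hn
  ext j
  rw [proj, show 2 * m + 1 + 1 = 2 * (m + 1) by ring, coef_complexify_sum hℓ, trunc]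
  have : (lam j ≤ ((2 * m + 1 : ℕ) : ℝ)) ↔ |2 * j + 1| < 2 * ((m + 1 : ℕ) : ℤ) := by
    rw [lam_le_iff]
    push_cast
    omega
  simp only [this]

theorem sn_trunc_lt_top (σ : ℝ) (n : ℕ) {c : ℤ → ℂ} (h : sn 0 c < ⊤) : sn σ (trunc n c) < ⊤ := by
  refine lt_of_le_of_lt (sn_le_mul (τ := 0) (K := max 1 ((n : ℝ) ^ σ)) (d := c) fun j => ?_)
    (ENNReal.mul_lt_top ENNReal.ofReal_lt_top h)
  rw [trunc, Real.rpow_zero, one_mul]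
  split_ifs with hj
  · refine mul_le_mul_of_nonneg_right ?_ (norm_nonneg _)
    rcases le_total 0 σ with hσ | hσ
    · exact (Real.rpow_le_rpow (lam_pos j).le hj hσ).trans (le_max_right _ _)
    · exact (Real.rpow_le_one_of_one_le_of_nonpos (one_le_lam j) hσ).trans (le_max_left _ _)
  · rw [norm_zero, mul_zero]
    positivity

theorem sn_coef_lt_top {ℓ : ℝ} (hℓ : 0 < ℓ) (f : L2C) : sn 0 (coef ℓ f) < ⊤ := by
  rw [sn_coef_zero hℓ]
  exact enorm_lt_top

/-- The derivative acts on a finite expansion, so no regularity of `u` is needed. -/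
theorem coef_autJ {ℓ : ℝ} (hℓ : 0 < ℓ) {n : ℕ} (hn : Odd n) (u : L2) :
    coef ℓ (complexify (autJ ℓ n u))
      = -trunc n (dseq ℓ (trunc n (coef ℓ (complexify u)))) := by
  rw [autJ, complexify_neg, coef_neg, coef_proj hℓ hn, coef_dx hℓ, coef_proj hℓ hn]
  rw [coef_proj hℓ hn]
  exact sn_trunc_lt_top 1 n (sn_coef_lt_top hℓ _)

/-! ### Interpolation at the nodes -/

theorem sqrt_two_mul_sqrt_two : (√2 : ℝ) * √2 = 2 := Real.mul_self_sqrt (by norm_num)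

/-- The reproducing kernel of `ℙₙ` for `n = 2m - 1`. -/
theorem ofReal_sum_christov_mul (ℓ : ℝ) (m : ℕ) (x y : ℝ) :
    ((∑ k ∈ Finset.range (2 * m), christov ℓ k x * christov ℓ k y : ℝ) : ℂ)
      = ∑ i ∈ Finset.range m, (mt ℓ i x * (starRingEnd ℂ) (mt ℓ i y)
        + (starRingEnd ℂ) (mt ℓ i x) * mt ℓ i y) := by
  induction m with
  | zero => simp
  | succ m ih =>
    rw [sum_range_two_mul_succ, Complex.ofReal_add, ih, Finset.sum_range_succ]
    congr 1
    rw [christov_even ℓ, christov_even ℓ, christov_odd ℓ, christov_odd ℓ]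
    have h : (mt ℓ m x * (starRingEnd ℂ) (mt ℓ m y) + (starRingEnd ℂ) (mt ℓ m x) * mt ℓ m y)
        = ((2 * ((mt ℓ m x).re * (mt ℓ m y).re + (mt ℓ m x).im * (mt ℓ m y).im) : ℝ) : ℂ) := by
      apply Complex.ext
      · simp
        ring
      · simp
        ring
    rw [h, Complex.ofReal_inj]
    linear_combination ((mt ℓ m x).re * (mt ℓ m y).re + (mt ℓ m x).im * (mt ℓ m y).im)
      * sqrt_two_mul_sqrt_two

theorem sum_christov_sq {ℓ : ℝ} (hℓ : 0 < ℓ) {n : ℕ} (hn : Odd n) (x : ℝ) :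
    ∑ k ∈ Finset.range (n + 1), christov ℓ k x * christov ℓ k x = (n + 1) * ‖mt ℓ 0 x‖ ^ 2 := by
  obtain ⟨m, rfl⟩ := hn
  have h := ofReal_sum_christov_mul ℓ (m + 1) x x
  have h1 : ∀ i : ℕ, mt ℓ i x * (starRingEnd ℂ) (mt ℓ i x)
      + (starRingEnd ℂ) (mt ℓ i x) * mt ℓ i x = ((2 * ‖mt ℓ 0 x‖ ^ 2 : ℝ) : ℂ) := by
    intro i
    rw [mul_comm ((starRingEnd ℂ) _), Complex.mul_conj, Complex.normSq_eq_norm_sq,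
      norm_mt_eq hℓ i 0]
    push_cast
    ring
  simp only [h1, Finset.sum_const, Finset.card_range, nsmul_eq_mul] at h
  rw [show 2 * m + 1 + 1 = 2 * (m + 1) by ring]
  have h2 : ∑ k ∈ Finset.range (2 * (m + 1)), christov ℓ k x * christov ℓ k x
      = ((m + 1 : ℕ) : ℝ) * (2 * ‖mt ℓ 0 x‖ ^ 2) := by exact_mod_cast h
  rw [h2]
  push_cast
  ring

/-- The exponents run through `-m, …, m - 1`, and the geometric sum telescopes. -/
theorem sum_zpow_mul_sub {z : ℂ} (hz : z ≠ 0) (m : ℕ) :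
    (∑ i ∈ Finset.range m, (z ^ (i : ℤ) + z ^ (-1 - i : ℤ))) * (z - 1)
      = z ^ (m : ℤ) - z ^ (-m : ℤ) := by
  induction m with
  | zero => simp
  | succ m ih =>
    rw [Finset.sum_range_succ, add_mul, ih]
    have e1 : z ^ ((m + 1 : ℕ) : ℤ) = z ^ (m : ℤ) * z := by
      push_cast
      rw [zpow_add₀ hz, zpow_one]
    have e2 : z ^ (-m : ℤ) = z ^ (-1 - m : ℤ) * z := by
      rw [← zpow_add_one₀ hz]
      congr 1
      ring
    have e3 : z ^ (-((m + 1 : ℕ) : ℤ)) = z ^ (-1 - m : ℤ) := by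
      congr 1
      push_cast
      ring
    rw [e1, e2, e3]
    ring

/-- The angle of a node. -/
def nodeAngle (n i : ℕ) : ℝ := Real.pi * (2 * i - n) / (n + 1)

theorem node_eq_tanMap (ℓ : ℝ) (n i : ℕ) : node ℓ n i = tanMap ℓ (nodeAngle n i) := by
  rw [node, tanMap, nodeAngle]
  congr 2
  rw [div_div, mul_comm (n + 1 : ℝ)]

theorem nodeAngle_mem {n i : ℕ} (hi : i ≤ n) : nodeAngle n i ∈ Ioo (-Real.pi) Real.pi := by
  have hp := Real.pi_pos
  have hn : (0 : ℝ) < n + 1 := by positivity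
  have hi' : (i : ℝ) ≤ n := by exact_mod_cast hi
  have h0 : (0 : ℝ) ≤ i := by positivity
  rw [nodeAngle]
  constructor
  · rw [lt_div_iff₀ hn]
    nlinarith
  · rw [div_lt_iff₀ hn]
    nlinarith

theorem phase_node {ℓ : ℝ} (hℓ : 0 < ℓ) {n i : ℕ} (hi : i ≤ n) :
    phase ℓ (node ℓ n i) = Complex.exp (Complex.I * nodeAngle n i) := by
  rw [node_eq_tanMap, phase_tanMap hℓ (cos_half_pos (nodeAngle_mem hi)).ne']

theorem phase_node_div {ℓ : ℝ} (hℓ : 0 < ℓ) {n i k : ℕ} (hi : i ≤ n) (hk : k ≤ n) :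
    phase ℓ (node ℓ n i) / phase ℓ (node ℓ n k)
      = Complex.exp (2 * Real.pi * Complex.I * (((i - k : ℤ) : ℂ) / (n + 1))) := by
  rw [phase_node hℓ hi, phase_node hℓ hk, ← Complex.exp_sub, nodeAngle, nodeAngle]
  congr 1
  push_cast
  ring

/-- The reproducing kernel of `ℙₙ` at two nodes is a geometric sum in the ratio `z` of their phases.
The nodes are equidistant in angle, so `z` is an `(n+1)`-th root of unity different from `1`, and
the sum vanishes because `n + 1 = 2(m + 1)` gives `z^(m+1) = z^(-(m+1))`. -/
theorem sum_christov_node_eq_zero {ℓ : ℝ} (hℓ : 0 < ℓ) {n : ℕ} (hn : Odd n) {i k : ℕ}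
    (hi : i ≤ n) (hk : k ≤ n) (hik : i ≠ k) :
    ∑ q ∈ Finset.range (n + 1), christov ℓ q (node ℓ n i) * christov ℓ q (node ℓ n k) = 0 := by
  have hd := phase_node_div hℓ hi hk
  have hN : ((n : ℂ) + 1) ≠ 0 := by exact_mod_cast n.succ_ne_zero
  obtain ⟨m, hm⟩ := hn
  set x := node ℓ n i
  set y := node ℓ n k
  set z := phase ℓ x / phase ℓ y with hzdef
  have hz0 : z ≠ 0 := div_ne_zero (phase_ne_zero hℓ x) (phase_ne_zero hℓ y)
  have hpow : z ^ ((n + 1 : ℕ) : ℤ) = 1 := by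
    rw [hd, zpow_natCast, ← Complex.exp_nat_mul, Complex.exp_eq_one_iff]
    refine ⟨i - k, ?_⟩
    push_cast
    field_simp
  have hz1 : z ≠ 1 := by
    rw [hd]
    intro h
    rw [Complex.exp_eq_one_iff] at h
    obtain ⟨q, hq⟩ := h
    have hpi : (2 * Real.pi * Complex.I : ℂ) ≠ 0 := Complex.two_pi_I_ne_zero
    have h2 : (((i - k : ℤ) : ℂ) / (n + 1)) = q := by
      rw [mul_comm (q : ℂ)] at hq
      exact mul_left_cancel₀ hpi hq
    rw [div_eq_iff hN] at h2
    have h3 : (i - k : ℤ) = q * (n + 1) := by exact_mod_cast h2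
    -- Since `|i - k| ≤ n`, a multiple of `n + 1` can equal `i - k` only if it is zero.
    rcases lt_trichotomy q 0 with h | h | h
    · nlinarith
    · rw [h, zero_mul] at h3
      omega
    · nlinarith
  have hsum : ∑ a ∈ Finset.range (m + 1), (z ^ (a : ℤ) + z ^ (-1 - a : ℤ)) = 0 := by
    have h := sum_zpow_mul_sub hz0 (m + 1)
    have h2 : z ^ ((m + 1 : ℕ) : ℤ) = z ^ (-((m + 1 : ℕ) : ℤ)) := by
      rw [show -((m + 1 : ℕ) : ℤ) = ((m + 1 : ℕ) : ℤ) - ((n + 1 : ℕ) : ℤ) by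
        rw [hm]; push_cast; ring, zpow_sub₀ hz0, hpow, div_one]
    rw [h2, sub_self] at h
    exact (mul_eq_zero.1 h).resolve_right (sub_ne_zero.2 hz1)
  have hm' : n + 1 = 2 * (m + 1) := by omega
  have h := ofReal_sum_christov_mul ℓ (m + 1) x y
  have hconj : ∀ w : ℝ, (starRingEnd ℂ) (phase ℓ w) = (phase ℓ w)⁻¹ := by
    intro w
    rw [phase, map_div₀, conj_add_eq, conj_sub_eq, inv_div]
  have hterm : ∀ a : ℕ, mt ℓ a x * (starRingEnd ℂ) (mt ℓ a y) + (starRingEnd ℂ) (mt ℓ a x) * mt ℓ a y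
      = (z ^ (a : ℤ) + z ^ (-1 - a : ℤ)) * (mt ℓ 0 x * (starRingEnd ℂ) (mt ℓ 0 y)) := by
    intro a
    have e : ∀ b : ℤ, mt ℓ b x * (starRingEnd ℂ) (mt ℓ b y)
        = z ^ b * (mt ℓ 0 x * (starRingEnd ℂ) (mt ℓ 0 y)) := by
      intro b
      rw [mt_eq_phase_zpow hℓ b x, mt_eq_phase_zpow hℓ b y, map_mul, map_zpow₀, hconj, hzdef,
        div_eq_mul_inv, mul_zpow]
      ring
    have e2 := e (-1 - a)
    rw [← conj_mt, ← conj_mt, Complex.conj_conj] at e2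
    rw [e, e2]
    ring
  simp only [hterm] at h
  rw [← Finset.sum_mul, hsum, zero_mul] at h
  rw [hm']
  exact_mod_cast h

/-- The discrete weights: `∑ₖ φₖ(xᵢ)²`. -/
def weight (ℓ : ℝ) (n i : ℕ) : ℝ := (n + 1) * ‖mt ℓ 0 (node ℓ n i)‖ ^ 2

theorem weight_pos {ℓ : ℝ} (hℓ : 0 < ℓ) (n i : ℕ) : 0 < weight ℓ n i := by
  have := norm_pos_iff.2 (mt_ne_zero hℓ 0 (node ℓ n i))
  rw [weight]
  positivity

/-- The orthogonal matrix that relates nodal values and coefficients. -/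
def nodeMatrix (ℓ : ℝ) (n : ℕ) : Matrix (Fin (n + 1)) (Fin (n + 1)) ℝ :=
  fun i k => christov ℓ k (node ℓ n i) / √(weight ℓ n i)

theorem nodeMatrix_mul_transpose {ℓ : ℝ} (hℓ : 0 < ℓ) {n : ℕ} (hn : Odd n) :
    nodeMatrix ℓ n * (nodeMatrix ℓ n).transpose = 1 := by
  ext i k
  rw [Matrix.mul_apply]
  simp only [Matrix.transpose_apply, nodeMatrix, div_mul_div_comm]
  rw [← Finset.sum_div, Fin.sum_univ_eq_sum_range
    (fun q => christov ℓ q (node ℓ n i) * christov ℓ q (node ℓ n k)) (n + 1), Matrix.one_apply]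
  split_ifs with h
  · subst h
    rw [sum_christov_sq hℓ hn, Real.mul_self_sqrt (weight_pos hℓ n i).le, weight, div_self]
    exact (weight_pos hℓ n i).ne'
  · rw [sum_christov_node_eq_zero hℓ hn i.is_le k.is_le (fun hik => h (Fin.ext hik)), zero_div]

/-- A square matrix with orthonormal rows has orthonormal columns. This is the exactness of the
quadrature rule with weights `1 / weight` on products of two elements of `ℙₙ`. -/
theorem sum_christov_node_dual {ℓ : ℝ} (hℓ : 0 < ℓ) {n : ℕ} (hn : Odd n) (p q : Fin (n + 1)) :
    ∑ i : Fin (n + 1), christov ℓ p (node ℓ n i) * christov ℓ q (node ℓ n i) / weight ℓ n i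
      = if p = q then 1 else 0 := by
  have h := mul_eq_one_comm.1 (nodeMatrix_mul_transpose hℓ hn)
  have h2 := congrFun (congrFun h p) q
  rw [Matrix.mul_apply, Matrix.one_apply] at h2
  rw [← h2]
  refine Finset.sum_congr rfl fun i _ => ?_
  change _ = christov ℓ p (node ℓ n i) / √(weight ℓ n i) * (christov ℓ q (node ℓ n i)
    / √(weight ℓ n i))
  rw [div_mul_div_comm, Real.mul_self_sqrt (weight_pos hℓ n i).le]

theorem sum_christov_node_dual' {ℓ : ℝ} (hℓ : 0 < ℓ) {n : ℕ} (hn : Odd n) (i k : Fin (n + 1)) :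
    ∑ q : Fin (n + 1), christov ℓ q (node ℓ n i) * christov ℓ q (node ℓ n k)
      = if i = k then weight ℓ n i else 0 := by
  rw [Fin.sum_univ_eq_sum_range
    (fun q => christov ℓ q (node ℓ n i) * christov ℓ q (node ℓ n k)) (n + 1)]
  split_ifs with h
  · subst h
    rw [sum_christov_sq hℓ hn, weight]
  · exact sum_christov_node_eq_zero hℓ hn i.is_le k.is_le (fun hik => h (Fin.ext hik))

/-- The coefficients of the interpolant. -/
def interpCoef (ℓ : ℝ) (n : ℕ) (f : ℝ → ℝ) (k : ℕ) : ℝ :=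
  ∑ i : Fin (n + 1), christov ℓ k (node ℓ n i) * f (node ℓ n i) / weight ℓ n i

theorem sum_interpCoef_node {ℓ : ℝ} (hℓ : 0 < ℓ) {n : ℕ} (hn : Odd n) (f : ℝ → ℝ)
    (i : Fin (n + 1)) :
    ∑ k : Fin (n + 1), interpCoef ℓ n f k * christov ℓ k (node ℓ n i) = f (node ℓ n i) := by
  simp only [interpCoef, Finset.sum_mul]
  rw [Finset.sum_comm]
  have : ∀ j : Fin (n + 1), ∑ k : Fin (n + 1), christov ℓ k (node ℓ n j) * f (node ℓ n j)
      / weight ℓ n j * christov ℓ k (node ℓ n i)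
      = if j = i then f (node ℓ n i) else 0 := by
    intro j
    have h := sum_christov_node_dual' hℓ hn j i
    rw [Finset.sum_congr rfl fun (k : Fin (n + 1)) _ => show christov ℓ k (node ℓ n j) * f (node ℓ n j)
      / weight ℓ n j * christov ℓ k (node ℓ n i) = f (node ℓ n j) / weight ℓ n j *
        (christov ℓ k (node ℓ n j) * christov ℓ k (node ℓ n i)) by ring, ← Finset.mul_sum, h]
    split_ifs with h'
    · subst h'
      rw [div_mul_cancel₀ _ (weight_pos hℓ n j).ne']
    · rw [mul_zero]
  simp [this]

theorem interpCoef_sum {ℓ : ℝ} (hℓ : 0 < ℓ) {n : ℕ} (hn : Odd n) {f : ℝ → ℝ}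
    {a : Fin (n + 1) → ℝ} (h : ∀ i : Fin (n + 1), ∑ k, a k * christov ℓ k (node ℓ n i)
      = f (node ℓ n i)) (k : Fin (n + 1)) : interpCoef ℓ n f k = a k := by
  simp only [interpCoef, ← h, Finset.mul_sum, Finset.sum_div]
  rw [Finset.sum_comm]
  have : ∀ p : Fin (n + 1), ∑ i : Fin (n + 1), christov ℓ k (node ℓ n i) *
      (a p * christov ℓ p (node ℓ n i)) / weight ℓ n i = if k = p then a p else 0 := by
    intro p
    rw [Finset.sum_congr rfl fun (i : Fin (n + 1)) _ => show christov ℓ k (node ℓ n i) *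
      (a p * christov ℓ p (node ℓ n i)) / weight ℓ n i = a p * (christov ℓ k (node ℓ n i) *
        christov ℓ p (node ℓ n i) / weight ℓ n i) by ring, ← Finset.mul_sum,
      sum_christov_node_dual hℓ hn]
    split_ifs <;> simp
  simp [this]

theorem mem_mtcSpace_iff {ℓ : ℝ} {n : ℕ} {g : ℝ → ℝ} :
    g ∈ mtcSpace ℓ n ↔ ∃ a : Fin (n + 1) → ℝ, ∑ k, a k • christov ℓ k = g := by
  have : christov ℓ '' {k | k ≤ n} = range fun k : Fin (n + 1) => christov ℓ k := by
    ext f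
    constructor
    · rintro ⟨k, hk, rfl⟩
      exact ⟨⟨k, Nat.lt_succ_of_le hk⟩, rfl⟩
    · rintro ⟨k, rfl⟩
      exact ⟨k, k.is_le, rfl⟩
  rw [mtcSpace, this, Submodule.mem_span_range_iff_exists_fun]

theorem toL2_finsetSum {ι E : Type} [NormedAddCommGroup E] (J : Finset ι) {f : ι → ℝ → E}
    (h : ∀ k ∈ J, MemLp (f k) 2 volume) : toL2 (∑ k ∈ J, f k) = ∑ k ∈ J, toL2 (f k) := by
  classical
  induction J using Finset.induction_on with
  | empty =>
    rw [Finset.sum_empty, Finset.sum_empty, toL2_eq (MemLp.zero (ε := E))]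
    rfl
  | insert k J hk ih =>
    have h1 := fun q hq => h q (Finset.mem_insert_of_mem hq)
    rw [Finset.sum_insert hk, Finset.sum_insert hk, ← ih h1]
    exact toL2_add (h k (Finset.mem_insert_self k J)) (memLp_finsetSum' J h1) (ae_eq_refl _)

/-- The class in `L²` of a combination of the Christov functions. -/
theorem toL2_sum {ℓ : ℝ} (hℓ : 0 < ℓ) {n : ℕ} (a : Fin (n + 1) → ℝ) :
    toL2 (∑ k, a k • christov ℓ k) = ∑ k, a k • toL2 (christov ℓ k) := by
  rw [toL2_finsetSum Finset.univ fun (k : Fin (n + 1)) _ => (memLp_christov hℓ k).const_smul (a k)]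
  refine Finset.sum_congr rfl fun k _ => ?_
  rw [toL2_eq ((memLp_christov hℓ k).const_smul (a k)), toL2_eq (memLp_christov hℓ k)]
  exact MemLp.toLp_const_smul _ _

/-- The explicit sum shows that an interpolant exists, and `interpCoef_sum` that it is the only one.
So the choice in `interp` must return it. -/
theorem interp_eq_sum {ℓ : ℝ} (hℓ : 0 < ℓ) {n : ℕ} (hn : Odd n) (f : ℝ → ℝ) :
    interp ℓ n f = ∑ k : Fin (n + 1), interpCoef ℓ n f k • toL2 (christov ℓ k) := by
  have hex : ∃ g ∈ mtcSpace ℓ n, ∀ i ≤ n, g (node ℓ n i) = f (node ℓ n i) := by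
    refine ⟨∑ k : Fin (n + 1), interpCoef ℓ n f k • christov ℓ k, mem_mtcSpace_iff.2 ⟨_, rfl⟩,
      fun i hi => ?_⟩
    have := sum_interpCoef_node hℓ hn f ⟨i, Nat.lt_succ_of_le hi⟩
    simpa [Finset.sum_apply] using this
  rw [interp, dif_pos hex]
  obtain ⟨h1, h2⟩ := hex.choose_spec
  generalize hex.choose = g at h1 h2
  obtain ⟨a, rfl⟩ := mem_mtcSpace_iff.1 h1
  rw [toL2_sum hℓ]
  refine Finset.sum_congr rfl fun k _ => ?_
  rw [interpCoef_sum hℓ hn (a := a) (f := f)]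
  intro i
  rw [← h2 i i.is_le]
  simp [Finset.sum_apply]

theorem interp_sub {ℓ : ℝ} (hℓ : 0 < ℓ) {n : ℕ} (hn : Odd n) (f g : ℝ → ℝ) :
    interp ℓ n (f - g) = interp ℓ n f - interp ℓ n g := by
  rw [interp_eq_sum hℓ hn, interp_eq_sum hℓ hn, interp_eq_sum hℓ hn, ← Finset.sum_sub_distrib]
  refine Finset.sum_congr rfl fun k _ => ?_
  rw [← sub_smul]
  congr 1
  rw [interpCoef, interpCoef, interpCoef, ← Finset.sum_sub_distrib]
  refine Finset.sum_congr rfl fun i _ => ?_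
  rw [Pi.sub_apply]
  ring

theorem interp_add {ℓ : ℝ} (hℓ : 0 < ℓ) {n : ℕ} (hn : Odd n) (f g : ℝ → ℝ) :
    interp ℓ n (f + g) = interp ℓ n f + interp ℓ n g := by
  rw [interp_eq_sum hℓ hn, interp_eq_sum hℓ hn, interp_eq_sum hℓ hn, ← Finset.sum_add_distrib]
  refine Finset.sum_congr rfl fun k _ => ?_
  rw [← add_smul]
  congr 1
  rw [interpCoef, interpCoef, interpCoef, ← Finset.sum_add_distrib]
  refine Finset.sum_congr rfl fun i _ => ?_
  rw [Pi.add_apply]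
  ring

theorem interp_smul {ℓ : ℝ} (hℓ : 0 < ℓ) {n : ℕ} (hn : Odd n) (c : ℝ) (f : ℝ → ℝ) :
    interp ℓ n (c • f) = c • interp ℓ n f := by
  rw [interp_eq_sum hℓ hn, interp_eq_sum hℓ hn, Finset.smul_sum]
  refine Finset.sum_congr rfl fun k _ => ?_
  rw [smul_smul]
  congr 1
  rw [interpCoef, interpCoef, Finset.mul_sum]
  refine Finset.sum_congr rfl fun i _ => ?_
  rw [Pi.smul_apply, smul_eq_mul]
  ring

/-- Interpolation reproduces `ℙₙ`. -/
theorem interp_sum {ℓ : ℝ} (hℓ : 0 < ℓ) {n : ℕ} (hn : Odd n) (a : Fin (n + 1) → ℝ) :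
    interp ℓ n (∑ k, a k • christov ℓ k) = ∑ k, a k • toL2 (christov ℓ k) := by
  rw [interp_eq_sum hℓ hn]
  refine Finset.sum_congr rfl fun k _ => ?_
  rw [interpCoef_sum hℓ hn (a := a)]
  intro i
  simp [Finset.sum_apply]

theorem inner_christov {ℓ : ℝ} (hℓ : 0 < ℓ) (p q : ℕ) :
    inner ℝ (toL2 (christov ℓ p)) (toL2 (christov ℓ q)) = if p = q then (1 : ℝ) else 0 := by
  rw [← Complex.ofReal_inj, ← inner_complexify]
  have h : (√2 : ℂ) * √2 = 2 := by
    rw [← Complex.ofReal_mul, sqrt_two_mul_sqrt_two]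
    norm_num
  have h0 : (√2 : ℂ) ≠ 0 := by
    exact_mod_cast (Real.sqrt_pos.2 two_pos).ne'
  have hd : ∀ j k : ℤ, inner ℂ (mtL2 ℓ j) (mtL2 ℓ k) = if j = k then (1 : ℂ) else 0 :=
    inner_mtL2_mtL2 hℓ
  obtain ⟨i, rfl | rfl⟩ := p.even_or_odd' <;> obtain ⟨k, rfl | rfl⟩ := q.even_or_odd'
  · rw [complexify_christov_even hℓ, complexify_christov_even hℓ]
    simp only [inner_smul_left, inner_smul_right, inner_add_left, inner_add_right, hd]
    have e1 : ¬ ((i : ℤ) = -1 - k) := by omega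
    have e2 : ¬ (-1 - (i : ℤ) = k) := by omega
    by_cases hik : i = k
    · subst hik
      simp only [e1, e2, if_true, if_false, map_div₀, map_one, Complex.conj_ofReal]
      field_simp
      rw [pow_two, h]
      norm_num
    · have e3 : ¬ ((i : ℤ) = k) := by omega
      have e4 : ¬ (-1 - (i : ℤ) = -1 - k) := by omega
      have e5 : ¬ (2 * i = 2 * k) := by omega
      simp [e1, e2, e3, e4, e5]
  · rw [complexify_christov_even hℓ, complexify_christov_odd hℓ]
    simp only [inner_smul_left, inner_smul_right, inner_add_left, inner_sub_right, hd]
    have e1 : ¬ ((i : ℤ) = -1 - k) := by omega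
    have e2 : ¬ (-1 - (i : ℤ) = k) := by omega
    have e5 : ¬ (2 * i = 2 * k + 1) := by omega
    by_cases hik : i = k
    · subst hik
      simp [e1, e2]
    · have e3 : ¬ ((i : ℤ) = k) := by omega
      have e4 : ¬ (-1 - (i : ℤ) = -1 - k) := by omega
      simp [e1, e2, e3, e4, e5]
  · rw [complexify_christov_even hℓ, complexify_christov_odd hℓ]
    simp only [inner_smul_left, inner_smul_right, inner_sub_left, inner_add_right, hd]
    have e1 : ¬ ((i : ℤ) = -1 - k) := by omega
    have e2 : ¬ (-1 - (i : ℤ) = k) := by omega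
    have e5 : ¬ (2 * i + 1 = 2 * k) := by omega
    by_cases hik : i = k
    · subst hik
      simp [e1, e2]
    · have e3 : ¬ ((i : ℤ) = k) := by omega
      have e4 : ¬ (-1 - (i : ℤ) = -1 - k) := by omega
      simp [e1, e2, e3, e4, e5]
  · rw [complexify_christov_odd hℓ, complexify_christov_odd hℓ]
    simp only [inner_smul_left, inner_smul_right, inner_sub_left, inner_sub_right, hd]
    have e1 : ¬ ((i : ℤ) = -1 - k) := by omega
    have e2 : ¬ (-1 - (i : ℤ) = k) := by omega
    by_cases hik : i = k
    · subst hik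
      simp only [e1, e2, if_true, if_false, map_div₀, map_neg, Complex.conj_I, Complex.conj_ofReal]
      field_simp
      push_cast
      linear_combination (-2) * Complex.I_sq - h
    · have e3 : ¬ ((i : ℤ) = k) := by omega
      have e4 : ¬ (-1 - (i : ℤ) = -1 - k) := by omega
      have e5 : ¬ (2 * i = 2 * k) := by omega
      simp [e1, e2, e3, e4, e5]

theorem inner_sum_christov {ℓ : ℝ} (hℓ : 0 < ℓ) {n : ℕ} (a b : Fin (n + 1) → ℝ) :
    inner ℝ (∑ k, a k • toL2 (christov ℓ k)) (∑ k, b k • toL2 (christov ℓ k)) = ∑ k, a k * b k := by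
  rw [sum_inner]
  refine Finset.sum_congr rfl fun p _ => ?_
  rw [inner_sum]
  simp only [real_inner_smul_left, real_inner_smul_right, inner_christov hℓ, Fin.val_inj]
  simp [mul_comm]

/-- The discrete inner product. -/
theorem inner_sum_interp {ℓ : ℝ} (hℓ : 0 < ℓ) {n : ℕ} (hn : Odd n) (a : Fin (n + 1) → ℝ)
    (f : ℝ → ℝ) : inner ℝ (∑ k, a k • toL2 (christov ℓ k)) (interp ℓ n f)
      = ∑ i : Fin (n + 1), (∑ k, a k * christov ℓ k (node ℓ n i)) * f (node ℓ n i)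
        / weight ℓ n i := by
  rw [interp_eq_sum hℓ hn, inner_sum_christov hℓ]
  simp only [interpCoef, Finset.mul_sum, Finset.sum_mul, Finset.sum_div]
  rw [Finset.sum_comm]
  refine Finset.sum_congr rfl fun i _ => Finset.sum_congr rfl fun k _ => ?_
  ring

theorem norm_interp_sq {ℓ : ℝ} (hℓ : 0 < ℓ) {n : ℕ} (hn : Odd n) (f : ℝ → ℝ) :
    ‖interp ℓ n f‖ ^ 2 = ∑ i : Fin (n + 1), f (node ℓ n i) ^ 2 / weight ℓ n i := by
  rw [← real_inner_self_eq_norm_sq]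
  nth_rw 1 [interp_eq_sum hℓ hn]
  rw [inner_sum_interp hℓ hn]
  refine Finset.sum_congr rfl fun i _ => ?_
  rw [sum_interpCoef_node hℓ hn, pow_two]

/-- The weights are `(n + 1) |mt ℓ 0|²` at the nodes, so each of the `n + 1` terms of the quadrature
sum is at most `M²/(n + 1)`: interpolation is stable, uniformly in `n`, for the supremum of `f / mt
ℓ 0`. -/
theorem norm_interp_le {ℓ : ℝ} (hℓ : 0 < ℓ) {n : ℕ} (hn : Odd n) {f : ℝ → ℝ} {M : ℝ} (hM : 0 ≤ M)
    (h : ∀ x, |f x| ≤ M * ‖mt ℓ 0 x‖) : ‖interp ℓ n f‖ ≤ M := by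
  refine le_of_sq_le_sq ?_ hM
  rw [norm_interp_sq hℓ hn]
  have : ∀ i : Fin (n + 1), f (node ℓ n i) ^ 2 / weight ℓ n i ≤ M ^ 2 / (n + 1) := by
    intro i
    have hp := norm_pos_iff.2 (mt_ne_zero hℓ 0 (node ℓ n i))
    rw [div_le_div_iff₀ (weight_pos hℓ n i) (by positivity), weight]
    have h1 : f (node ℓ n i) ^ 2 ≤ (M * ‖mt ℓ 0 (node ℓ n i)‖) ^ 2 :=
      sq_le_sq' (by linarith [neg_abs_le (f (node ℓ n i)), h (node ℓ n i)])
        ((le_abs_self _).trans (h _))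
    calc _ ≤ (M * ‖mt ℓ 0 (node ℓ n i)‖) ^ 2 * (n + 1) :=
          mul_le_mul_of_nonneg_right h1 (by positivity)
      _ = _ := by ring
  refine (Finset.sum_le_sum fun i _ => this i).trans (le_of_eq ?_)
  rw [Finset.sum_const, Finset.card_univ, Fintype.card_fin, nsmul_eq_mul]
  push_cast
  field_simp

/-! ### Absolutely convergent expansions -/

/-- The weighted `ℓ¹` norm of a sequence. -/
def wn (σ : ℝ) (c : ℤ → ℂ) : ℝ≥0∞ := ∑' j, ENNReal.ofReal (lam j ^ σ) * ‖c j‖ₑ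

theorem wn_zero (c : ℤ → ℂ) : wn 0 c = ∑' j, ‖c j‖ₑ := by
  simp [wn]

theorem wn_mono {σ : ℝ} {c d : ℤ → ℂ} (h : ∀ j, ‖c j‖ ≤ ‖d j‖) : wn σ c ≤ wn σ d :=
  ENNReal.tsum_le_tsum fun j => mul_le_mul_right (enorm_le_iff_norm_le.2 (h j)) _

theorem wn_mono_exponent {σ τ : ℝ} (h : σ ≤ τ) (c : ℤ → ℂ) : wn σ c ≤ wn τ c :=
  ENNReal.tsum_le_tsum fun j => mul_le_mul_left (ENNReal.ofReal_le_ofReal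
    (Real.rpow_le_rpow_of_exponent_le (one_le_lam j) h)) _

theorem wn_sub_trunc_le {σ : ℝ} (hσ : 0 ≤ σ) {n : ℕ} (hn : 1 ≤ n) (c : ℤ → ℂ) :
    wn 0 (c - trunc n c) ≤ ENNReal.ofReal ((n : ℝ) ^ (-σ)) * wn σ c := by
  rw [wn, wn, ← ENNReal.tsum_mul_left]
  refine ENNReal.tsum_le_tsum fun j => ?_
  rw [Pi.sub_apply, trunc]
  split_ifs with h
  · simp
  · rw [sub_zero, ← mul_assoc, ← ENNReal.ofReal_mul (by positivity)]
    refine mul_le_mul_left (ENNReal.ofReal_le_ofReal ?_) _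
    have := lam_rpow_le hσ hn (not_le.1 h).le
    rwa [zero_sub] at this

theorem summable_inv_lam_sq : Summable fun j : ℤ => (lam j)⁻¹ ^ 2 := by
  have h := (Real.summable_one_div_int_pow (p := 2)).2 (by norm_num)
  have hi : Function.Injective fun j : ℤ => 2 * j + 1 := fun a b hab => by
    simp only at hab
    omega
  refine (h.comp_injective hi).congr fun j => ?_
  simp only [Function.comp_apply, lam]
  push_cast
  rw [inv_pow, sq_abs, one_div]

theorem eLpNorm_inv_lam_lt_top : eLpNorm (fun j : ℤ => (lam j)⁻¹) 2 Measure.count < ⊤ := by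
  rw [eLpNorm_lt_top_iff_lintegral_rpow_enorm_lt_top two_ne_zero ENNReal.ofNat_ne_top,
    lintegral_count]
  have e : ∀ j, ‖(lam j)⁻¹‖ₑ ^ (2 : ℝ≥0∞).toReal = ENNReal.ofReal ((lam j)⁻¹ ^ 2) := by
    intro j
    have h0 := inv_nonneg.2 (lam_pos j).le
    rw [Real.enorm_eq_ofReal h0, ENNReal.ofReal_pow h0]
    simp
  simp_rw [e]
  rw [← ENNReal.ofReal_tsum_of_nonneg (fun _ => sq_nonneg _) summable_inv_lam_sq]
  exact ENNReal.ofReal_lt_top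

/-- Cauchy-Schwarz against the square summable sequence `1/lam`; one full power of `lam` is spent.
-/
theorem exists_wn_le_sn : ∃ C : ℝ, 0 ≤ C ∧ ∀ (s : ℝ) (c : ℤ → ℂ),
    wn (s - 1) c ≤ ENNReal.ofReal C * sn s c := by
  refine ⟨(eLpNorm (fun j : ℤ => (lam j)⁻¹) 2 Measure.count).toReal, ENNReal.toReal_nonneg,
    fun s c => ?_⟩
  rw [ENNReal.ofReal_toReal eLpNorm_inv_lam_lt_top.ne]
  have h := eLpNorm_smul_le_mul_eLpNorm (p := 2) (q := 2) (r := 1) (μ := Measure.count)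
    (f := fun j : ℤ => lam j ^ s * ‖c j‖) (φ := fun j : ℤ => (lam j)⁻¹) (aesm_int _) (aesm_int _)
  refine le_trans (le_of_eq ?_) h
  rw [eLpNorm_one_eq_lintegral_enorm, lintegral_count, wn]
  congr 1
  ext j
  rw [Pi.smul_apply', smul_eq_mul, ← mul_assoc, Real.rpow_sub_one (lam_pos j).ne', div_eq_inv_mul,
    enorm_mul, enorm_norm, Real.enorm_eq_ofReal]
  exact mul_nonneg (inv_nonneg.2 (lam_pos j).le) (lam_rpow_nonneg j s)

theorem summable_norm_of_wn {c : ℤ → ℂ} (h : wn 0 c < ⊤) : Summable fun j => ‖c j‖ := by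
  rw [wn_zero] at h
  exact (ENNReal.summable_toReal h.ne).congr fun j => toReal_enorm _

/-- All basis functions have the modulus of `mt ℓ 0`, so the `ℓ¹` norm controls exactly the quantity
in which interpolation is stable. -/
theorem enorm_tsum_mul_mt_le {ℓ : ℝ} (hℓ : 0 < ℓ) (c : ℤ → ℂ) (x : ℝ) :
    ‖∑' j, c j * mt ℓ j x‖ₑ ≤ wn 0 c * ‖mt ℓ 0 x‖ₑ := by
  refine (enorm_tsum_le_tsum_enorm).trans (le_of_eq ?_)
  rw [wn_zero, ← ENNReal.tsum_mul_right]
  congr 1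
  ext j
  rw [enorm_mul, ← ofReal_norm (mt ℓ j x), norm_mt_eq hℓ j 0, ofReal_norm]

theorem continuous_tsum_mul_mt {ℓ : ℝ} (hℓ : 0 < ℓ) {c : ℤ → ℂ} (h : wn 0 c < ⊤) :
    Continuous fun x => ∑' j, c j * mt ℓ j x := by
  refine continuous_tsum (fun j => continuous_const.mul (continuous_mt hℓ j))
    ((summable_norm_of_wn h).mul_right (√(2 * ℓ / Real.pi) / ℓ)) fun j x => ?_
  rw [norm_mul]
  exact mul_le_mul_of_nonneg_left (norm_mt_le hℓ j x) (norm_nonneg _)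

theorem memLp_tsum_mul_mt {ℓ : ℝ} (hℓ : 0 < ℓ) {c : ℤ → ℂ} (h : wn 0 c < ⊤) :
    MemLp (fun x => ∑' j, c j * mt ℓ j x) 2 volume := by
  refine (memLp_mt hℓ 0).of_le_mul (c := (wn 0 c).toReal)
    (continuous_tsum_mul_mt hℓ h).aestronglyMeasurable (Eventually.of_forall fun x => ?_)
  have h1 := enorm_tsum_mul_mt_le hℓ c x
  have h2 := ENNReal.toReal_mono (ENNReal.mul_lt_top h enorm_lt_top).ne h1
  rwa [ENNReal.toReal_mul, toReal_enorm, toReal_enorm] at h2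

theorem integral_conj_mt_mul_mt {ℓ : ℝ} (hℓ : 0 < ℓ) (j k : ℤ) :
    ∫ x, (starRingEnd ℂ) (mt ℓ j x) * mt ℓ k x = if j = k then 1 else 0 := by
  rw [← inner_mtL2_mtL2 hℓ, inner_mtL2_eq_integral hℓ j (coeFn_mtL2 hℓ k)]

theorem integrable_conj_mt_mul_mt {ℓ : ℝ} (hℓ : 0 < ℓ) (j k : ℤ) :
    Integrable fun x => (starRingEnd ℂ) (mt ℓ j x) * mt ℓ k x := by
  refine (integrable_conj_mt_mul hℓ j (mtL2 ℓ k)).congr ?_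
  filter_upwards [coeFn_mtL2 hℓ k] with x hx
  rw [hx]

/-- An absolutely convergent expansion has the expected coefficients. -/
theorem coef_toL2_tsum {ℓ : ℝ} (hℓ : 0 < ℓ) {c : ℤ → ℂ} (h : wn 0 c < ⊤) :
    coef ℓ (toL2 fun x => ∑' j, c j * mt ℓ j x) = c := by
  ext k
  rw [coef, inner_mtL2_eq_integral hℓ k (coeFn_toL2 (memLp_tsum_mul_mt hℓ h))]
  have hnorm : ∀ j x, ‖(starRingEnd ℂ) (mt ℓ k x) * (c j * mt ℓ j x)‖
      = ‖c j‖ * ‖mt ℓ 0 x‖ ^ 2 := by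
    intro j x
    rw [norm_mul, norm_mul, Complex.norm_conj, norm_mt_eq hℓ k 0, norm_mt_eq hℓ j 0]
    ring
  -- Sum and integral may be exchanged because the terms are dominated by `|c j| |mt ℓ 0|²`.
  have hs := hasSum_integral_of_summable_integral_norm (μ := volume)
    (F := fun j x => (starRingEnd ℂ) (mt ℓ k x) * (c j * mt ℓ j x)) (fun j => by
      refine ((integrable_conj_mt_mul_mt hℓ k j).const_mul (c j)).congr
        (Eventually.of_forall fun x => ?_)
      simp only
      ring) (by
      simp only [hnorm, integral_const_mul]
      exact (summable_norm_of_wn h).mul_right _)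
  have e : ∀ j, ∫ x, (starRingEnd ℂ) (mt ℓ k x) * (c j * mt ℓ j x)
      = if j = k then c k else 0 := by
    intro j
    have : ∀ x, (starRingEnd ℂ) (mt ℓ k x) * (c j * mt ℓ j x)
        = c j * ((starRingEnd ℂ) (mt ℓ k x) * mt ℓ j x) := fun x => by ring
    simp only [this]
    rw [integral_const_mul, integral_conj_mt_mul_mt hℓ]
    rcases eq_or_ne j k with rfl | hjk
    · simp
    · simp [hjk, hjk.symm]
  simp only [e] at hs
  have h2 := hs.unique (hasSum_ite_eq k (c k))
  rw [← h2]
  congr 1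
  ext x
  rw [tsum_mul_left]

theorem contRep_eq_of_continuous {f : L2} {g : ℝ → ℝ} (hg : Continuous g) (h : f =ᵐ[volume] g) :
    contRep f = g := by
  have hex : ∃ g : ℝ → ℝ, Continuous g ∧ f =ᵐ[volume] g := ⟨g, hg, h⟩
  rw [contRep, dif_pos hex]
  obtain ⟨h1, h2⟩ := hex.choose_spec
  exact (Continuous.ae_eq_iff_eq volume h1 hg).1 (h2.symm.trans h)

theorem coeFn_eq_re_tsum {ℓ : ℝ} (hℓ : 0 < ℓ) {f : L2} (h : wn 0 (coef ℓ (complexify f)) < ⊤) :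
    f =ᵐ[volume] fun x => (∑' j, coef ℓ (complexify f) j * mt ℓ j x).re := by
  have h1 := coef_injective hℓ (coef_toL2_tsum hℓ h)
  have h2 := coeFn_toL2 (memLp_tsum_mul_mt hℓ h)
  rw [h1] at h2
  filter_upwards [h2, coeFn_complexify f] with x hx hx'
  rw [← hx, hx', Complex.ofReal_re]

/-- The continuous representative of a function with absolutely summable coefficients. -/
theorem contRep_eq_re_tsum {ℓ : ℝ} (hℓ : 0 < ℓ) {f : L2}
    (h : wn 0 (coef ℓ (complexify f)) < ⊤) :
    contRep f = fun x => (∑' j, coef ℓ (complexify f) j * mt ℓ j x).re :=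
  contRep_eq_of_continuous (Complex.continuous_re.comp (continuous_tsum_mul_mt hℓ h))
    (coeFn_eq_re_tsum hℓ h)

theorem continuous_contRep {ℓ : ℝ} (hℓ : 0 < ℓ) {f : L2}
    (h : wn 0 (coef ℓ (complexify f)) < ⊤) : Continuous (contRep f) := by
  rw [contRep_eq_re_tsum hℓ h]
  exact Complex.continuous_re.comp (continuous_tsum_mul_mt hℓ h)

theorem coeFn_eq_contRep {ℓ : ℝ} (hℓ : 0 < ℓ) {f : L2}
    (h : wn 0 (coef ℓ (complexify f)) < ⊤) : f =ᵐ[volume] contRep f := by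
  rw [contRep_eq_re_tsum hℓ h]
  exact coeFn_eq_re_tsum hℓ h

theorem ofReal_contRep {ℓ : ℝ} (hℓ : 0 < ℓ) {f : L2}
    (h : wn 0 (coef ℓ (complexify f)) < ⊤) (x : ℝ) :
    (contRep f x : ℂ) = ∑' j, coef ℓ (complexify f) j * mt ℓ j x := by
  have h1 := coef_injective hℓ (coef_toL2_tsum hℓ h)
  have h2 := coeFn_toL2 (memLp_tsum_mul_mt hℓ h)
  rw [h1] at h2
  refine congrFun ((Continuous.ae_eq_iff_eq volume (Complex.continuous_ofReal.comp
    (continuous_contRep hℓ h)) (continuous_tsum_mul_mt hℓ h)).1 ?_) x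
  filter_upwards [h2, coeFn_complexify f, coeFn_eq_contRep hℓ h] with x hx hx' hx''
  rw [← hx, hx', Function.comp_apply, hx'']

theorem enorm_contRep_le {ℓ : ℝ} (hℓ : 0 < ℓ) {f : L2}
    (h : wn 0 (coef ℓ (complexify f)) < ⊤) (x : ℝ) :
    ‖contRep f x‖ₑ ≤ wn 0 (coef ℓ (complexify f)) * ‖mt ℓ 0 x‖ₑ := by
  have h1 := enorm_tsum_mul_mt_le hℓ (coef ℓ (complexify f)) x
  rw [← ofReal_contRep hℓ h] at h1
  rwa [← ofReal_norm, Complex.norm_real, ofReal_norm] at h1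

theorem contRep_sub {ℓ : ℝ} (hℓ : 0 < ℓ) {f g : L2} (hf : wn 0 (coef ℓ (complexify f)) < ⊤)
    (hg : wn 0 (coef ℓ (complexify g)) < ⊤) : contRep (f - g) = contRep f - contRep g := by
  refine contRep_eq_of_continuous ((continuous_contRep hℓ hf).sub (continuous_contRep hℓ hg)) ?_
  filter_upwards [Lp.coeFn_sub f g, coeFn_eq_contRep hℓ hf, coeFn_eq_contRep hℓ hg] with x h1 h2 h3
  rw [h1, Pi.sub_apply, Pi.sub_apply, h2, h3]

theorem contRep_add {ℓ : ℝ} (hℓ : 0 < ℓ) {f g : L2} (hf : wn 0 (coef ℓ (complexify f)) < ⊤)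
    (hg : wn 0 (coef ℓ (complexify g)) < ⊤) : contRep (f + g) = contRep f + contRep g := by
  refine contRep_eq_of_continuous ((continuous_contRep hℓ hf).add (continuous_contRep hℓ hg)) ?_
  filter_upwards [Lp.coeFn_add f g, coeFn_eq_contRep hℓ hf, coeFn_eq_contRep hℓ hg] with x h1 h2 h3
  rw [h1, Pi.add_apply, Pi.add_apply, h2, h3]

theorem contRep_smul {ℓ : ℝ} (hℓ : 0 < ℓ) (a : ℝ) {f : L2}
    (hf : wn 0 (coef ℓ (complexify f)) < ⊤) : contRep (a • f) = a • contRep f := by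
  refine contRep_eq_of_continuous ((continuous_contRep hℓ hf).const_smul a) ?_
  filter_upwards [Lp.coeFn_smul a f, coeFn_eq_contRep hℓ hf] with x h1 h2
  rw [h1, Pi.smul_apply, Pi.smul_apply, h2]

/-! ### Projection and interpolation of absolutely convergent expansions -/

theorem finite_lam_le (n : ℕ) : {j : ℤ | lam j ≤ n}.Finite := by
  refine (Set.finite_Icc (-(n : ℤ)) n).subset fun j hj => ?_
  have h := (lam_le_iff j n).1 hj
  rw [abs_le] at h
  constructor <;> omega

theorem wn_trunc_lt_top (σ : ℝ) (n : ℕ) (c : ℤ → ℂ) : wn σ (trunc n c) < ⊤ := by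
  have h : ∀ j ∉ (finite_lam_le n).toFinset,
      ENNReal.ofReal (lam j ^ σ) * ‖trunc n c j‖ₑ = 0 := by
    intro j hj
    rw [Set.Finite.mem_toFinset, mem_ofPred_eq] at hj
    rw [trunc, if_neg hj]
    simp
  rw [wn, tsum_eq_sum h]
  exact ENNReal.sum_lt_top.2 fun j _ => ENNReal.mul_lt_top ENNReal.ofReal_lt_top enorm_lt_top

theorem wn_proj_lt_top {ℓ : ℝ} (hℓ : 0 < ℓ) {n : ℕ} (hn : Odd n) (σ : ℝ) (f : L2) :
    wn σ (coef ℓ (complexify (proj ℓ n f))) < ⊤ := by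
  rw [coef_proj hℓ hn]
  exact wn_trunc_lt_top σ n _

theorem proj_eq_sum (ℓ : ℝ) (n : ℕ) (f : L2) : proj ℓ n f
    = ∑ k : Fin (n + 1), inner ℝ f (toL2 (christov ℓ k)) • toL2 (christov ℓ k) := by
  rw [proj, Fin.sum_univ_eq_sum_range
    (fun k => inner ℝ f (toL2 (christov ℓ k)) • toL2 (christov ℓ k)) (n + 1)]

theorem contRep_sum_christov {ℓ : ℝ} (hℓ : 0 < ℓ) {n : ℕ} (a : Fin (n + 1) → ℝ) :
    contRep (∑ k, a k • toL2 (christov ℓ k)) = ∑ k, a k • christov ℓ k := by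
  refine contRep_eq_of_continuous ?_ ?_
  · have h : ∀ k ∈ (Finset.univ : Finset (Fin (n + 1))), Continuous (a k • christov ℓ k) :=
      fun k _ => (continuous_christov hℓ k).const_smul (a k)
    convert! continuous_finsetSum _ h using 1
    ext x
    rw [Finset.sum_apply]
  · rw [← toL2_sum hℓ]
    have := memLp_finsetSum' (μ := volume) (p := 2) (f := fun k : Fin (n + 1) => a k • christov ℓ k)
      Finset.univ fun k _ => (memLp_christov hℓ k).const_smul (a k)
    exact coeFn_toL2 this

theorem interp_contRep_proj {ℓ : ℝ} (hℓ : 0 < ℓ) {n : ℕ} (hn : Odd n) (f : L2) :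
    interp ℓ n (contRep (proj ℓ n f)) = proj ℓ n f := by
  rw [proj_eq_sum, contRep_sum_christov hℓ, interp_sum hℓ hn]

/-- The distance of the projection and the interpolant. -/
theorem enorm_proj_sub_interp_le {ℓ : ℝ} (hℓ : 0 < ℓ) {n : ℕ} (hn : Odd n) {f : L2}
    (h : wn 0 (coef ℓ (complexify f)) < ⊤) :
    ‖proj ℓ n f - interp ℓ n (contRep f)‖ₑ
      ≤ wn 0 (coef ℓ (complexify f) - trunc n (coef ℓ (complexify f))) := by
  have hc : coef ℓ (complexify (f - proj ℓ n f))
      = coef ℓ (complexify f) - trunc n (coef ℓ (complexify f)) := by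
    rw [complexify_sub, coef_sub, coef_proj hℓ hn]
  have hfin : wn 0 (coef ℓ (complexify (f - proj ℓ n f))) < ⊤ := by
    refine lt_of_le_of_lt (wn_mono fun j => ?_) h
    rw [hc, Pi.sub_apply, trunc]
    split_ifs <;> simp
  -- Interpolation reproduces the projection, so only the aliasing error remains: the interpolant of
  -- the tail `f - proj ℓ n f`.
  have e : proj ℓ n f - interp ℓ n (contRep f) = -interp ℓ n (contRep (f - proj ℓ n f)) := by
    rw [contRep_sub hℓ h (wn_proj_lt_top hℓ hn 0 f), interp_sub hℓ hn, interp_contRep_proj hℓ hn]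
    abel
  rw [e, enorm_neg, ← hc]
  have h1 : ‖interp ℓ n (contRep (f - proj ℓ n f))‖
      ≤ (wn 0 (coef ℓ (complexify (f - proj ℓ n f)))).toReal := by
    refine norm_interp_le hℓ hn ENNReal.toReal_nonneg fun x => ?_
    have h2 := ENNReal.toReal_mono (ENNReal.mul_lt_top hfin enorm_lt_top).ne
      (enorm_contRep_le hℓ hfin x)
    rwa [ENNReal.toReal_mul, toReal_enorm, toReal_enorm, Real.norm_eq_abs] at h2
  rw [← ofReal_norm]
  exact ENNReal.ofReal_le_of_le_toReal h1

/-! ### Products -/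

/-- The phases multiply, and one remaining factor `1/(ℓ - 2ix)` is absorbed by adding the next basis
function. -/
theorem mt_mul_mt {ℓ : ℝ} (hℓ : 0 < ℓ) (i j : ℤ) (x : ℝ) :
    mt ℓ i x * mt ℓ j x
      = (√(2 * ℓ / Real.pi) / (2 * ℓ) : ℝ) * (mt ℓ (i + j) x + mt ℓ (i + j + 1) x) := by
  have hb := sub_ne_zero_of_pos hℓ x
  have hl : (ℓ : ℂ) ≠ 0 := by exact_mod_cast hℓ.ne'
  rw [mt_add_mt_succ hℓ, mt_add hℓ i j, mt_eq_phase_zpow hℓ i]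
  have : mt ℓ 0 x = (√(2 * ℓ / Real.pi) : ℝ) / (ℓ - 2 * Complex.I * x) := by
    simp [mt]
  rw [this]
  push_cast
  field_simp

theorem lam_add_le {i j b : ℤ} (hb : b ∈ ({0, 1} : Finset ℤ)) :
    lam (i + j + b) ≤ 3 * (lam i * lam j) := by
  have hi := one_le_lam i
  have hj := one_le_lam j
  have h : lam (i + j + b) ≤ lam i + lam j + 1 := by
    simp only [lam]
    have hb' : |2 * (b : ℝ) - 1| = 1 := by
      simp only [Finset.mem_insert, Finset.mem_singleton] at hb
      rcases hb with rfl | rfl <;> norm_num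
    have e : 2 * (((i + j + b : ℤ)) : ℝ) + 1 = (2 * (i : ℝ) + 1) + (2 * (j : ℝ) + 1)
        + (2 * (b : ℝ) - 1) := by
      push_cast
      ring
    rw [e]
    exact (abs_add_le _ _).trans (add_le_add (abs_add_le _ _) hb'.le)
  nlinarith

theorem wn_add_le (σ : ℝ) (c d : ℤ → ℂ) : wn σ (c + d) ≤ wn σ c + wn σ d := by
  rw [wn, wn, wn, ← ENNReal.tsum_add]
  refine ENNReal.tsum_le_tsum fun j => ?_
  rw [← mul_add]
  exact mul_le_mul_right (enorm_add_le _ _) _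

theorem wn_coef_mtL2 {ℓ : ℝ} (hℓ : 0 < ℓ) (σ : ℝ) (k : ℤ) (a : ℂ) :
    wn σ (coef ℓ (a • mtL2 ℓ k)) = ‖a‖ₑ * ENNReal.ofReal (lam k ^ σ) := by
  rw [wn, tsum_eq_single k]
  · rw [coef_smul, Pi.smul_apply, coef_mtL2 hℓ, if_pos rfl, smul_eq_mul, mul_one, mul_comm]
  · intro j hj
    rw [coef_smul, Pi.smul_apply, coef_mtL2 hℓ, if_neg hj]
    simp

theorem wn_coef_sum_le {ℓ : ℝ} (hℓ : 0 < ℓ) (σ : ℝ) {ι : Type} (P : Finset ι) (a : ι → ℂ)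
    (k : ι → ℤ) : wn σ (coef ℓ (∑ p ∈ P, a p • mtL2 ℓ (k p)))
      ≤ ∑ p ∈ P, ‖a p‖ₑ * ENNReal.ofReal (lam (k p) ^ σ) := by
  classical
  induction P using Finset.induction_on with
  | empty =>
    have : coef ℓ (0 : L2C) = 0 := by
      ext j
      exact inner_zero_right _
    simp [this, wn]
  | insert p P hp ih =>
    rw [Finset.sum_insert hp, Finset.sum_insert hp, coef_add]
    exact (wn_add_le _ _ _).trans (add_le_add (wn_coef_mtL2 hℓ σ _ _).le ih)

theorem toL2_sum_mt {ℓ : ℝ} (hℓ : 0 < ℓ) {ι : Type} (P : Finset ι) (a : ι → ℂ) (k : ι → ℤ) :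
    toL2 (∑ p ∈ P, a p • mt ℓ (k p)) = ∑ p ∈ P, a p • mtL2 ℓ (k p) := by
  rw [toL2_finsetSum P fun p _ => (memLp_mt hℓ (k p)).const_smul (a p)]
  refine Finset.sum_congr rfl fun p _ => ?_
  rw [toL2_eq ((memLp_mt hℓ (k p)).const_smul (a p)), mtL2, toL2_eq (memLp_mt hℓ (k p))]
  exact MemLp.toLp_const_smul _ _

theorem enorm_le_wn {ℓ : ℝ} (hℓ : 0 < ℓ) (f : L2C) : ‖f‖ₑ ≤ wn 0 (coef ℓ f) := by
  have h := (hasSum_coef_smul hℓ f).tsum_eq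
  nth_rw 1 [← h]
  refine enorm_tsum_le_tsum_enorm.trans (le_of_eq ?_)
  rw [wn_zero]
  congr 1
  ext j
  rw [enorm_smul, ← ofReal_norm (mtL2 ℓ j), (orthonormal_mtL2 hℓ).1 j]
  simp

theorem ofReal_contRep_proj {ℓ : ℝ} (hℓ : 0 < ℓ) {n : ℕ} (hn : Odd n) (f : L2) (x : ℝ) :
    (contRep (proj ℓ n f) x : ℂ)
      = ∑ j ∈ (finite_lam_le n).toFinset, coef ℓ (complexify f) j * mt ℓ j x := by
  rw [ofReal_contRep hℓ (wn_proj_lt_top hℓ hn 0 f), coef_proj hℓ hn]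
  have h : ∀ j ∉ (finite_lam_le n).toFinset, trunc n (coef ℓ (complexify f)) j * mt ℓ j x = 0 := by
    intro j hj
    rw [Set.Finite.mem_toFinset, mem_ofPred_eq] at hj
    rw [trunc, if_neg hj, zero_mul]
  rw [tsum_eq_sum h]
  refine Finset.sum_congr rfl fun j hj => ?_
  rw [Set.Finite.mem_toFinset, mem_ofPred_eq] at hj
  rw [trunc, if_pos hj]

/-- The product of two square integrable functions, one of which is bounded. -/
def prodL2 (f g : L2) : L2 := toL2 fun x => f x * g x

theorem prodL2_comm (f g : L2) : prodL2 f g = prodL2 g f := by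
  rw [prodL2, prodL2]
  congr 1
  ext x
  ring

theorem abs_contRep_le {ℓ : ℝ} (hℓ : 0 < ℓ) {f : L2} (h : wn 0 (coef ℓ (complexify f)) < ⊤)
    (x : ℝ) : |contRep f x|
      ≤ √(2 * ℓ / Real.pi) / ℓ * (wn 0 (coef ℓ (complexify f))).toReal := by
  have h2 := ENNReal.toReal_mono (ENNReal.mul_lt_top h enorm_lt_top).ne (enorm_contRep_le hℓ h x)
  rw [ENNReal.toReal_mul, toReal_enorm, toReal_enorm, Real.norm_eq_abs] at h2
  rw [mul_comm]
  exact h2.trans (mul_le_mul_of_nonneg_left (norm_mt_le hℓ 0 x) ENNReal.toReal_nonneg)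

theorem ae_abs_mul_le {ℓ : ℝ} (hℓ : 0 < ℓ) {f : L2} (h : wn 0 (coef ℓ (complexify f)) < ⊤)
    (g : L2) : ∀ᵐ x, ‖f x * g x‖
      ≤ √(2 * ℓ / Real.pi) / ℓ * (wn 0 (coef ℓ (complexify f))).toReal * ‖g x‖ := by
  filter_upwards [coeFn_eq_contRep hℓ h] with x hx
  rw [norm_mul, hx]
  exact mul_le_mul_of_nonneg_right (abs_contRep_le hℓ h x) (norm_nonneg _)

theorem memLp_mul {ℓ : ℝ} (hℓ : 0 < ℓ) {f : L2} (h : wn 0 (coef ℓ (complexify f)) < ⊤)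
    (g : L2) : MemLp (fun x => f x * g x) 2 volume :=
  (Lp.memLp g).of_le_mul ((Lp.aestronglyMeasurable f).mul (Lp.aestronglyMeasurable g))
    (ae_abs_mul_le hℓ h g)

theorem enorm_prodL2_le {ℓ : ℝ} (hℓ : 0 < ℓ) {f : L2} (h : wn 0 (coef ℓ (complexify f)) < ⊤)
    (g : L2) : ‖prodL2 f g‖ₑ
      ≤ ENNReal.ofReal (√(2 * ℓ / Real.pi) / ℓ) * wn 0 (coef ℓ (complexify f)) * ‖g‖ₑ := by
  rw [prodL2, toL2_eq (memLp_mul hℓ h g), Lp.enorm_toLp, Lp.enorm_def]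
  refine (eLpNorm_le_mul_eLpNorm_of_ae_le_mul (ae_abs_mul_le hℓ h g) 2).trans (le_of_eq ?_)
  rw [ENNReal.ofReal_mul (by positivity), ENNReal.ofReal_toReal h.ne]

theorem prodL2_add {ℓ : ℝ} (hℓ : 0 < ℓ) {f : L2} (h : wn 0 (coef ℓ (complexify f)) < ⊤)
    (g g' : L2) : prodL2 f (g + g') = prodL2 f g + prodL2 f g' := by
  refine toL2_add (memLp_mul hℓ h g) (memLp_mul hℓ h g') ?_
  filter_upwards [Lp.coeFn_add g g'] with x hx
  rw [hx, Pi.add_apply, Pi.add_apply, mul_add]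

theorem prodL2_sub {ℓ : ℝ} (hℓ : 0 < ℓ) {f : L2} (h : wn 0 (coef ℓ (complexify f)) < ⊤)
    (g g' : L2) : prodL2 f (g - g') = prodL2 f g - prodL2 f g' := by
  have := prodL2_add hℓ h (g - g') g'
  rw [sub_add_cancel] at this
  rw [this, add_sub_cancel_right]

theorem prodL2_smul {ℓ : ℝ} (hℓ : 0 < ℓ) {f : L2} (h : wn 0 (coef ℓ (complexify f)) < ⊤)
    (a : ℝ) (g : L2) : prodL2 f (a • g) = a • prodL2 f g := by
  have e : (fun x => f x * (a • g : L2) x) =ᵐ[volume] a • fun x => f x * g x := by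
    filter_upwards [Lp.coeFn_smul a g] with x hx
    rw [hx, Pi.smul_apply, Pi.smul_apply, smul_eq_mul, smul_eq_mul]
    ring
  rw [prodL2, prodL2, toL2_congr e, toL2_eq ((memLp_mul hℓ h g).const_smul a),
    toL2_eq (memLp_mul hℓ h g)]
  exact MemLp.toLp_const_smul _ _

theorem contRep_prodL2 {ℓ : ℝ} (hℓ : 0 < ℓ) {f g : L2} (hf : wn 0 (coef ℓ (complexify f)) < ⊤)
    (hg : wn 0 (coef ℓ (complexify g)) < ⊤) :
    contRep (prodL2 f g) = contRep f * contRep g := by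
  refine contRep_eq_of_continuous ((continuous_contRep hℓ hf).mul (continuous_contRep hℓ hg)) ?_
  filter_upwards [coeFn_toL2 (memLp_mul hℓ hf g), coeFn_eq_contRep hℓ hf,
    coeFn_eq_contRep hℓ hg] with x h1 h2 h3
  rw [prodL2, h1, h2, h3, Pi.mul_apply]

theorem complexify_prodL2_proj {ℓ : ℝ} (hℓ : 0 < ℓ) {n : ℕ} (hn : Odd n) (f g : L2) :
    complexify (prodL2 (proj ℓ n f) (proj ℓ n g))
      = ∑ p ∈ (finite_lam_le n).toFinset ×ˢ (finite_lam_le n).toFinset ×ˢ ({0, 1} : Finset ℤ),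
        (((√(2 * ℓ / Real.pi) / (2 * ℓ) : ℝ) : ℂ) * (coef ℓ (complexify f) p.1
          * coef ℓ (complexify g) p.2.1)) • mtL2 ℓ (p.1 + p.2.1 + p.2.2) := by
  have hf := wn_proj_lt_top hℓ hn 0 f
  have hg := wn_proj_lt_top hℓ hn 0 g
  rw [← toL2_sum_mt hℓ _ (fun p : ℤ × ℤ × ℤ => ((√(2 * ℓ / Real.pi) / (2 * ℓ) : ℝ) : ℂ) *
    (coef ℓ (complexify f) p.1 * coef ℓ (complexify g) p.2.1)) (fun p => p.1 + p.2.1 + p.2.2),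
    ← toL2_coeFn (complexify (prodL2 (proj ℓ n f) (proj ℓ n g)))]
  refine toL2_congr ?_
  filter_upwards [coeFn_complexify (prodL2 (proj ℓ n f) (proj ℓ n g)),
    coeFn_toL2 (memLp_mul hℓ hf (proj ℓ n g)), coeFn_eq_contRep hℓ hf,
    coeFn_eq_contRep hℓ hg] with x h1 h2 h3 h4
  rw [h1, prodL2, h2, h3, h4, Complex.ofReal_mul, ofReal_contRep_proj hℓ hn,
    ofReal_contRep_proj hℓ hn, Finset.sum_mul_sum, Finset.sum_apply, Finset.sum_product]
  refine Finset.sum_congr rfl fun i _ => ?_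
  rw [Finset.sum_product]
  refine Finset.sum_congr rfl fun j _ => ?_
  rw [Finset.sum_pair zero_ne_one, mul_mul_mul_comm, mt_mul_mt hℓ]
  simp only [Pi.smul_apply, smul_eq_mul, add_zero]
  ring

/-- The product convolves the coefficients, up to a shift by `0` or `1`, and `lam (i + j + b) ≤ 3
lam i lam j` makes the weight submultiplicative. The factor `2` counts the two shifts. Only finite
sums occur, as both functions are projected first. -/
theorem wn_prodL2_proj_le {ℓ : ℝ} (hℓ : 0 < ℓ) {n : ℕ} (hn : Odd n) {σ : ℝ} (hσ : 0 ≤ σ)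
    (f g : L2) : wn σ (coef ℓ (complexify (prodL2 (proj ℓ n f) (proj ℓ n g))))
      ≤ ENNReal.ofReal (2 * (√(2 * ℓ / Real.pi) / (2 * ℓ) * 3 ^ σ))
        * (wn σ (coef ℓ (complexify f)) * wn σ (coef ℓ (complexify g))) := by
  rw [complexify_prodL2_proj hℓ hn]
  refine (wn_coef_sum_le hℓ σ _ _ _).trans ?_
  set W := (finite_lam_le n).toFinset
  set c := coef ℓ (complexify f)
  set d := coef ℓ (complexify g)
  set κ : ℝ := √(2 * ℓ / Real.pi) / (2 * ℓ) with hκ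
  have hκ0 : 0 ≤ κ := by positivity
  have h1 : ∀ p ∈ W ×ˢ W ×ˢ ({0, 1} : Finset ℤ),
      ‖(κ : ℂ) * (c p.1 * d p.2.1)‖ₑ * ENNReal.ofReal (lam (p.1 + p.2.1 + p.2.2) ^ σ)
      ≤ ENNReal.ofReal (κ * 3 ^ σ) * ((ENNReal.ofReal (lam p.1 ^ σ) * ‖c p.1‖ₑ)
        * (ENNReal.ofReal (lam p.2.1 ^ σ) * ‖d p.2.1‖ₑ)) := by
    intro p hp
    have hb : p.2.2 ∈ ({0, 1} : Finset ℤ) :=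
      (Finset.mem_product.1 (Finset.mem_product.1 hp).2).2
    have h2 : lam (p.1 + p.2.1 + p.2.2) ^ σ ≤ 3 ^ σ * (lam p.1 ^ σ * lam p.2.1 ^ σ) := by
      rw [← Real.mul_rpow (lam_pos _).le (lam_pos _).le, ← Real.mul_rpow (by norm_num)
        (mul_nonneg (lam_pos _).le (lam_pos _).le)]
      exact Real.rpow_le_rpow (lam_pos _).le (lam_add_le hb) hσ
    have h3 : ‖(κ : ℂ)‖ₑ = ENNReal.ofReal κ := by
      rw [← ofReal_norm, Complex.norm_real, Real.norm_of_nonneg hκ0]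
    rw [enorm_mul, enorm_mul, h3]
    refine (mul_le_mul_right (ENNReal.ofReal_le_ofReal h2) _).trans (le_of_eq ?_)
    rw [ENNReal.ofReal_mul hκ0, ENNReal.ofReal_mul (by positivity),
      ENNReal.ofReal_mul (lam_rpow_nonneg _ _)]
    ring
  refine (Finset.sum_le_sum h1).trans ?_
  rw [← Finset.mul_sum, Finset.sum_product]
  have h4 : ∀ i ∈ W, ∑ q ∈ W ×ˢ ({0, 1} : Finset ℤ), (ENNReal.ofReal (lam i ^ σ) * ‖c i‖ₑ)
        * (ENNReal.ofReal (lam q.1 ^ σ) * ‖d q.1‖ₑ)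
      = (ENNReal.ofReal (lam i ^ σ) * ‖c i‖ₑ) * (2 * ∑ j ∈ W, ENNReal.ofReal (lam j ^ σ) * ‖d j‖ₑ) := by
    intro i _
    rw [← Finset.mul_sum, Finset.sum_product]
    congr 1
    rw [Finset.mul_sum]
    refine Finset.sum_congr rfl fun j _ => ?_
    rw [Finset.sum_pair zero_ne_one, two_mul]
  rw [Finset.sum_congr rfl h4, ← Finset.sum_mul, ENNReal.ofReal_mul (by norm_num : (0 : ℝ) ≤ 2),
    ENNReal.ofReal_ofNat]
  have h5 : ∑ j ∈ W, ENNReal.ofReal (lam j ^ σ) * ‖c j‖ₑ ≤ wn σ c := ENNReal.sum_le_tsum W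
  have h6 : ∑ j ∈ W, ENNReal.ofReal (lam j ^ σ) * ‖d j‖ₑ ≤ wn σ d := ENNReal.sum_le_tsum W
  calc _ ≤ ENNReal.ofReal (κ * 3 ^ σ) * (wn σ c * (2 * wn σ d)) :=
        mul_le_mul_right (mul_le_mul' h5 (mul_le_mul_right h6 _)) _
    _ = _ := by ring

theorem proj_add (ℓ : ℝ) (n : ℕ) (f g : L2) : proj ℓ n (f + g) = proj ℓ n f + proj ℓ n g := by
  simp only [proj, inner_add_left, add_smul, Finset.sum_add_distrib]

theorem proj_smul (ℓ : ℝ) (n : ℕ) (a : ℝ) (f : L2) : proj ℓ n (a • f) = a • proj ℓ n f := by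
  simp only [proj, real_inner_smul_left, mul_smul, Finset.smul_sum]

theorem enorm_sub_proj_le {ℓ : ℝ} (hℓ : 0 < ℓ) {n : ℕ} (hn : Odd n) (f : L2) :
    ‖f - proj ℓ n f‖ₑ ≤ wn 0 (coef ℓ (complexify f) - trunc n (coef ℓ (complexify f))) := by
  rw [← enorm_complexify]
  refine (enorm_le_wn hℓ _).trans (le_of_eq ?_)
  rw [complexify_sub, coef_sub, coef_proj hℓ hn]

/-- The bilinear error of the nonlinear term. -/
def quadErr (ℓ : ℝ) (n : ℕ) (f g : L2) : L2 :=
  prodL2 f g - interp ℓ n (contRep (proj ℓ n f) * contRep (proj ℓ n g))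

theorem quadErr_comm (ℓ : ℝ) (n : ℕ) (f g : L2) : quadErr ℓ n f g = quadErr ℓ n g f := by
  rw [quadErr, quadErr, prodL2_comm, mul_comm (contRep _)]

theorem quadErr_self (ℓ : ℝ) (n : ℕ) (f : L2) :
    quadErr ℓ n f f = toL2 (fun x => f x ^ 2) - interpSq ℓ n (proj ℓ n f) := by
  rw [quadErr, prodL2, interpSq]
  congr 2
  · ext x
    ring
  · ext x
    rw [Pi.mul_apply]
    ring

theorem quadErr_add {ℓ : ℝ} (hℓ : 0 < ℓ) {n : ℕ} (hn : Odd n) {f : L2}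
    (h : wn 0 (coef ℓ (complexify f)) < ⊤) (g g' : L2) :
    quadErr ℓ n f (g + g') = quadErr ℓ n f g + quadErr ℓ n f g' := by
  rw [quadErr, quadErr, quadErr, prodL2_add hℓ h, proj_add, contRep_add hℓ
    (wn_proj_lt_top hℓ hn 0 g) (wn_proj_lt_top hℓ hn 0 g'), mul_add, interp_add hℓ hn]
  abel

theorem quadErr_smul {ℓ : ℝ} (hℓ : 0 < ℓ) {n : ℕ} (hn : Odd n) {f : L2}
    (h : wn 0 (coef ℓ (complexify f)) < ⊤) (a : ℝ) (g : L2) :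
    quadErr ℓ n f (a • g) = a • quadErr ℓ n f g := by
  rw [quadErr, quadErr, prodL2_smul hℓ h, proj_smul, contRep_smul hℓ _
    (wn_proj_lt_top hℓ hn 0 g), mul_smul_comm, interp_smul hℓ hn, smul_sub]

theorem enorm_quadErr_le {ℓ : ℝ} (hℓ : 0 < ℓ) {σ : ℝ} (hσ : 0 ≤ σ) : ∃ C : ℝ, 0 ≤ C ∧
    ∀ n : ℕ, Odd n → ∀ f g : L2, wn σ (coef ℓ (complexify f)) < ⊤ →
      wn σ (coef ℓ (complexify g)) < ⊤ →
      ‖quadErr ℓ n f g‖ₑ ≤ ENNReal.ofReal (C * (n : ℝ) ^ (-σ))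
        * (wn σ (coef ℓ (complexify f)) * wn σ (coef ℓ (complexify g))) := by
  set κ : ℝ := √(2 * ℓ / Real.pi) / ℓ
  set κ' : ℝ := 2 * (√(2 * ℓ / Real.pi) / (2 * ℓ) * 3 ^ σ)
  have hκ : 0 ≤ κ := by positivity
  have hκ' : 0 ≤ κ' := by positivity
  refine ⟨2 * κ + 2 * κ', by positivity, fun n hn f g hf hg => ?_⟩
  have hn1 : 1 ≤ n := hn.pos
  have hf0 := (wn_mono_exponent hσ _).trans_lt hf
  have hg0 := (wn_mono_exponent hσ _).trans_lt hg
  have hPf := wn_proj_lt_top hℓ hn 0 f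
  have hPg := wn_proj_lt_top hℓ hn 0 g
  set c := coef ℓ (complexify f)
  set d := coef ℓ (complexify g)
  set w := prodL2 (proj ℓ n f) (proj ℓ n g) with hw
  have hwn := wn_prodL2_proj_le hℓ hn hσ f g
  have hwfin : wn σ (coef ℓ (complexify w)) < ⊤ :=
    hwn.trans_lt (ENNReal.mul_lt_top ENNReal.ofReal_lt_top (ENNReal.mul_lt_top hf hg))
  have hw0 := (wn_mono_exponent hσ _).trans_lt hwfin
  -- With `w` the product of the projections, the error splits into two errors of replacing a factor
  -- by its projection, the projection error of `w`, and the aliasing error of `w`.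
  have e : quadErr ℓ n f g = prodL2 f (g - proj ℓ n g) + prodL2 (proj ℓ n g) (f - proj ℓ n f)
      + (w - proj ℓ n w) + (proj ℓ n w - interp ℓ n (contRep w)) := by
    rw [quadErr, prodL2_sub hℓ hf0, prodL2_sub hℓ hPg, prodL2_comm (proj ℓ n g) f,
      prodL2_comm (proj ℓ n g) (proj ℓ n f), ← hw, hw, contRep_prodL2 hℓ hPf hPg]
    abel
  set N := ENNReal.ofReal ((n : ℝ) ^ (-σ))
  have b1 : ‖prodL2 f (g - proj ℓ n g)‖ₑ ≤ ENNReal.ofReal κ * N * (wn σ c * wn σ d) := by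
    calc _ ≤ ENNReal.ofReal κ * wn σ c * (N * wn σ d) :=
          (enorm_prodL2_le hℓ hf0 _).trans (mul_le_mul' (mul_le_mul_right
            (wn_mono_exponent hσ c) _) ((enorm_sub_proj_le hℓ hn g).trans
              (wn_sub_trunc_le hσ hn1 d)))
      _ = _ := by ring
  have b2 : ‖prodL2 (proj ℓ n g) (f - proj ℓ n f)‖ₑ
      ≤ ENNReal.ofReal κ * N * (wn σ c * wn σ d) := by
    have h1 : wn 0 (coef ℓ (complexify (proj ℓ n g))) ≤ wn σ d := by
      rw [coef_proj hℓ hn]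
      exact (wn_mono (norm_trunc_le n d)).trans (wn_mono_exponent hσ d)
    calc _ ≤ ENNReal.ofReal κ * wn σ d * (N * wn σ c) :=
          (enorm_prodL2_le hℓ hPg _).trans (mul_le_mul' (mul_le_mul_right h1 _)
            ((enorm_sub_proj_le hℓ hn f).trans (wn_sub_trunc_le hσ hn1 c)))
      _ = _ := by ring
  have b0 : wn 0 (coef ℓ (complexify w) - trunc n (coef ℓ (complexify w)))
      ≤ ENNReal.ofReal κ' * N * (wn σ c * wn σ d) := by
    calc _ ≤ N * (ENNReal.ofReal κ' * (wn σ c * wn σ d)) :=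
          (wn_sub_trunc_le hσ hn1 _).trans (mul_le_mul_right hwn _)
      _ = _ := by ring
  have b3 := (enorm_sub_proj_le hℓ hn w).trans b0
  have b4 := (enorm_proj_sub_interp_le hℓ hn hw0).trans b0
  rw [e]
  refine (enorm_add_le _ _).trans ((add_le_add ((enorm_add_le _ _).trans (add_le_add
    ((enorm_add_le _ _).trans (add_le_add b1 b2)) b3)) b4).trans (le_of_eq ?_))
  have e2 : ENNReal.ofReal ((2 * κ + 2 * κ') * (n : ℝ) ^ (-σ))
      = (2 * ENNReal.ofReal κ + 2 * ENNReal.ofReal κ') * N := by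
    rw [ENNReal.ofReal_mul (by positivity), ENNReal.ofReal_add (by positivity) (by positivity),
      ENNReal.ofReal_mul two_pos.le, ENNReal.ofReal_mul two_pos.le, ENNReal.ofReal_ofNat]
  rw [e2]
  ring

/-! ### The consistency error as a polynomial map on the weighted Sobolev space -/

theorem dseq_add (ℓ : ℝ) (c d : ℤ → ℂ) : dseq ℓ (c + d) = dseq ℓ c + dseq ℓ d := by
  ext k
  simp only [dseq, Pi.add_apply]
  ring

theorem dseq_smul (ℓ : ℝ) (a : ℂ) (c : ℤ → ℂ) : dseq ℓ (a • c) = a • dseq ℓ c := by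
  ext k
  simp only [dseq, Pi.smul_apply, smul_eq_mul]
  ring

theorem dseq_neg (ℓ : ℝ) (c : ℤ → ℂ) : dseq ℓ (-c) = -dseq ℓ c := by
  ext k
  simp only [dseq, Pi.neg_apply]
  ring

theorem trunc_neg (n : ℕ) (c : ℤ → ℂ) : trunc n (-c) = -trunc n c := by
  ext j
  simp only [trunc, Pi.neg_apply]
  split_ifs <;> simp

theorem trunc_trunc (n : ℕ) (c : ℤ → ℂ) : trunc n (trunc n c) = trunc n c := by
  ext j
  simp only [trunc]
  split_ifs <;> rfl

theorem sn_smul (σ : ℝ) (a : ℂ) (c : ℤ → ℂ) : sn σ (a • c) ≤ ENNReal.ofReal ‖a‖ * sn σ c := by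
  refine sn_le_mul fun j => le_of_eq ?_
  rw [Pi.smul_apply, norm_smul]
  ring

theorem dx_add {ℓ : ℝ} (hℓ : 0 < ℓ) {u v : L2} (hu : sn 1 (coef ℓ (complexify u)) < ⊤)
    (hv : sn 1 (coef ℓ (complexify v)) < ⊤) : dx (u + v) = dx u + dx v := by
  refine complexify_injective (coef_injective hℓ ?_)
  have h : sn 1 (coef ℓ (complexify (u + v))) < ⊤ := by
    rw [complexify_add, coef_add]
    exact (sn_add_le 1 _ _).trans_lt (ENNReal.add_lt_top.2 ⟨hu, hv⟩)
  rw [complexify_add, coef_add, coef_dx hℓ h, coef_dx hℓ hu, coef_dx hℓ hv, complexify_add,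
    coef_add, dseq_add]

theorem dx_smul {ℓ : ℝ} (hℓ : 0 < ℓ) (a : ℝ) {u : L2} (hu : sn 1 (coef ℓ (complexify u)) < ⊤) :
    dx (a • u) = a • dx u := by
  refine complexify_injective (coef_injective hℓ ?_)
  have h : sn 1 (coef ℓ (complexify (a • u))) < ⊤ := by
    rw [complexify_smul, coef_smul]
    exact (sn_smul 1 _ _).trans_lt (ENNReal.mul_lt_top ENNReal.ofReal_lt_top hu)
  rw [complexify_smul, coef_smul, coef_dx hℓ h, coef_dx hℓ hu, complexify_smul, coef_smul,
    dseq_smul]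

theorem sn_proj_lt_top {ℓ : ℝ} (hℓ : 0 < ℓ) {n : ℕ} (hn : Odd n) (σ : ℝ) (u : L2) :
    sn σ (coef ℓ (complexify (proj ℓ n u))) < ⊤ := by
  rw [coef_proj hℓ hn]
  exact sn_trunc_lt_top σ n (sn_coef_lt_top hℓ _)

theorem autJ_add {ℓ : ℝ} (hℓ : 0 < ℓ) {n : ℕ} (hn : Odd n) (u v : L2) :
    autJ ℓ n (u + v) = autJ ℓ n u + autJ ℓ n v := by
  rw [autJ, autJ, autJ, proj_add, dx_add hℓ (sn_proj_lt_top hℓ hn 1 u) (sn_proj_lt_top hℓ hn 1 v),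
    proj_add]
  abel

theorem autJ_smul {ℓ : ℝ} (hℓ : 0 < ℓ) {n : ℕ} (hn : Odd n) (a : ℝ) (u : L2) :
    autJ ℓ n (a • u) = a • autJ ℓ n u := by
  rw [autJ, autJ, proj_smul, dx_smul hℓ a (sn_proj_lt_top hℓ hn 1 u), proj_smul, smul_neg]

/-- The linear part of the consistency error. -/
def linErr (ℓ : ℝ) (n : ℕ) (α β γ : ℝ) (w : L2) : L2 :=
  α • (w - proj ℓ n w) + β • hilbert (dx w + autJ ℓ n w)
    - γ • (dx (dx w) - autJ ℓ n (autJ ℓ n w))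

theorem hilbert_add (f g : L2) : hilbert (f + g) = hilbert f + hilbert g := map_add hilbertL f g

theorem hilbert_smul (a : ℝ) (f : L2) : hilbert (a • f) = a • hilbert f := map_smul hilbertL a f

theorem sn_dx_lt_top {ℓ : ℝ} (hℓ : 0 < ℓ) {u : L2} (hu : sn 2 (coef ℓ (complexify u)) < ⊤) :
    sn 1 (coef ℓ (complexify (dx u))) < ⊤ := by
  rw [coef_dx hℓ ((sn_mono_exponent (by norm_num) _).trans_lt hu)]
  refine (sn_dseq_le hℓ zero_le_one _).trans_lt ?_
  rw [one_add_one_eq_two]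
  exact ENNReal.mul_lt_top ENNReal.ofReal_lt_top hu

theorem linErr_add {ℓ : ℝ} (hℓ : 0 < ℓ) {n : ℕ} (hn : Odd n) (α β γ : ℝ) {u v : L2}
    (hu : sn 2 (coef ℓ (complexify u)) < ⊤) (hv : sn 2 (coef ℓ (complexify v)) < ⊤) :
    linErr ℓ n α β γ (u + v) = linErr ℓ n α β γ u + linErr ℓ n α β γ v := by
  have h1 := dx_add hℓ ((sn_mono_exponent (by norm_num) _).trans_lt hu)
    ((sn_mono_exponent (by norm_num) _).trans_lt hv)
  have h2 := dx_add hℓ (sn_dx_lt_top hℓ hu) (sn_dx_lt_top hℓ hv)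
  rw [linErr, linErr, linErr, h1, h2, proj_add, autJ_add hℓ hn, autJ_add hℓ hn,
    show dx u + dx v + (autJ ℓ n u + autJ ℓ n v) = (dx u + autJ ℓ n u) + (dx v + autJ ℓ n v) by
      abel, hilbert_add]
  module

theorem linErr_smul {ℓ : ℝ} (hℓ : 0 < ℓ) {n : ℕ} (hn : Odd n) (α β γ a : ℝ) {u : L2}
    (hu : sn 2 (coef ℓ (complexify u)) < ⊤) :
    linErr ℓ n α β γ (a • u) = a • linErr ℓ n α β γ u := by
  have h1 := dx_smul hℓ a ((sn_mono_exponent (by norm_num) _).trans_lt hu)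
  have h2 := dx_smul hℓ a (sn_dx_lt_top hℓ hu)
  rw [linErr, linErr, h1, h2, proj_smul, autJ_smul hℓ hn, autJ_smul hℓ hn, ← smul_add,
    hilbert_smul]
  module

theorem enorm_eq_sn {ℓ : ℝ} (hℓ : 0 < ℓ) (f : L2) : ‖f‖ₑ = sn 0 (coef ℓ (complexify f)) := by
  rw [sn_coef_zero hℓ, enorm_complexify]

theorem enorm_hilbert_le (f : L2) : ‖hilbert f‖ₑ ≤ ‖f‖ₑ :=
  enorm_le_iff_norm_le.2 (norm_hilbert_le f)

/-- The three parts lose no, one and two derivatives, so they are of size `n^(-s)`, `n^(1-s)` and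
`n^(2-s)`; the last dominates as `n ≥ 1`. The Hilbert transform is a contraction. -/
theorem enorm_linErr_le {ℓ : ℝ} (hℓ : 0 < ℓ) (α β γ : ℝ) {s : ℝ} (hs : 2 ≤ s) :
    ∃ C : ℝ, 0 ≤ C ∧ ∀ n : ℕ, Odd n → ∀ u : L2, sn s (coef ℓ (complexify u)) < ⊤ →
      ‖linErr ℓ n α β γ u‖ₑ
        ≤ ENNReal.ofReal (C * (n : ℝ) ^ (2 - s)) * sn s (coef ℓ (complexify u)) := by
  refine ⟨|α| + |β| * (2 * (3 ^ s / ℓ)) + |γ| * (3 * ((3 ^ s / ℓ) * (3 ^ s / ℓ))), by positivity,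
    fun n hn u hu => ?_⟩
  have hn1 : 1 ≤ n := hn.pos
  have hn1' : (1 : ℝ) ≤ n := by exact_mod_cast hn1
  have h2 := (sn_mono_exponent hs _).trans_lt hu
  have h1 : sn 1 (coef ℓ (complexify u)) < ⊤ := (sn_mono_exponent (by norm_num) _).trans_lt h2
  have hc1 := coef_dx hℓ h1
  have hc2 := coef_dx hℓ (sn_dx_lt_top hℓ h2)
  rw [hc1] at hc2
  set c := coef ℓ (complexify u)
  have b1 : ‖u - proj ℓ n u‖ₑ ≤ ENNReal.ofReal ((n : ℝ) ^ (2 - s)) * sn s c := by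
    rw [enorm_eq_sn hℓ, complexify_sub, coef_sub, coef_proj hℓ hn]
    refine (sn_sub_trunc_le (by linarith) hn1 c).trans (mul_le_mul_left ?_ _)
    exact ENNReal.ofReal_le_ofReal (Real.rpow_le_rpow_of_exponent_le hn1' (by linarith))
  have b2 : ‖hilbert (dx u + autJ ℓ n u)‖ₑ
      ≤ ENNReal.ofReal (2 * (3 ^ s / ℓ) * (n : ℝ) ^ (2 - s)) * sn s c := by
    refine (enorm_hilbert_le _).trans ?_
    rw [enorm_eq_sn hℓ, complexify_add, coef_add, hc1, coef_autJ hℓ hn, ← sub_eq_add_neg]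
    refine (sn_dseq_sub_trunc_le hℓ (by linarith) hn1 c).trans (mul_le_mul_left ?_ _)
    refine ENNReal.ofReal_le_ofReal (mul_le_mul_of_nonneg_left ?_ (by positivity))
    exact Real.rpow_le_rpow_of_exponent_le hn1' (by linarith)
  have b3 : ‖dx (dx u) - autJ ℓ n (autJ ℓ n u)‖ₑ
      ≤ ENNReal.ofReal (3 * ((3 ^ s / ℓ) * (3 ^ s / ℓ)) * (n : ℝ) ^ (2 - s)) * sn s c := by
    -- The two minus signs in the square of `autJ` cancel, and the adjacent truncations merge into
    -- one.
    rw [enorm_eq_sn hℓ, complexify_sub, coef_sub, hc2, coef_autJ hℓ hn, coef_autJ hℓ hn, trunc_neg,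
      dseq_neg, trunc_neg, neg_neg, trunc_trunc]
    exact sn_dseq_dseq_sub_trunc_le hℓ hs hn1 c
  have es : ∀ (a : ℝ) (f : L2), ‖a • f‖ₑ = ENNReal.ofReal |a| * ‖f‖ₑ := fun a f => by
    rw [enorm_smul, Real.enorm_eq_ofReal_abs]
  rw [linErr, sub_eq_add_neg]
  refine (enorm_add_le _ _).trans ((add_le_add ((enorm_add_le _ _)) le_rfl).trans ?_)
  rw [enorm_neg, es, es, es]
  refine (add_le_add (add_le_add (mul_le_mul_right b1 _) (mul_le_mul_right b2 _))
    (mul_le_mul_right b3 _)).trans (le_of_eq ?_)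
  have hp : (0 : ℝ) ≤ (n : ℝ) ^ (2 - s) := by positivity
  rw [← mul_assoc, ← mul_assoc, ← mul_assoc, ← add_mul, ← add_mul,
    ← ENNReal.ofReal_mul (abs_nonneg _), ← ENNReal.ofReal_mul (abs_nonneg _),
    ← ENNReal.ofReal_mul (abs_nonneg _), ← ENNReal.ofReal_add (by positivity) (by positivity),
    ← ENNReal.ofReal_add (by positivity) (by positivity)]
  congr 2
  ring

theorem exists_sn_le {ℓ : ℝ} (hℓ : 0 < ℓ) {s : ℝ} (hs : 2 ≤ s) : ∃ C : ℝ, 0 ≤ C ∧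
    ∀ u : WSob s (2 * s), sn s (coef ℓ (complexify u.incl)) ≤ ENNReal.ofReal (C * ‖u‖) := by
  obtain ⟨C, hC, h⟩ := exists_bound_coef hℓ hs
  exact ⟨C, hC, fun u => sn_le_of_sum_le (by positivity) (h u)⟩

theorem exists_wn_le {ℓ : ℝ} (hℓ : 0 < ℓ) {s : ℝ} (hs : 2 ≤ s) : ∃ C : ℝ, 0 ≤ C ∧
    ∀ u : WSob s (2 * s), wn (s - 1) (coef ℓ (complexify u.incl)) ≤ ENNReal.ofReal (C * ‖u‖) := by
  obtain ⟨C, hC, h⟩ := exists_sn_le hℓ hs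
  obtain ⟨C', hC', h'⟩ := exists_wn_le_sn
  refine ⟨C' * C, by positivity, fun u => (h' s _).trans ?_⟩
  rw [mul_assoc, ENNReal.ofReal_mul hC']
  exact mul_le_mul_right (h u) _

theorem norm_le_of_enorm_le {E : Type*} [NormedAddCommGroup E] {x : E} {K : ℝ} (hK : 0 ≤ K)
    (h : ‖x‖ₑ ≤ ENNReal.ofReal K) : ‖x‖ ≤ K := by
  rwa [← ofReal_norm, ENNReal.ofReal_le_ofReal_iff hK] at h

/-- The linear part of the consistency error is a small operator. -/
theorem exists_linOp {ℓ : ℝ} (hℓ : 0 < ℓ) (α β γ : ℝ) {s : ℝ} (hs : 2 ≤ s) :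
    ∃ C : ℝ, 0 ≤ C ∧ ∀ n : ℕ, Odd n → ∃ L : WSob s (2 * s) →L[ℝ] L2,
      (∀ u, L u = linErr ℓ n α β γ u.incl) ∧ ‖L‖ ≤ C * (n : ℝ) ^ (2 - s) := by
  obtain ⟨C, hC, h⟩ := exists_sn_le hℓ hs
  obtain ⟨C', hC', h'⟩ := enorm_linErr_le hℓ α β γ hs
  refine ⟨C' * C, by positivity, fun n hn => ?_⟩
  have hfin : ∀ u : WSob s (2 * s), sn s (coef ℓ (complexify u.incl)) < ⊤ := fun u =>
    (h u).trans_lt ENNReal.ofReal_lt_top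
  have hfin2 : ∀ u : WSob s (2 * s), sn 2 (coef ℓ (complexify u.incl)) < ⊤ := fun u =>
    (sn_mono_exponent hs _).trans_lt (hfin u)
  let L0 : WSob s (2 * s) →ₗ[ℝ] L2 :=
    { toFun := fun u => linErr ℓ n α β γ u.incl
      map_add' := fun u v => linErr_add hℓ hn α β γ (hfin2 u) (hfin2 v)
      map_smul' := fun a u => linErr_smul hℓ hn α β γ a (hfin2 u) }
  have hb : ∀ u, ‖L0 u‖ ≤ C' * C * (n : ℝ) ^ (2 - s) * ‖u‖ := by
    intro u
    refine norm_le_of_enorm_le (by positivity) ((h' n hn u.incl (hfin u)).trans ?_)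
    rw [show C' * C * (n : ℝ) ^ (2 - s) * ‖u‖ = C' * (n : ℝ) ^ (2 - s) * (C * ‖u‖) by ring,
      ENNReal.ofReal_mul (by positivity : 0 ≤ C' * (n : ℝ) ^ (2 - s))]
    exact mul_le_mul_right (h u) _
  exact ⟨L0.mkContinuous _ hb, fun u => rfl,
    LinearMap.mkContinuous_norm_le _ (by positivity) _⟩

/-- The quadratic part of the consistency error is a small bilinear map. -/
theorem exists_quadOp {ℓ : ℝ} (hℓ : 0 < ℓ) {s : ℝ} (hs : 2 ≤ s) :
    ∃ C : ℝ, 0 ≤ C ∧ ∀ n : ℕ, Odd n → ∃ B : WSob s (2 * s) →L[ℝ] WSob s (2 * s) →L[ℝ] L2,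
      (∀ u v, B u v = quadErr ℓ n u.incl v.incl) ∧ ‖B‖ ≤ C * (n : ℝ) ^ (2 - s) := by
  obtain ⟨C, hC, h⟩ := exists_wn_le hℓ hs
  have hs1 : 0 ≤ s - 1 := by linarith
  obtain ⟨C', hC', h'⟩ := enorm_quadErr_le hℓ hs1
  refine ⟨C' * (C * C), by positivity, fun n hn => ?_⟩
  have hn1' : (1 : ℝ) ≤ n := by exact_mod_cast hn.pos
  have hfin : ∀ u : WSob s (2 * s), wn (s - 1) (coef ℓ (complexify u.incl)) < ⊤ := fun u =>
    (h u).trans_lt ENNReal.ofReal_lt_top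
  have hfin0 : ∀ u : WSob s (2 * s), wn 0 (coef ℓ (complexify u.incl)) < ⊤ := fun u =>
    (wn_mono_exponent hs1 _).trans_lt (hfin u)
  let B0 : WSob s (2 * s) →ₗ[ℝ] WSob s (2 * s) →ₗ[ℝ] L2 :=
    LinearMap.mk₂ ℝ (fun u v => quadErr ℓ n u.incl v.incl)
      (fun u u' v => by
        rw [quadErr_comm ℓ n _ v.incl, quadErr_comm ℓ n _ v.incl, quadErr_comm ℓ n _ v.incl]
        exact quadErr_add hℓ hn (hfin0 v) u.incl u'.incl)
      (fun a u v => by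
        rw [quadErr_comm ℓ n _ v.incl, quadErr_comm ℓ n _ v.incl]
        exact quadErr_smul hℓ hn (hfin0 v) a u.incl)
      (fun u v v' => quadErr_add hℓ hn (hfin0 u) v.incl v'.incl)
      (fun a u v => quadErr_smul hℓ hn (hfin0 u) a v.incl)
  have hb : ∀ u v, ‖B0 u v‖ ≤ C' * (C * C) * (n : ℝ) ^ (2 - s) * ‖u‖ * ‖v‖ := by
    intro u v
    refine norm_le_of_enorm_le (by positivity)
      ((h' n hn u.incl v.incl (hfin u) (hfin v)).trans ?_)
    rw [show C' * (C * C) * (n : ℝ) ^ (2 - s) * ‖u‖ * ‖v‖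
        = C' * (n : ℝ) ^ (2 - s) * ((C * ‖u‖) * (C * ‖v‖)) by ring,
      ENNReal.ofReal_mul (by positivity : 0 ≤ C' * (n : ℝ) ^ (2 - s)),
      ENNReal.ofReal_mul (by positivity : 0 ≤ C * ‖u‖)]
    -- The quadratic error is of the better size `n^(-(s-1))`, which is relaxed to the rate
    -- `n^(2-s)` of the linear part.
    refine mul_le_mul' (ENNReal.ofReal_le_ofReal ?_) (mul_le_mul' (h u) (h v))
    refine mul_le_mul_of_nonneg_left ?_ hC'
    exact Real.rpow_le_rpow_of_exponent_le hn1' (by linarith)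
  exact ⟨B0.mkContinuous₂ _ hb, fun u v => rfl,
    LinearMap.mkContinuous₂_norm_le _ (by positivity) _⟩

/-! ### The gradient as the consistency error -/

theorem gradient_inner_left {F : Type*} [NormedAddCommGroup F] [InnerProductSpace ℝ F]
    [CompleteSpace F] (g e : F) : ∇ (fun e : F => inner ℝ e g) e = g := by
  refine HasGradientAt.gradient ?_
  rw [hasGradientAt_iff_hasFDerivAt]
  have : (fun e : F => inner ℝ e g) = fun e => (InnerProductSpace.toDual ℝ F g) e := by
    ext e
    rw [InnerProductSpace.toDual_apply_apply, real_inner_comm]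
  rw [this]
  exact (InnerProductSpace.toDual ℝ F g).hasFDerivAt

theorem funD_eq (ℓ : ℝ) (n : ℕ) (α β γ δ : ℝ) (w : L2) : funD ℓ n α β γ δ w
    = fun e => inner ℝ e (linErr ℓ n α β γ w + δ • quadErr ℓ n w w) := by
  ext e
  rw [funD, linErr, quadErr_self]

theorem gradient_funD (ℓ : ℝ) (n : ℕ) (α β γ δ : ℝ) (w e : L2) :
    ∇ (funD ℓ n α β γ δ w) e = linErr ℓ n α β γ w + δ • quadErr ℓ n w w := by
  rw [funD_eq, gradient_inner_left]

/-! ### Curves -/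

section Curves

variable {E F : Type*} [NormedAddCommGroup E] [NormedSpace ℝ E] [NormedAddCommGroup F]
  [NormedSpace ℝ F]

theorem lipschitzOnWith_integral {T K : ℝ} (hK : 0 ≤ K) {v : ℝ → F}
    (hi : IntegrableOn v (Icc 0 T)) (hv : ∀ᵐ t ∂volume.restrict (Icc 0 T), ‖v t‖ ≤ K) :
    LipschitzOnWith (Real.toNNReal K) (fun t => ∫ τ in (0 : ℝ)..t, v τ) (Icc 0 T) := by
  refine LipschitzOnWith.of_dist_le_mul fun x hx y hy => ?_
  rw [Real.coe_toNNReal K hK, dist_eq_norm, dist_eq_norm]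
  have hInt : ∀ z ∈ Icc 0 T, IntervalIntegrable v volume 0 z := fun z hz =>
    (intervalIntegrable_iff_integrableOn_Icc_of_le hz.1).2
      (hi.mono_set (Icc_subset_Icc le_rfl hz.2))
  rw [intervalIntegral.integral_interval_sub_left (hInt x hx) (hInt y hy)]
  refine intervalIntegral.norm_integral_le_of_norm_le_const_ae ?_
  rw [ae_restrict_iff' measurableSet_Icc] at hv
  filter_upwards [hv] with t ht h
  refine ht ?_
  have := uIoc_subset_uIcc h
  rw [uIcc_comm] at this
  exact (uIcc_subset_Icc hx hy) this

theorem hasDerivAt_quad (B : E →L[ℝ] E →L[ℝ] F) (hB : ∀ x y, B x y = B y x) {V : ℝ → E} {v : E}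
    {t : ℝ} (h : HasDerivAt V v t) : HasDerivAt (fun t => B (V t) (V t)) ((2 : ℝ) • B (V t) v) t := by
  have h1 : HasDerivAt (fun t => B (V t)) (B v) t := B.hasFDerivAt.comp_hasDerivAt t h
  have h2 := h1.clm_apply h
  refine h2.congr_deriv ?_
  rw [hB v, two_smul]

/-- The integrated product rule. -/
theorem quad_integral [CompleteSpace E] [CompleteSpace F] (B : E →L[ℝ] E →L[ℝ] F) (hB : ∀ x y, B x y = B y x) {T : ℝ} (hT : 0 < T)
    {u v : ℝ → E} (hv : MemLp v ⊤ (volume.restrict (Icc 0 T)))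
    (hu : ∀ t ∈ Icc 0 T, u t = u 0 + ∫ τ in (0 : ℝ)..t, v τ) :
    IntegrableOn (fun t => (2 : ℝ) • B (u t) (v t)) (Icc 0 T) ∧
      ∀ t ∈ Icc 0 T, B (u t) (u t) = B (u 0) (u 0) + ∫ τ in (0 : ℝ)..t, (2 : ℝ) • B (u τ) (v τ) := by
  have hfin : IsFiniteMeasure (volume.restrict (Icc (0 : ℝ) T)) :=
    ⟨by rw [Measure.restrict_apply_univ]; exact measure_Icc_lt_top⟩
  have hi : IntegrableOn v (Icc 0 T) := hv.integrable le_top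
  obtain ⟨K, hK0, hK⟩ : ∃ K : ℝ, 0 ≤ K ∧ ∀ᵐ t ∂volume.restrict (Icc 0 T), ‖v t‖ ≤ K := by
    refine ⟨(eLpNorm v ⊤ (volume.restrict (Icc 0 T))).toReal, ENNReal.toReal_nonneg, ?_⟩
    filter_upwards [ae_le_eLpNormEssSup (f := v) (μ := volume.restrict (Icc 0 T))] with t ht
    rw [← eLpNorm_exponent_top] at ht
    rw [← toReal_enorm]
    exact ENNReal.toReal_mono hv.2.ne ht
  -- The curve `u` is constrained only on `[0, T]`; `V` agrees with it there and is defined by the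
  -- integral at all times, so that two-sided derivatives are available almost everywhere.
  set V : ℝ → E := fun t => u 0 + ∫ τ in (0 : ℝ)..t, v τ with hVdef
  have hVu : ∀ t ∈ Icc 0 T, u t = V t := hu
  have h0 : (0 : ℝ) ∈ Icc 0 T := ⟨le_rfl, hT.le⟩
  have hVL : LipschitzOnWith (Real.toNNReal K) V (Icc 0 T) := by
    have h := lipschitzOnWith_integral hK0 hi hK
    refine LipschitzOnWith.of_dist_le_mul fun x hx y hy => ?_
    rw [hVdef]
    simp only [dist_add_left]
    exact h.dist_le_mul x hx y hy
  set M : ℝ := ‖u 0‖ + K * T with hM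
  have hM0 : 0 ≤ M := by positivity
  have hVb : ∀ t ∈ Icc 0 T, ‖V t‖ ≤ M := by
    intro t ht
    have h1 := hVL.dist_le_mul t ht 0 h0
    rw [Real.coe_toNNReal K hK0, dist_eq_norm, dist_eq_norm, sub_zero, Real.norm_of_nonneg ht.1] at h1
    have e : V 0 = u 0 := by simp [hVdef]
    rw [e] at h1
    have h2 : ‖V t‖ ≤ ‖V t - u 0‖ + ‖u 0‖ := by
      simpa using norm_add_le (V t - u 0) (u 0)
    have h3 : K * t ≤ K * T := mul_le_mul_of_nonneg_left ht.2 hK0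
    linarith
  have hmeas : AEStronglyMeasurable V (volume.restrict (Icc 0 T)) :=
    hVL.continuousOn.aestronglyMeasurable measurableSet_Icc
  set w : ℝ → F := fun t => (2 : ℝ) • B (V t) (v t) with hw
  have hwm : AEStronglyMeasurable w (volume.restrict (Icc 0 T)) := by
    exact (B.aestronglyMeasurable_comp₂ hmeas hv.1).const_smul _
  have hwb : ∀ᵐ t ∂volume.restrict (Icc 0 T), ‖w t‖ ≤ 2 * (‖B‖ * M * K) := by
    filter_upwards [hK, ae_restrict_mem measurableSet_Icc] with t h1 h2
    rw [hw]
    simp only [norm_smul, Real.norm_ofNat]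
    refine mul_le_mul_of_nonneg_left ((B.le_opNorm₂ _ _).trans ?_) two_pos.le
    exact mul_le_mul (mul_le_mul_of_nonneg_left (hVb t h2) (norm_nonneg B)) h1 (norm_nonneg _)
      (by positivity)
  have hwi : IntegrableOn w (Icc 0 T) := Integrable.of_bound hwm _ hwb
  have hQL : LipschitzOnWith (Real.toNNReal (2 * (‖B‖ * M * K))) (fun t => B (V t) (V t))
      (Icc 0 T) := by
    refine LipschitzOnWith.of_dist_le_mul fun x hx y hy => ?_
    rw [Real.coe_toNNReal _ (by positivity), dist_eq_norm]
    have e : B (V x) (V x) - B (V y) (V y) = B (V x) (V x - V y) + B (V x - V y) (V y) := by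
      simp only [map_sub, sub_apply]
      abel
    have h1 : ‖V x - V y‖ ≤ K * dist x y := by
      have := hVL.dist_le_mul x hx y hy
      rwa [Real.coe_toNNReal K hK0, dist_eq_norm] at this
    have hd : 0 ≤ dist x y := dist_nonneg
    rw [e]
    refine (norm_add_le _ _).trans ((add_le_add (B.le_opNorm₂ _ _) (B.le_opNorm₂ _ _)).trans ?_)
    calc _ ≤ ‖B‖ * M * (K * dist x y) + ‖B‖ * (K * dist x y) * M := by
          have a1 := mul_le_mul (mul_le_mul_of_nonneg_left (hVb x hx) (norm_nonneg B)) h1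
            (norm_nonneg _) (by positivity)
          have a2 := mul_le_mul (mul_le_mul_of_nonneg_left h1 (norm_nonneg B)) (hVb y hy)
            (norm_nonneg _) (by positivity)
          exact add_le_add a1 a2
      _ = _ := by ring
  have hIcc : uIcc (0 : ℝ) T = Icc 0 T := uIcc_of_le hT.le
  -- Both terms are Lipschitz because `v` is essentially bounded. Their difference is absolutely
  -- continuous with derivative zero almost everywhere, hence constant.
  have hac : AbsolutelyContinuousOnInterval
      ((fun t => B (V t) (V t)) - fun t => ∫ τ in (0 : ℝ)..t, w τ) 0 T := by
    refine AbsolutelyContinuousOnInterval.sub ?_ ?_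
    · exact LipschitzOnWith.absolutelyContinuousOnInterval (hIcc ▸ hQL)
    · exact LipschitzOnWith.absolutelyContinuousOnInterval
        (hIcc ▸ lipschitzOnWith_integral (by positivity) hwi hwb)
  have hvI : IntervalIntegrable v volume 0 T :=
    (intervalIntegrable_iff_integrableOn_Icc_of_le hT.le).2 hi
  have hwI : IntervalIntegrable w volume 0 T :=
    (intervalIntegrable_iff_integrableOn_Icc_of_le hT.le).2 hwi
  obtain ⟨A, hA⟩ := hac.const_of_ae_hasDerivAt_zero (by
    filter_upwards [hvI.ae_hasDerivAt_integral, hwI.ae_hasDerivAt_integral] with t h1 h2 ht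
    have d1 : HasDerivAt V (v t) t := (h1 ht 0 left_mem_uIcc).const_add (u 0)
    have d3 := (hasDerivAt_quad B hB d1).sub (h2 ht 0 left_mem_uIcc)
    refine d3.congr_deriv ?_
    rw [hw]
    exact sub_self _)
  rw [hIcc] at hA
  have hcongr : ∀ t ∈ Icc 0 T, ∫ τ in (0 : ℝ)..t, (2 : ℝ) • B (u τ) (v τ)
      = ∫ τ in (0 : ℝ)..t, w τ := by
    intro t ht
    refine intervalIntegral.integral_congr fun τ hτ => ?_
    rw [uIcc_of_le ht.1] at hτ
    simp only [hw]
    rw [hVu τ ⟨hτ.1, hτ.2.trans ht.2⟩]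
  refine ⟨hwi.congr_fun (fun t ht => ?_) measurableSet_Icc, fun t ht => ?_⟩
  · simp only [hw]
    rw [hVu t ht]
  · have h1 := (hA t ht).trans (hA 0 h0).symm
    simp only [Pi.sub_apply, intervalIntegral.integral_same, sub_zero] at h1
    rw [hcongr t ht, hVu t ht, hVu 0 h0, ← h1]
    abel

end Curves

/-! ### Bounds in time -/

/-- Hölder's inequality in this form bounds the `L²` norm in time of a product by two `L⁴` norms. -/
instance holderTriple_four : ENNReal.HolderTriple 4 4 2 where
  inv_add_inv_eq_inv := by
    rw [show (4 : ℝ≥0∞) = 2 * 2 by norm_num, ENNReal.mul_inv (by simp) (by simp), ← mul_add,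
      ENNReal.inv_two_add_inv_two, mul_one]

theorem eLpNorm_two_le {E F : Type*} [NormedAddCommGroup E] [NormedAddCommGroup F]
    {μ : Measure ℝ} {u v : ℝ → E} (hu : AEStronglyMeasurable u μ) (hv : AEStronglyMeasurable v μ)
    {g : ℝ → F} {A : ℝ} (h : ∀ t, ‖g t‖ ≤ A * (‖v t‖ + ‖u t‖ * ‖v t‖)) :
    eLpNorm g 2 μ ≤ ENNReal.ofReal A * (eLpNorm v 2 μ + eLpNorm u 4 μ * eLpNorm v 4 μ) := by
  have h1 : eLpNorm g 2 μ ≤ ENNReal.ofReal A *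
      eLpNorm ((fun t => ‖v t‖) + (fun t => ‖u t‖) • fun t => ‖v t‖) 2 μ := by
    refine eLpNorm_le_mul_eLpNorm_of_ae_le_mul (Eventually.of_forall fun t => ?_) 2
    rw [Pi.add_apply, Pi.smul_apply', smul_eq_mul, Real.norm_of_nonneg (by positivity)]
    exact h t
  refine h1.trans (mul_le_mul_right ?_ _)
  refine (eLpNorm_add_le hv.norm (hu.norm.smul hv.norm) (by norm_num)).trans ?_
  rw [eLpNorm_norm]
  refine add_le_add le_rfl ?_
  refine (eLpNorm_smul_le_mul_eLpNorm (p := 4) (q := 4) (r := 2) hv.norm hu.norm).trans ?_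
  rw [eLpNorm_norm, eLpNorm_norm]

/-- The hypothesis is an identity in `L²`. The inclusion is continuous, linear and injective, so it
commutes with the integral and the identity lifts to the weighted space, where the operators of the
consistency error are bounded. -/
theorem eq_add_integral_of_isTimeDeriv {s : ℝ} (hs : 0 ≤ s) {T : ℝ} {u ut : ℝ → WSob s (2 * s)}
    (hut : IntegrableOn ut (Icc 0 T))
    (h : IsTimeDeriv T (fun t => (u t).incl) (fun t => (ut t).incl)) :
    ∀ t ∈ Icc 0 T, u t = u 0 + ∫ τ in (0 : ℝ)..t, ut τ := by
  intro t ht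
  have := completeSpace_wsob hs
  refine incl_injective ?_
  rw [← inclL_apply hs, ← inclL_apply hs, map_add]
  have hi : IntervalIntegrable ut volume 0 t :=
    (intervalIntegrable_iff_integrableOn_Icc_of_le ht.1).2
      (hut.mono_set (Icc_subset_Icc le_rfl ht.2))
  rw [← ContinuousLinearMap.intervalIntegral_comp_comm _ hi]
  exact h.2 t ht

theorem gradient_bounds {ℓ : ℝ} (hℓ : 0 < ℓ) (α β γ δ : ℝ) {s : ℝ} (hs : 2 ≤ s) :
    ∃ C : ℝ, 0 ≤ C ∧ ∀ n : ℕ, Odd n →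
      (∀ w : WSob s (2 * s), ∀ e, ‖∇ (funD ℓ n α β γ δ w.incl) e‖
        ≤ C * (n : ℝ) ^ (2 - s) * (‖w‖ + ‖w‖ * ‖w‖)) ∧
      ∀ T : ℝ, 0 < T → ∀ u ut : ℝ → WSob s (2 * s),
        MemLp u ⊤ (volume.restrict (Icc 0 T)) → MemLp ut ⊤ (volume.restrict (Icc 0 T)) →
        IsTimeDeriv T (fun t => (u t).incl) (fun t => (ut t).incl) →
        (∀ e : ℝ → L2, eLpNorm (fun t => ∇ (funD ℓ n α β γ δ (u t).incl) (e t)) 2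
            (volume.restrict (Icc 0 T))
          ≤ ENNReal.ofReal (C * (n : ℝ) ^ (2 - s)) * (eLpNorm u 2 (volume.restrict (Icc 0 T))
            + eLpNorm u 4 (volume.restrict (Icc 0 T)) ^ 2)) ∧
        ∃ w : ℝ → L2,
          (∀ e : L2, IsTimeDeriv T (fun t => ∇ (funD ℓ n α β γ δ (u t).incl) e) w) ∧
          eLpNorm w 2 (volume.restrict (Icc 0 T))
            ≤ ENNReal.ofReal (C * (n : ℝ) ^ (2 - s)) * (eLpNorm ut 2 (volume.restrict (Icc 0 T))
              + eLpNorm u 4 (volume.restrict (Icc 0 T))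
                * eLpNorm ut 4 (volume.restrict (Icc 0 T))) := by
  obtain ⟨C₁, hC₁, h₁⟩ := exists_linOp hℓ α β γ hs
  obtain ⟨C₂, hC₂, h₂⟩ := exists_quadOp hℓ hs
  have hs0 : 0 ≤ s := by linarith
  have hcomp := completeSpace_wsob hs0
  refine ⟨C₁ + 2 * |δ| * C₂, by positivity, fun n hn => ?_⟩
  obtain ⟨L, hL, hLn⟩ := h₁ n hn
  obtain ⟨B, hB, hBn⟩ := h₂ n hn
  have hsymm : ∀ x y, B x y = B y x := fun x y => by rw [hB, hB, quadErr_comm]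
  have hgrad : ∀ (w : WSob s (2 * s)) (e : L2), ∇ (funD ℓ n α β γ δ w.incl) e
      = L w + δ • B w w := fun w e => by rw [gradient_funD, hL, hB]
  set N : ℝ := (n : ℝ) ^ (2 - s)
  have hN : 0 ≤ N := by positivity
  have hb1 : ∀ w, ‖L w‖ ≤ C₁ * N * ‖w‖ := fun w =>
    (L.le_opNorm w).trans (mul_le_mul_of_nonneg_right hLn (norm_nonneg w))
  have hb2 : ∀ v w, ‖B v w‖ ≤ C₂ * N * (‖v‖ * ‖w‖) := fun v w => by
    refine (B.le_opNorm₂ v w).trans ?_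
    rw [mul_assoc]
    exact mul_le_mul_of_nonneg_right hBn (by positivity)
  -- Covers both uses: `a = δ`, `v = w = u` for the gradient and `a = 2δ`, `v = u`, `w = ut` for its
  -- time derivative.
  have hb3 : ∀ (a : ℝ) (v w : WSob s (2 * s)), |a| ≤ 2 * |δ| →
      ‖L w + a • B v w‖ ≤ (C₁ + 2 * |δ| * C₂) * N * (‖w‖ + ‖v‖ * ‖w‖) := by
    intro a v w ha
    refine (norm_add_le _ _).trans ?_
    rw [norm_smul, Real.norm_eq_abs]
    have e1 : |a| * ‖B v w‖ ≤ 2 * |δ| * (C₂ * N * (‖v‖ * ‖w‖)) :=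
      mul_le_mul ha (hb2 v w) (norm_nonneg _) (by positivity)
    have e2 : 0 ≤ C₁ * N * (‖v‖ * ‖w‖) := by positivity
    have e3 : 0 ≤ 2 * |δ| * C₂ * N * ‖w‖ := by positivity
    have e4 := hb1 w
    calc _ ≤ C₁ * N * ‖w‖ + 2 * |δ| * (C₂ * N * (‖v‖ * ‖w‖)) := add_le_add e4 e1
      _ ≤ C₁ * N * ‖w‖ + 2 * |δ| * (C₂ * N * (‖v‖ * ‖w‖)) + (C₁ * N * (‖v‖ * ‖w‖)
          + 2 * |δ| * C₂ * N * ‖w‖) := le_add_of_nonneg_right (add_nonneg e2 e3)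
      _ = _ := by ring
  have hδ : |δ| ≤ 2 * |δ| := by linarith [abs_nonneg δ]
  refine ⟨fun w e => ?_, fun T hT u ut hu hut htd => ⟨fun e => ?_, ?_⟩⟩
  · rw [hgrad]
    exact hb3 δ w w hδ
  · simp only [hgrad]
    rw [pow_two]
    exact eLpNorm_two_le hu.1 hu.1 fun t => hb3 δ (u t) (u t) hδ
  · have hfin : IsFiniteMeasure (volume.restrict (Icc (0 : ℝ) T)) :=
      ⟨by rw [Measure.restrict_apply_univ]; exact measure_Icc_lt_top⟩
    have huti : IntegrableOn ut (Icc 0 T) := hut.integrable le_top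
    have hcurve := eq_add_integral_of_isTimeDeriv hs0 huti htd
    obtain ⟨hqi, hq⟩ := quad_integral B hsymm hT hut hcurve
    have hLi : IntegrableOn (fun t => L (ut t)) (Icc 0 T) := L.integrable_comp huti
    refine ⟨fun t => L (ut t) + δ • ((2 : ℝ) • B (u t) (ut t)), fun e => ⟨?_, ?_⟩, ?_⟩
    · exact hLi.add (hqi.smul δ)
    · intro t ht
      have hii : ∀ {f : ℝ → L2}, IntegrableOn f (Icc 0 T) → IntervalIntegrable f volume 0 t :=
        fun hf => (intervalIntegrable_iff_integrableOn_Icc_of_le ht.1).2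
          (hf.mono_set (Icc_subset_Icc le_rfl ht.2))
      have hi : IntervalIntegrable ut volume 0 t :=
        (intervalIntegrable_iff_integrableOn_Icc_of_le ht.1).2
          (huti.mono_set (Icc_subset_Icc le_rfl ht.2))
      simp only [hgrad]
      have hsm : IntervalIntegrable (fun t => δ • ((2 : ℝ) • B (u t) (ut t))) volume 0 t :=
        (hii hqi).smul δ
      rw [intervalIntegral.integral_add (hii hLi) hsm, intervalIntegral.integral_smul, hq t ht, L.intervalIntegral_comp_comm hi]
      have e1 : L (u t) = L (u 0) + L (∫ τ in (0 : ℝ)..t, ut τ) := by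
        rw [hcurve t ht, map_add]
      rw [e1]
      module
    · refine eLpNorm_two_le hu.1 hut.1 fun t => ?_
      rw [smul_smul]
      refine hb3 (δ * 2) (u t) (ut t) (le_of_eq ?_)
      rw [abs_mul, abs_two, mul_comm]

/-! ### Bounds for the initial error -/

/-- The initial error is pure aliasing, bounded by the weighted `ℓ¹` tail of order `s - 1`. -/
theorem exists_initError_le {ℓ : ℝ} (hℓ : 0 < ℓ) {s : ℝ} (hs : 2 ≤ s) : ∃ C : ℝ, 0 ≤ C ∧
    ∀ n : ℕ, Odd n → ∀ u : WSob s (2 * s),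
      ‖initError ℓ n u.incl‖ ≤ C * (n : ℝ) ^ (1 - s) * ‖u‖ := by
  obtain ⟨C, hC, h⟩ := exists_wn_le hℓ hs
  have hs1 : 0 ≤ s - 1 := by linarith
  refine ⟨C, hC, fun n hn u => norm_le_of_enorm_le (by positivity) ?_⟩
  have h0 : wn 0 (coef ℓ (complexify u.incl)) < ⊤ :=
    ((wn_mono_exponent hs1 _).trans (h u)).trans_lt ENNReal.ofReal_lt_top
  refine (enorm_proj_sub_interp_le hℓ hn h0).trans ((wn_sub_trunc_le hs1 hn.pos _).trans ?_)
  rw [show C * (n : ℝ) ^ (1 - s) * ‖u‖ = (n : ℝ) ^ (-(s - 1)) * (C * ‖u‖) by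
    rw [neg_sub]; ring, ENNReal.ofReal_mul (by positivity)]
  exact mul_le_mul_right (h u) _

theorem initError_eq_sum {ℓ : ℝ} (hℓ : 0 < ℓ) {n : ℕ} (hn : Odd n) (w : L2) :
    ∃ a : Fin (n + 1) → ℝ, initError ℓ n w = ∑ k, a k • toL2 (christov ℓ k) := by
  refine ⟨fun k => inner ℝ w (toL2 (christov ℓ k)) - interpCoef ℓ n (contRep w) k, ?_⟩
  rw [initError, proj_eq_sum, interp_eq_sum hℓ hn, ← Finset.sum_sub_distrib]
  refine Finset.sum_congr rfl fun k _ => ?_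
  rw [sub_smul]

section Discrete

variable {ℓ : ℝ} {n : ℕ} {v : L2} {a : Fin (n + 1) → ℝ}

theorem sum_contRep_node_sq (hℓ : 0 < ℓ) (hn : Odd n)
    (hv : v = ∑ k, a k • toL2 (christov ℓ k)) :
    ∑ i : Fin (n + 1), contRep v (node ℓ n i) ^ 2 / weight ℓ n i = ‖v‖ ^ 2 := by
  rw [← norm_interp_sq hℓ hn, hv, contRep_sum_christov hℓ, interp_sum hℓ hn]

theorem inner_interp (hℓ : 0 < ℓ) (hn : Odd n) (hv : v = ∑ k, a k • toL2 (christov ℓ k))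
    (f : ℝ → ℝ) : inner ℝ v (interp ℓ n f)
      = ∑ i : Fin (n + 1), contRep v (node ℓ n i) * f (node ℓ n i) / weight ℓ n i := by
  have h : contRep v = ∑ k, a k • christov ℓ k := by rw [hv, contRep_sum_christov hℓ]
  rw [h, hv, inner_sum_interp hℓ hn]
  refine Finset.sum_congr rfl fun i _ => ?_
  congr 2
  simp [Finset.sum_apply]

/-- An inverse inequality: a single term of the quadrature sum for `‖v‖²` is at most the whole, and
the weights grow at most linearly in `n`. -/
theorem abs_contRep_node_le (hℓ : 0 < ℓ) (hn : Odd n) (hv : v = ∑ k, a k • toL2 (christov ℓ k))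
    (i : Fin (n + 1)) :
    |contRep v (node ℓ n i)| ≤ √2 * (√(2 * ℓ / Real.pi) / ℓ) * √n * ‖v‖ := by
  have h1 : contRep v (node ℓ n i) ^ 2 / weight ℓ n i ≤ ‖v‖ ^ 2 := by
    rw [← sum_contRep_node_sq hℓ hn hv]
    exact Finset.single_le_sum (f := fun i : Fin (n + 1) => contRep v (node ℓ n i) ^ 2
      / weight ℓ n i) (fun j _ => div_nonneg (sq_nonneg _) (weight_pos hℓ n j).le)
      (Finset.mem_univ i)
  rw [div_le_iff₀ (weight_pos hℓ n i)] at h1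
  have hn1 : (1 : ℝ) ≤ n := by exact_mod_cast hn.pos
  have h2 : weight ℓ n i ≤ 2 * n * (√(2 * ℓ / Real.pi) / ℓ) ^ 2 := by
    rw [weight]
    refine mul_le_mul (by linarith) ?_ (by positivity) (by positivity)
    exact pow_le_pow_left₀ (norm_nonneg _) (norm_mt_le hℓ 0 _) 2
  refine abs_le_of_sq_le_sq ?_ (by positivity)
  refine h1.trans ?_
  rw [mul_pow, mul_pow, mul_pow, Real.sq_sqrt (by norm_num), Real.sq_sqrt (by positivity)]
  calc _ ≤ ‖v‖ ^ 2 * (2 * n * (√(2 * ℓ / Real.pi) / ℓ) ^ 2) :=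
        mul_le_mul_of_nonneg_left h2 (by positivity)
    _ = _ := by ring

/-- The inner product is a quadrature sum with positive weights, from which the bound for `w` at the
nodes is taken out; the remaining sum is `‖v‖²`. -/
theorem abs_inner_interpSq_le (hℓ : 0 < ℓ) (hn : Odd n)
    (hv : v = ∑ k, a k • toL2 (christov ℓ k)) {b : Fin (n + 1) → ℝ} {w : L2}
    (hw : w = ∑ k, b k • toL2 (christov ℓ k)) {M : ℝ}
    (hM : ∀ i : Fin (n + 1), |contRep w (node ℓ n i)| ≤ M) :
    |inner ℝ w (interpSq ℓ n v)| ≤ M * ‖v‖ ^ 2 := by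
  rw [interpSq, inner_interp hℓ hn hw, ← sum_contRep_node_sq hℓ hn hv, Finset.mul_sum]
  refine (Finset.abs_sum_le_sum_abs _ _).trans (Finset.sum_le_sum fun i _ => ?_)
  rw [abs_div, abs_mul, abs_of_pos (weight_pos hℓ n i), abs_of_nonneg (sq_nonneg (contRep v _)),
    mul_div_assoc]
  exact mul_le_mul_of_nonneg_right (hM i) (div_nonneg (sq_nonneg _) (weight_pos hℓ n i).le)

end Discrete

/-- An inverse inequality: `∂ₓ` costs one power of `lam`, which is at most `n` on the truncated
sequence. -/
theorem norm_autJ_le {ℓ : ℝ} (hℓ : 0 < ℓ) {n : ℕ} (hn : Odd n) (v : L2) :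
    ‖autJ ℓ n v‖ ≤ 3 / ℓ * n * ‖v‖ := by
  refine norm_le_of_enorm_le (by positivity) ?_
  rw [enorm_eq_sn hℓ, coef_autJ hℓ hn, sn_neg]
  refine (sn_trunc_le 0 n _).trans ((sn_dseq_le hℓ le_rfl _).trans ?_)
  have h1 : sn 1 (trunc n (coef ℓ (complexify v)))
      ≤ ENNReal.ofReal n * sn 0 (coef ℓ (complexify v)) := by
    refine sn_le_mul fun j => ?_
    rw [trunc, Real.rpow_one, Real.rpow_zero, one_mul]
    split_ifs with h
    · exact mul_le_mul_of_nonneg_right h (norm_nonneg _)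
    · rw [norm_zero, mul_zero]
      positivity
  rw [← enorm_eq_sn hℓ, ← ofReal_norm] at h1
  rw [zero_add, Real.rpow_one, mul_assoc, ENNReal.ofReal_mul (by positivity),
    ENNReal.ofReal_mul (by positivity)]
  exact mul_le_mul_right h1 _

theorem integral_mul_eq_inner (f g : L2) : ∫ x, f x * g x = inner ℝ f g := by
  rw [L2.inner_def]
  congr 1
  ext x
  simp [mul_comm]

theorem integrable_mul_coeFn (f g : L2) : Integrable fun x => f x * g x :=
  (Lp.memLp f).integrable_mul (Lp.memLp g)

theorem hamG_eq (ℓ : ℝ) (n : ℕ) (α β γ δ : ℝ) (v : L2) :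
    hamG ℓ n α β γ δ v = 1 / 2 * (α * ‖v‖ ^ 2 - β * inner ℝ v (hilbert (autJ ℓ n v))
      + γ * ‖autJ ℓ n v‖ ^ 2 + 2 * δ / 3 * inner ℝ v (interpSq ℓ n v)) := by
  have i1 := (integrable_mul_coeFn v v).const_mul α
  have i2 := (integrable_mul_coeFn v (hilbert (autJ ℓ n v))).const_mul β
  have i3 := (integrable_mul_coeFn (autJ ℓ n v) (autJ ℓ n v)).const_mul γ
  have i4 := (integrable_mul_coeFn v (interpSq ℓ n v)).const_mul (2 * δ / 3)
  rw [hamG]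
  simp only [pow_two (_ : ℝ)]
  have e := integral_add ((i1.sub i2).add i3) i4
  rw [integral_add' (i1.sub i2) i3, integral_sub' i1 i2] at e
  simp only [Pi.add_apply, Pi.sub_apply] at e
  rw [e]
  simp only [integral_const_mul, integral_mul_eq_inner, real_inner_self_eq_norm_sq]
  simp only [pow_two]

/-- Each `autJ` contributes a factor `n`, and the cubic term a factor `√n` from the values at the
nodes. -/
theorem abs_hamG_le {ℓ : ℝ} (hℓ : 0 < ℓ) {n : ℕ} (hn : Odd n) (α β γ δ : ℝ) {v : L2}
    {a : Fin (n + 1) → ℝ} (hv : v = ∑ k, a k • toL2 (christov ℓ k)) :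
    |hamG ℓ n α β γ δ v| ≤ (|α| + |β| * (3 / ℓ) + |γ| * (3 / ℓ) ^ 2
      + |δ| * (√2 * (√(2 * ℓ / Real.pi) / ℓ))) * ((n * ‖v‖) ^ 2 + √n * ‖v‖ ^ 3) := by
  set κ : ℝ := √2 * (√(2 * ℓ / Real.pi) / ℓ)
  have hκ : 0 ≤ κ := by positivity
  set q : ℝ := 3 / ℓ
  have hq : 0 ≤ q := by positivity
  have hn1 : (1 : ℝ) ≤ n := by exact_mod_cast hn.pos
  have hJ := norm_autJ_le hℓ hn v
  have h2 : |inner ℝ v (hilbert (autJ ℓ n v))| ≤ ‖v‖ * (q * n * ‖v‖) :=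
    (abs_real_inner_le_norm _ _).trans (mul_le_mul_of_nonneg_left
      ((norm_hilbert_le _).trans hJ) (norm_nonneg _))
  have h4 := abs_inner_interpSq_le hℓ hn hv hv (abs_contRep_node_le hℓ hn hv)
  have h3 : ‖autJ ℓ n v‖ ^ 2 ≤ (q * n * ‖v‖) ^ 2 := pow_le_pow_left₀ (norm_nonneg _) hJ 2
  have hv0 := norm_nonneg v
  have hnn : (n : ℝ) ≤ n ^ 2 := by nlinarith
  set X := (n * ‖v‖) ^ 2
  set Y := √n * ‖v‖ ^ 3
  have hX : 0 ≤ X := by positivity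
  have hY : 0 ≤ Y := by positivity
  have b1 : |α * ‖v‖ ^ 2| ≤ |α| * X := by
    rw [abs_mul, abs_of_nonneg (sq_nonneg ‖v‖)]
    refine mul_le_mul_of_nonneg_left ?_ (abs_nonneg _)
    exact pow_le_pow_left₀ hv0 (by nlinarith) 2
  have b2 : |β * inner ℝ v (hilbert (autJ ℓ n v))| ≤ |β| * q * X := by
    rw [abs_mul, mul_assoc]
    refine mul_le_mul_of_nonneg_left (h2.trans ?_) (abs_nonneg _)
    calc ‖v‖ * (q * n * ‖v‖) = q * ‖v‖ ^ 2 * n := by ring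
      _ ≤ q * ‖v‖ ^ 2 * n ^ 2 := mul_le_mul_of_nonneg_left hnn (by positivity)
      _ = q * X := by ring
  have b3 : |γ * ‖autJ ℓ n v‖ ^ 2| ≤ |γ| * q ^ 2 * X := by
    rw [abs_mul, abs_of_nonneg (sq_nonneg ‖autJ ℓ n v‖), mul_assoc]
    refine mul_le_mul_of_nonneg_left (h3.trans (le_of_eq ?_)) (abs_nonneg _)
    ring
  have b4 : |2 * δ / 3 * inner ℝ v (interpSq ℓ n v)| ≤ |δ| * κ * Y := by
    rw [abs_mul]
    have e1 : |2 * δ / 3| ≤ |δ| := by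
      rw [abs_div, abs_mul, abs_two, abs_of_pos (by norm_num : (0 : ℝ) < 3)]
      linarith [abs_nonneg δ]
    refine (mul_le_mul e1 h4 (abs_nonneg _) (abs_nonneg _)).trans (le_of_eq ?_)
    ring
  rw [hamG_eq, abs_mul, abs_of_pos (by norm_num : (0 : ℝ) < 1 / 2)]
  have b5 := (abs_add_le (α * ‖v‖ ^ 2 - β * inner ℝ v (hilbert (autJ ℓ n v))
    + γ * ‖autJ ℓ n v‖ ^ 2) (2 * δ / 3 * inner ℝ v (interpSq ℓ n v))).trans (add_le_add
      ((abs_add_le _ _).trans (add_le_add ((abs_sub _ _).trans (add_le_add b1 b2)) b3)) b4)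
  have c1 : 0 ≤ (|α| + |β| * q + |γ| * q ^ 2) * Y := by positivity
  have c2 : 0 ≤ |δ| * κ * X := by positivity
  have c3 := abs_nonneg (α * ‖v‖ ^ 2 - β * inner ℝ v (hilbert (autJ ℓ n v))
    + γ * ‖autJ ℓ n v‖ ^ 2 + 2 * δ / 3 * inner ℝ v (interpSq ℓ n v))
  calc _ ≤ |α| * X + |β| * q * X + |γ| * q ^ 2 * X + |δ| * κ * Y := by linarith
    _ ≤ |α| * X + |β| * q * X + |γ| * q ^ 2 * X + |δ| * κ * Y
        + ((|α| + |β| * q + |γ| * q ^ 2) * Y + |δ| * κ * X) :=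
        le_add_of_nonneg_right (add_nonneg c1 c2)
    _ = _ := by ring

theorem exists_contRep_proj_le {ℓ : ℝ} (hℓ : 0 < ℓ) {s : ℝ} (hs : 2 ≤ s) : ∃ C : ℝ, 0 ≤ C ∧
    ∀ n : ℕ, Odd n → ∀ (u : WSob s (2 * s)) (x : ℝ),
      |contRep (proj ℓ n u.incl) x| ≤ C * ‖u‖ := by
  obtain ⟨C, hC, h⟩ := exists_wn_le hℓ hs
  refine ⟨√(2 * ℓ / Real.pi) / ℓ * C, by positivity, fun n hn u x => ?_⟩
  refine (abs_contRep_le hℓ (wn_proj_lt_top hℓ hn 0 u.incl) x).trans ?_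
  rw [mul_assoc]
  refine mul_le_mul_of_nonneg_left ?_ (by positivity)
  refine ENNReal.toReal_le_of_le_ofReal (by positivity) (le_trans ?_ (h u))
  rw [coef_proj hℓ hn]
  exact (wn_mono (norm_trunc_le n _)).trans (wn_mono_exponent (by linarith) _)

/-! ### Powers of `n` -/

/-- The exponents are compared at the base `n ≥ 1`, because `ℓn/2` may be less than `1`; the
constant `(ℓ/2)^(-b)` then changes the base. -/
theorem natCast_rpow_le {ℓ : ℝ} (hℓ : 0 < ℓ) {n : ℕ} (hn : Odd n) {a b : ℝ} (hab : a ≤ b) :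
    (n : ℝ) ^ a ≤ (ℓ / 2) ^ (-b) * (ℓ * n / 2) ^ b := by
  have hn1 : (1 : ℝ) ≤ n := by exact_mod_cast hn.pos
  rw [show ℓ * n / 2 = ℓ / 2 * n by ring, Real.mul_rpow (by positivity) (by positivity),
    ← mul_assoc, ← Real.rpow_add (by positivity), neg_add_cancel, Real.rpow_zero, one_mul]
  exact Real.rpow_le_rpow_of_exponent_le hn1 hab

theorem rpow_half_le {x A Y : ℝ} (hA : 0 ≤ A) (hY : 0 ≤ Y) (h : |x| ≤ A * Y ^ 2) :
    |x| ^ (1 / 2 : ℝ) ≤ √A * Y := by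
  rw [← Real.sqrt_eq_rpow]
  refine (Real.sqrt_le_sqrt h).trans (le_of_eq ?_)
  rw [Real.sqrt_mul hA, Real.sqrt_sq hY]

theorem sq_rpow_three_half {U : ℝ} (hU : 0 ≤ U) : (U ^ (3 / 2 : ℝ)) ^ 2 = U ^ 3 := by
  rw [← Real.rpow_natCast, ← Real.rpow_mul hU, ← Real.rpow_natCast]
  norm_num

/-- For `U ≤ 1` the square dominates the cube, for `U ≥ 1` the power `10/3` does. -/
theorem pow_three_le {U : ℝ} (hU : 0 ≤ U) : U ^ 3 ≤ U ^ 2 + (U ^ (5 / 3 : ℝ)) ^ 2 := by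
  rcases le_total U 1 with h | h
  · have h1 : U ^ 3 ≤ U ^ 2 := pow_le_pow_of_le_one hU h (by norm_num)
    have h2 := sq_nonneg (U ^ (5 / 3 : ℝ))
    linarith
  · have h1 : U ^ 3 ≤ (U ^ (5 / 3 : ℝ)) ^ 2 := by
      rw [← Real.rpow_natCast, ← Real.rpow_natCast, ← Real.rpow_mul hU]
      exact Real.rpow_le_rpow_of_exponent_le h (by norm_num)
    have h2 := sq_nonneg U
    linarith

/-! ### The four estimates at time zero -/

theorem exists_initError_bound {ℓ : ℝ} (hℓ : 0 < ℓ) {s : ℝ} (hs : 2 ≤ s) {b : ℝ}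
    (hb : 1 - s ≤ b) : ∃ C : ℝ, 0 ≤ C ∧ ∀ n : ℕ, Odd n → ∀ u : WSob s (2 * s),
      ‖initError ℓ n u.incl‖ ≤ C * (ℓ * n / 2) ^ b * ‖u‖ := by
  obtain ⟨C, hC, h⟩ := exists_initError_le hℓ hs
  refine ⟨C * (ℓ / 2) ^ (-b), by positivity, fun n hn u => (h n hn u).trans ?_⟩
  refine mul_le_mul_of_nonneg_right ?_ (norm_nonneg _)
  rw [mul_assoc]
  exact mul_le_mul_of_nonneg_left (natCast_rpow_le hℓ hn hb) hC

theorem exists_hamG_bound {ℓ : ℝ} (hℓ : 0 < ℓ) (α β γ δ : ℝ) {s : ℝ} (hs : 2 ≤ s) {b : ℝ}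
    (hb : 2 - s ≤ b) : ∃ C : ℝ, 0 ≤ C ∧ ∀ n : ℕ, Odd n → ∀ u : WSob s (2 * s),
      |hamG ℓ n α β γ δ (-initError ℓ n u.incl)| ^ (1 / 2 : ℝ)
        ≤ C * (ℓ * n / 2) ^ b * (‖u‖ + ‖u‖ ^ (5 / 3 : ℝ)) := by
  obtain ⟨C, hC, h⟩ := exists_initError_le hℓ hs
  set K : ℝ := |α| + |β| * (3 / ℓ) + |γ| * (3 / ℓ) ^ 2
      + |δ| * (√2 * (√(2 * ℓ / Real.pi) / ℓ)) with hK
  have hK0 : 0 ≤ K := by positivity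
  refine ⟨√(K * (2 * (C ^ 2 + C ^ 3))) * (ℓ / 2) ^ (-b), by positivity, fun n hn u => ?_⟩
  obtain ⟨a, ha⟩ := initError_eq_sum hℓ hn u.incl
  have hv : -initError ℓ n u.incl = ∑ k, (-a k) • toL2 (christov ℓ k) := by
    rw [ha, ← Finset.sum_neg_distrib]
    exact Finset.sum_congr rfl fun k _ => (neg_smul _ _).symm
  have h1 := abs_hamG_le hℓ hn α β γ δ hv
  rw [norm_neg, ← hK] at h1
  have hn1 : (1 : ℝ) ≤ n := by exact_mod_cast hn.pos
  have hn0 : (0 : ℝ) < n := by linarith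
  set U := ‖u‖
  have hU : 0 ≤ U := norm_nonneg u
  set e := ‖initError ℓ n u.incl‖
  have he0 : 0 ≤ e := norm_nonneg _
  have he : e ≤ C * (n : ℝ) ^ (1 - s) * U := h n hn u
  set N : ℝ := (n : ℝ) ^ (2 - s) with hN
  have hN0 : 0 ≤ N := by positivity
  have e1 : (n * e) ^ 2 ≤ C ^ 2 * (N ^ 2 * U ^ 2) := by
    have h2 : n * e ≤ C * N * U := by
      have : (n : ℝ) * (n : ℝ) ^ (1 - s) = N := by
        rw [hN, show (2 : ℝ) - s = 1 + (1 - s) by ring, Real.rpow_add hn0, Real.rpow_one]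
      calc (n : ℝ) * e ≤ n * (C * (n : ℝ) ^ (1 - s) * U) :=
            mul_le_mul_of_nonneg_left he hn0.le
        _ = C * ((n : ℝ) * (n : ℝ) ^ (1 - s)) * U := by ring
        _ = _ := by rw [this]
    refine (pow_le_pow_left₀ (by positivity) h2 2).trans (le_of_eq ?_)
    ring
  have e2 : √n * e ^ 3 ≤ C ^ 3 * (N ^ 2 * U ^ 3) := by
    -- The comparison of exponents `1/2 + 3(1 - s) ≤ 2(2 - s)` amounts to `s ≥ -1/2`, so the cubic
    -- term does not worsen the rate.
    have h2 : √n * ((n : ℝ) ^ (1 - s)) ^ 3 ≤ N ^ 2 := by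
      rw [hN, Real.sqrt_eq_rpow, ← Real.rpow_natCast, ← Real.rpow_natCast, ← Real.rpow_mul hn0.le,
        ← Real.rpow_mul hn0.le, ← Real.rpow_add hn0]
      refine Real.rpow_le_rpow_of_exponent_le hn1 ?_
      push_cast
      linarith
    calc √n * e ^ 3 ≤ √n * (C * (n : ℝ) ^ (1 - s) * U) ^ 3 :=
          mul_le_mul_of_nonneg_left (pow_le_pow_left₀ he0 he 3) (Real.sqrt_nonneg _)
      _ = C ^ 3 * U ^ 3 * (√n * ((n : ℝ) ^ (1 - s)) ^ 3) := by ring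
      _ ≤ C ^ 3 * U ^ 3 * N ^ 2 := mul_le_mul_of_nonneg_left h2 (by positivity)
      _ = _ := by ring
  set V := U ^ (5 / 3 : ℝ)
  have hV : 0 ≤ V := by positivity
  have e3 := pow_three_le hU
  have e4 : |hamG ℓ n α β γ δ (-initError ℓ n u.incl)|
      ≤ K * (2 * (C ^ 2 + C ^ 3)) * (N * (U + V)) ^ 2 := by
    refine h1.trans ?_
    rw [mul_assoc K]
    refine mul_le_mul_of_nonneg_left ((add_le_add e1 e2).trans ?_) hK0
    have f0 : U ^ 2 + V ^ 2 ≤ (U + V) ^ 2 := by nlinarith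
    have f1 : U ^ 2 ≤ 2 * (U + V) ^ 2 := by nlinarith [sq_nonneg V]
    have f2 : U ^ 3 ≤ 2 * (U + V) ^ 2 := by nlinarith [sq_nonneg (U + V)]
    calc _ ≤ C ^ 2 * (N ^ 2 * (2 * (U + V) ^ 2)) + C ^ 3 * (N ^ 2 * (2 * (U + V) ^ 2)) :=
          add_le_add
            (mul_le_mul_of_nonneg_left (mul_le_mul_of_nonneg_left f1 (by positivity))
              (by positivity))
            (mul_le_mul_of_nonneg_left (mul_le_mul_of_nonneg_left f2 (by positivity))
              (by positivity))
      _ = _ := by ring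
  refine (rpow_half_le (by positivity) (by positivity) e4).trans ?_
  rw [← mul_assoc, mul_assoc _ ((ℓ / 2) ^ (-b))]
  refine mul_le_mul_of_nonneg_right ?_ (by positivity)
  exact mul_le_mul_of_nonneg_left (natCast_rpow_le hℓ hn hb) (by positivity)

/-- The functional is quadratic in the initial error, and the values of the projection of `u` at the
nodes are bounded by its norm uniformly in `n`; so the square root keeps the rate `n^(1-s)`. -/
theorem exists_funE_bound {ℓ : ℝ} (hℓ : 0 < ℓ) (δ : ℝ) {s : ℝ} (hs : 2 ≤ s) {b : ℝ}
    (hb : 1 - s ≤ b) : ∃ C : ℝ, 0 ≤ C ∧ ∀ n : ℕ, Odd n → ∀ u : WSob s (2 * s),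
      |funE ℓ n δ u.incl (initError ℓ n u.incl)| ^ (1 / 2 : ℝ)
        ≤ C * (ℓ * n / 2) ^ b * ‖u‖ ^ (3 / 2 : ℝ) := by
  obtain ⟨C, hC, h⟩ := exists_initError_le hℓ hs
  obtain ⟨C', hC', h'⟩ := exists_contRep_proj_le hℓ hs
  refine ⟨√(2 * |δ| * (C' * C ^ 2)) * (ℓ / 2) ^ (-b), by positivity, fun n hn u => ?_⟩
  obtain ⟨a, ha⟩ := initError_eq_sum hℓ hn u.incl
  have h1 := abs_inner_interpSq_le hℓ hn ha (proj_eq_sum ℓ n u.incl)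
    fun i => h' n hn u (node ℓ n i)
  have e4 : |funE ℓ n δ u.incl (initError ℓ n u.incl)|
      ≤ 2 * |δ| * (C' * C ^ 2) * ((n : ℝ) ^ (1 - s) * ‖u‖ ^ (3 / 2 : ℝ)) ^ 2 := by
    rw [funE, abs_mul, abs_mul, abs_two, mul_pow, sq_rpow_three_half (norm_nonneg u), mul_assoc
      (2 * |δ|)]
    refine mul_le_mul_of_nonneg_left (h1.trans ?_) (by positivity)
    calc _ ≤ C' * ‖u‖ * (C * (n : ℝ) ^ (1 - s) * ‖u‖) ^ 2 :=
          mul_le_mul_of_nonneg_left (pow_le_pow_left₀ (norm_nonneg _) (h n hn u) 2)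
            (by positivity)
      _ = _ := by ring
  refine (rpow_half_le (by positivity) (by positivity) e4).trans ?_
  rw [← mul_assoc, mul_assoc _ ((ℓ / 2) ^ (-b))]
  refine mul_le_mul_of_nonneg_right ?_ (by positivity)
  exact mul_le_mul_of_nonneg_left (natCast_rpow_le hℓ hn hb) (by positivity)

/-- Cauchy-Schwarz pairs the initial error, of size `n^(1-s)`, with the consistency error, of size
`n^(2-s)`; the square root of the product is `n^(3/2-s)`. -/
theorem exists_funD_bound {ℓ : ℝ} (hℓ : 0 < ℓ) (α β γ δ : ℝ) {s : ℝ} (hs : 2 ≤ s) {b : ℝ}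
    (hb : 3 / 2 - s ≤ b) : ∃ C : ℝ, 0 ≤ C ∧ ∀ n : ℕ, Odd n → ∀ u : WSob s (2 * s),
      |funD ℓ n α β γ δ u.incl (initError ℓ n u.incl)| ^ (1 / 2 : ℝ)
        ≤ C * (ℓ * n / 2) ^ b * (‖u‖ + ‖u‖ ^ (3 / 2 : ℝ)) := by
  obtain ⟨C, hC, h⟩ := exists_initError_le hℓ hs
  obtain ⟨C', hC', h'⟩ := gradient_bounds hℓ α β γ δ hs
  refine ⟨√(C * C') * (ℓ / 2) ^ (-b), by positivity, fun n hn u => ?_⟩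
  have hn0 : (0 : ℝ) < n := by exact_mod_cast hn.pos
  have hg := (h' n hn).1 u (initError ℓ n u.incl)
  have hD : funD ℓ n α β γ δ u.incl (initError ℓ n u.incl) = inner ℝ (initError ℓ n u.incl)
      (∇ (funD ℓ n α β γ δ u.incl) (initError ℓ n u.incl)) := by
    rw [gradient_funD, funD_eq]
  set U := ‖u‖
  have hU : 0 ≤ U := norm_nonneg u
  set V := U ^ (3 / 2 : ℝ) with hV
  have hV0 : 0 ≤ V := by positivity
  have hV2 : V ^ 2 = U ^ 3 := sq_rpow_three_half hU
  have hN : (n : ℝ) ^ (1 - s) * (n : ℝ) ^ (2 - s) = ((n : ℝ) ^ (3 / 2 - s)) ^ 2 := by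
    rw [← Real.rpow_add hn0, ← Real.rpow_natCast, ← Real.rpow_mul hn0.le]
    congr 1
    push_cast
    ring
  have e4 : |funD ℓ n α β γ δ u.incl (initError ℓ n u.incl)|
      ≤ C * C' * ((n : ℝ) ^ (3 / 2 - s) * (U + V)) ^ 2 := by
    rw [hD]
    refine (abs_real_inner_le_norm _ _).trans ?_
    -- The left side is `U² + U³ = U² + V²`.
    have f : U * (U + U * U) ≤ (U + V) ^ 2 := by nlinarith
    calc _ ≤ (C * (n : ℝ) ^ (1 - s) * U) * (C' * (n : ℝ) ^ (2 - s) * (U + U * U)) :=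
          mul_le_mul (h n hn u) hg (norm_nonneg _) (by positivity)
      _ = C * C' * ((n : ℝ) ^ (1 - s) * (n : ℝ) ^ (2 - s)) * (U * (U + U * U)) := by ring
      _ ≤ C * C' * ((n : ℝ) ^ (1 - s) * (n : ℝ) ^ (2 - s)) * (U + V) ^ 2 :=
          mul_le_mul_of_nonneg_left f (by positivity)
      _ = _ := by rw [hN]; ring
  refine (rpow_half_le (by positivity) (by positivity) e4).trans ?_
  rw [← mul_assoc, mul_assoc _ ((ℓ / 2) ^ (-b))]
  refine mul_le_mul_of_nonneg_right ?_ (by positivity)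
  exact mul_le_mul_of_nonneg_left (natCast_rpow_le hℓ hn hb) (by positivity)

end MTC

end

theorem lemma4p7 (ℓ : ℝ) (hℓ : 0 < ℓ) (α β γ δ : ℝ) (s : ℝ) (hs : 2 ≤ s) (ε : ℝ) (hε : 0 < ε) :
    ∃ c : ℝ, 0 < c ∧
      ∀ (n : ℕ) (_ : Odd n) (T : ℝ) (_ : 0 < T) (u ut : ℝ → MTC.WSob s (2 * s))
        (_ : MemLp u ∞ (volume.restrict (Icc 0 T)))
        (_ : MemLp ut ∞ (volume.restrict (Icc 0 T)))
        (_ : MTC.IsTimeDeriv T (fun t => (u t).incl) (fun t => (ut t).incl)),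
        ‖MTC.initError ℓ n (u 0).incl‖
            ≤ c * (ℓ * n / 2) ^ (3 / 2 + ε - s) * ‖u 0‖ ∧
        |MTC.hamG ℓ n α β γ δ (-MTC.initError ℓ n (u 0).incl)| ^ (1 / 2 : ℝ)
            ≤ c * (ℓ * n / 2) ^ (5 / 2 + ε - s) * (‖u 0‖ + ‖u 0‖ ^ (5 / 3 : ℝ)) ∧
        |MTC.funE ℓ n δ (u 0).incl (MTC.initError ℓ n (u 0).incl)| ^ (1 / 2 : ℝ)
            ≤ c * (ℓ * n / 2) ^ (3 / 2 + ε - s) * ‖u 0‖ ^ (3 / 2 : ℝ) ∧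
        |MTC.funD ℓ n α β γ δ (u 0).incl (MTC.initError ℓ n (u 0).incl)| ^ (1 / 2 : ℝ)
            ≤ c * (ℓ * n / 2) ^ ((7 + 2 * ε) / 4 - s) * (‖u 0‖ + ‖u 0‖ ^ (3 / 2 : ℝ)) ∧
        (∀ e : ℝ → MTC.L2,
          eLpNorm (fun t => ∇ (MTC.funD ℓ n α β γ δ (u t).incl) (e t)) 2
              (volume.restrict (Icc 0 T))
            ≤ ENNReal.ofReal (c * (ℓ * n / 2) ^ (2 - s))
              * (eLpNorm u 2 (volume.restrict (Icc 0 T))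
                + eLpNorm u 4 (volume.restrict (Icc 0 T)) ^ 2)) ∧
        (∃ w : ℝ → MTC.L2,
          (∀ e : MTC.L2,
            MTC.IsTimeDeriv T (fun t => ∇ (MTC.funD ℓ n α β γ δ (u t).incl) e) w) ∧
          eLpNorm w 2 (volume.restrict (Icc 0 T))
            ≤ ENNReal.ofReal (c * (ℓ * n / 2) ^ (2 - s))
              * (eLpNorm ut 2 (volume.restrict (Icc 0 T))
                + eLpNorm u 4 (volume.restrict (Icc 0 T))
                  * eLpNorm ut 4 (volume.restrict (Icc 0 T)))) := by
  -- The exponents available are `1 - s`, `2 - s`, `1 - s` and `3/2 - s`, all below the ones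
  -- asserted.
  obtain ⟨C₁, hC₁, h₁⟩ := MTC.exists_initError_bound hℓ hs (b := 3 / 2 + ε - s) (by linarith)
  obtain ⟨C₂, hC₂, h₂⟩ := MTC.exists_hamG_bound hℓ α β γ δ hs (b := 5 / 2 + ε - s) (by linarith)
  obtain ⟨C₃, hC₃, h₃⟩ := MTC.exists_funE_bound hℓ δ hs (b := 3 / 2 + ε - s) (by linarith)
  obtain ⟨C₄, hC₄, h₄⟩ := MTC.exists_funD_bound hℓ α β γ δ hs (b := (7 + 2 * ε) / 4 - s)
    (by linarith)
  obtain ⟨C₅, hC₅, h₅⟩ := MTC.gradient_bounds hℓ α β γ δ hs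
  have hC₆ : 0 ≤ C₅ * (ℓ / 2) ^ (-(2 - s)) := by positivity
  set C₆ := C₅ * (ℓ / 2) ^ (-(2 - s)) with hC₆'
  -- The summand `1` makes the constant positive, as the others are only known to be nonnegative.
  set c := C₁ + C₂ + C₃ + C₄ + C₆ + 1 with hc
  refine ⟨c, by positivity, fun n hn T hT u ut hu hut htd => ?_⟩
  have mono : ∀ {C b Y : ℝ}, C ≤ c → 0 ≤ Y → C * (ℓ * n / 2) ^ b * Y ≤ c * (ℓ * n / 2) ^ b * Y :=
    fun hCc hY => mul_le_mul_of_nonneg_right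
      (mul_le_mul_of_nonneg_right hCc (by positivity)) hY
  have hN : ENNReal.ofReal (C₅ * (n : ℝ) ^ (2 - s))
      ≤ ENNReal.ofReal (c * (ℓ * n / 2) ^ (2 - s)) := by
    refine ENNReal.ofReal_le_ofReal ?_
    calc C₅ * (n : ℝ) ^ (2 - s) ≤ C₅ * ((ℓ / 2) ^ (-(2 - s)) * (ℓ * n / 2) ^ (2 - s)) :=
          mul_le_mul_of_nonneg_left (MTC.natCast_rpow_le hℓ hn le_rfl) hC₅
      _ = C₆ * (ℓ * n / 2) ^ (2 - s) := by rw [hC₆']; ring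
      _ ≤ _ := mul_le_mul_of_nonneg_right (by linarith) (by positivity)
  obtain ⟨b₅, w, hw, b₆⟩ := (h₅ n hn).2 T hT u ut hu hut htd
  exact ⟨(h₁ n hn (u 0)).trans (mono (by linarith) (by positivity)),
    (h₂ n hn (u 0)).trans (mono (by linarith) (by positivity)),
    (h₃ n hn (u 0)).trans (mono (by linarith) (by positivity)),
    (h₄ n hn (u 0)).trans (mono (by linarith) (by positivity)),
    fun e => (b₅ e).trans (mul_le_mul_left hN _), w, hw, b₆.trans (mul_le_mul_left hN _)⟩
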